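/- Let $\ell$ be an odd prime, $E$ a finite extension of $\mathbb{Q}_\ell$ with ring of integers $\mathcal{O}$, maximal ideal $\lambda$ and residue field $k$. Let $\mathcal{C}_{\mathcal{O}}$ be the category of complete Noetherian local $\mathcal{O}$-algebras $R$ with residue field $k$ (with maximal ideal $\mathfrak{m}_R$ and the $\mathfrak{m}_R$-adic topology). Let $n$ be an integer with $1\le n\le \ell$, and let $\mathcal{G}_n=(\mathrm{GL}_n\times\mathrm{GL}_1)\rtimes\{1,\mathfrak{c}\}$ with $\mathfrak{c}^2=1$, $\mathfrak{c}(g,a)\mathfrak{c}=(a\,{}^tg^{-1},a)$; let $\nu\colon\mathcal{G}_n\to\mathrm{GL}_1$ be given by $\nu(g,a)=a$, $\nu(\mathfrak{c})=-1$, and let $\mathcal{G}_n$ act on $\mathrm{M}_n$ by $\mathrm{ad}(g,a)(x)=gxg^{-1}$, $\mathrm{ad}(\mathfrak{c})(x)=-{}^tx$. Let $q\ge1$ be an integer coprime to $\ell$, let $\mathrm{T}_q=t^{\mathbb{Z}_\ell}\rtimes\phi_q^{\widehat{\mathbb{Z}}}$ be the $q$-tame group, with $\phi_q t\phi_q^{-1}=t^q$,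 and let $\mathrm{T}_{q^2}\subseteq\mathrm{T}_q$ be the subgroup topologically generated by $t$ and $\phi_q^2$. Let $\bar\varrho\colon\mathrm{T}_q\to\mathcal{G}_n(k)$ and $\mu\colon\mathrm{T}_q\to\mathcal{O}^\times$ be continuous homomorphisms such that $\bar\varrho^{-1}(\mathrm{GL}_n(k)\times k^\times)=\mathrm{T}_{q^2}$, $\nu\circ\bar\varrho=\mu\bmod\lambda$ and $\mu(t)=1$. A lifting of $\bar\varrho$ to $R\in\mathcal{C}_{\mathcal{O}}$ is a continuous homomorphism $\varrho\colon\mathrm{T}_q\to\mathcal{G}_n(R)$ with $\varrho\bmod\mathfrak{m}_R=\bar\varrho$ and $\nu\circ\varrho=\mu$. Write $\varrho(t)=(A,1)$ and $\bar\varrho(t)=(\bar A,1)$, and put $\bar X=\log\bar A=\sum_{i=1}^{n-1}(-1)^{i-1}(\bar A-1)^i/i$. The lifting $\varrho$ is minimally ramified if $A=\exp X=\sum_{i=0}^{n-1}X^i/i!$ for some $X\in\mathrm{M}_n(R)$ with $X^n=0$ that reduces to $\bar X$ and is of the form $X=CX_0C^{-1}$, where $C\in\mathrm{GL}_n(R)$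 and $X_0\in\mathrm{M}_n(\mathcal{O})$ is a matrix with $X_0^n=0$ whose Jordan type over $E$ (a partition of $n$) equals the Jordan type of $\bar X$ over $k$. Then there is a universal lifting of $\bar\varrho$, over a ring $\mathsf{R}^{\mathrm{loc}}$ in $\mathcal{C}_{\mathcal{O}}$, and the minimally ramified liftings are classified by a local deformation problem $\mathcal{D}^{\min}$, that is, by a closed formal subscheme $\mathrm{Spf}(\mathsf{R}^{\mathrm{loc}}/I)$ of $\mathrm{Spf}\,\mathsf{R}^{\mathrm{loc}}$ stable under conjugation by $1+\mathrm{M}_n(\mathfrak{m}_R)$ for all $R$. Moreover: 1. $\mathcal{D}^{\min}$ is formally smooth over $\mathrm{Spf}\,\mathcal{O}$ of pure relative dimension $n^2$. 2. Let $\mathrm{L}(\mathcal{D}^{\min})\subseteq\mathrm{H}^1(\mathrm{T}_q,\mathrm{ad}\,\bar\varrho)$ be the tangent space of $\mathcal{D}^{\min}$, that is, the image of the space of the continuous $1$-cocycles $\varphi$ for which the lifting $g\mapsto(1+\varepsilon\varphi(g))\bar\varrho(g)$ to $k[\varepsilon]/(\varepsilon^2)$ is a point of $\mathcal{D}^{\min}$.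 Then $\dim_k\mathrm{L}(\mathcal{D}^{\min})=\dim_k\mathrm{H}^0(\mathrm{T}_q,\mathrm{ad}\,\bar\varrho)$. -/

import Mathlib

universe u

noncomputable section IntegerRing

variable (ℓ : ℕ) [Fact ℓ.Prime] (E : Type u) [Field E] [Algebra ℚ_[ℓ] E]

/-- The ring of integers of `E`: the integral closure of `ℤ_ℓ` in `E`. -/
def padicIntegers : Subring E :=
  letI : Algebra ℤ_[ℓ] E := Algebra.compHom E (algebraMap ℤ_[ℓ] ℚ_[ℓ])
  (integralClosure ℤ_[ℓ] E).toSubring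

theorem mem_padicIntegers_iff [FiniteDimensional ℚ_[ℓ] E] (x : E) :
    x ∈ padicIntegers ℓ E ↔ spectralNorm ℚ_[ℓ] E x ≤ 1 := by
  let : Algebra ℤ_[ℓ] E := Algebra.compHom E (algebraMap ℤ_[ℓ] ℚ_[ℓ])
  have : IsScalarTower ℤ_[ℓ] ℚ_[ℓ] E := IsScalarTower.of_algebraMap_eq (fun _ => rfl)
  have hx : IsIntegral ℚ_[ℓ] x := Algebra.IsIntegral.isIntegral x
  have key : spectralNorm ℚ_[ℓ] E x ≤ 1 ↔ ∀ i, ‖(minpoly ℚ_[ℓ] x).coeff i‖ ≤ 1 :=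
    spectralValue_le_one_iff (minpoly.monic hx)
  have hmem : x ∈ padicIntegers ℓ E ↔ IsIntegral ℤ_[ℓ] x := Iff.rfl
  rw [hmem, key]
  constructor
  · intro h i
    rw [minpoly.isIntegrallyClosed_eq_field_fractions' ℚ_[ℓ] h, Polynomial.coeff_map]
    exact PadicInt.norm_le_one _
  · intro h
    have hl : minpoly ℚ_[ℓ] x ∈ Polynomial.lifts (algebraMap ℤ_[ℓ] ℚ_[ℓ]) := by
      rw [Polynomial.lifts_iff_coeff_lifts]
      exact fun i => ⟨⟨_, h i⟩, rfl⟩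
    obtain ⟨p, hp, -, hm⟩ := Polynomial.lifts_and_natDegree_eq_and_monic hl (minpoly.monic hx)
    refine ⟨p, hm, ?_⟩
    have h0 := minpoly.aeval ℚ_[ℓ] x
    rw [← hp, Polynomial.aeval_map_algebraMap] at h0
    exact h0

instance [FiniteDimensional ℚ_[ℓ] E] : IsLocalRing (padicIntegers ℓ E) := by
  have hinv : ∀ x : padicIntegers ℓ E, spectralNorm ℚ_[ℓ] E (x : E) = 1 → IsUnit x := by
    intro x hx
    have h0 : (x : E) ≠ 0 := by
      intro h
      rw [h, spectralNorm_zero] at hx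
      exact zero_ne_one hx
    have hi : spectralNorm ℚ_[ℓ] E (x : E)⁻¹ = 1 := by
      have hm : spectralNorm ℚ_[ℓ] E ((x : E) * (x : E)⁻¹)
          = spectralNorm ℚ_[ℓ] E (x : E) * spectralNorm ℚ_[ℓ] E (x : E)⁻¹ :=
        spectralAlgNorm_mul _ _
      rw [mul_inv_cancel₀ h0, spectralNorm_one, hx, one_mul] at hm
      exact hm.symm
    exact IsUnit.of_mul_eq_one ⟨(x : E)⁻¹, (mem_padicIntegers_iff ℓ E _).2 hi.le⟩
      (Subtype.ext (mul_inv_cancel₀ h0))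
  refine { isUnit_or_isUnit_of_add_one := fun {a b} hab => ?_ }
  by_contra! hcon
  have ha : spectralNorm ℚ_[ℓ] E (a : E) < 1 :=
    lt_of_le_of_ne ((mem_padicIntegers_iff ℓ E _).1 a.2) fun h => hcon.1 (hinv a h)
  have hb : spectralNorm ℚ_[ℓ] E (b : E) < 1 :=
    lt_of_le_of_ne ((mem_padicIntegers_iff ℓ E _).1 b.2) fun h => hcon.2 (hinv b h)
  have hadd := isNonarchimedean_spectralNorm (K := ℚ_[ℓ]) (L := E) (a : E) (b : E)
  have h1 : (a : E) + (b : E) = 1 := by exact_mod_cast congrArg Subtype.val hab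
  rw [h1, spectralNorm_one] at hadd
  exact absurd (max_lt ha hb) (not_lt.2 hadd)

end IntegerRing


noncomputable section Tame

/-- The profinite completion `Ẑ` of `ℤ`, written multiplicatively, as a profinite group. -/
abbrev ZHatGrp : ProfiniteGrp.{0} :=
  ProfiniteGrp.ProfiniteCompletion.completion (GrpCat.of (Multiplicative ℤ))

/-- The underlying type of `Ẑ`, with its structure of a topological group. -/
def ZHat : Type := ZHatGrp

instance : Group ZHat := inferInstanceAs (Group ZHatGrp)
instance : TopologicalSpace ZHat := inferInstanceAs (TopologicalSpace ZHatGrp)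
instance : IsTopologicalGroup ZHat := inferInstanceAs (IsTopologicalGroup ZHatGrp)
instance : CompactSpace ZHat := inferInstanceAs (CompactSpace ZHatGrp)
instance : TotallyDisconnectedSpace ZHat := inferInstanceAs (TotallyDisconnectedSpace ZHatGrp)

/-- The canonical topological generator of `Ẑ`, the image of `1 ∈ ℤ`. -/
def ZHat.gen : ZHat :=
  ProfiniteGrp.ProfiniteCompletion.etaFn (GrpCat.of (Multiplicative ℤ))
    (Multiplicative.ofAdd (1 : ℤ))

variable (ℓ : ℕ) [Fact ℓ.Prime]

instance PadicInt.units_totallyDisconnected : TotallyDisconnectedSpace ℤ_[ℓ]ˣ := by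
  refine ⟨isTotallyDisconnected_of_image (f := (Units.val : ℤ_[ℓ]ˣ → ℤ_[ℓ]))
    Units.continuous_val.continuousOn Units.val_injective ?_⟩
  exact isTotallyDisconnected_of_totallyDisconnectedSpace _

variable {ℓ} {q : ℕ}

/-- A natural number `q` coprime to `ℓ`, as an `ℓ`-adic unit. -/
def frobUnit (hq : q.Coprime ℓ) : ℤ_[ℓ]ˣ :=
  (PadicInt.isUnit_iff.2 (PadicInt.norm_natCast_eq_one_iff.2 hq.symm)).unit

/-- The continuous homomorphism `Ẑ → ℤ_ℓˣ`, `z ↦ q ^ z`, extending `ℤ → ℤ_ℓˣ`, `m ↦ q ^ m`. -/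
def frobPow (hq : q.Coprime ℓ) : ZHat →ₜ* ℤ_[ℓ]ˣ :=
  (ProfiniteGrp.ProfiniteCompletion.lift (G := GrpCat.of (Multiplicative ℤ))
    (P := ProfiniteGrp.of ℤ_[ℓ]ˣ)
    (GrpCat.ofHom (zpowersHom ℤ_[ℓ]ˣ (frobUnit hq)))).hom

theorem frobPow_gen (hq : q.Coprime ℓ) : frobPow hq ZHat.gen = frobUnit hq := by
  have h := ProfiniteGrp.ProfiniteCompletion.lift_eta (G := GrpCat.of (Multiplicative ℤ))
    (P := ProfiniteGrp.of ℤ_[ℓ]ˣ) (GrpCat.ofHom (zpowersHom ℤ_[ℓ]ˣ (frobUnit hq)))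
  have h2 := CategoryTheory.ConcreteCategory.congr_hom h (Multiplicative.ofAdd (1 : ℤ))
  rw [CategoryTheory.ConcreteCategory.comp_apply] at h2
  have h3 : ∀ f : ZHatGrp ⟶ ProfiniteGrp.of ℤ_[ℓ]ˣ, ∀ g : ZHat →ₜ* ℤ_[ℓ]ˣ, g = f.hom →
      ∀ x : GrpCat.of ZHatGrp, x = ZHat.gen →
      (CategoryTheory.ConcreteCategory.hom ((CategoryTheory.forget₂ ProfiniteGrp.{0} GrpCat).map f))
        x = g ZHat.gen := by
    rintro f _ rfl _ rfl
    rfl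
  have h4 : CategoryTheory.ConcreteCategory.hom
      (ProfiniteGrp.ProfiniteCompletion.eta (GrpCat.of (Multiplicative ℤ)))
        (Multiplicative.ofAdd (1 : ℤ)) = ZHat.gen := rfl
  refine (h3 _ (frobPow hq) rfl _ h4).symm.trans (Eq.trans h2 ?_)
  change zpowersHom ℤ_[ℓ]ˣ (frobUnit hq) (Multiplicative.ofAdd (1 : ℤ)) = _
  simp

/-- The action of `Ẑ` on (the multiplicatively written group) `ℤ_ℓ` through `z ↦ q ^ z`. -/
def tameAction (hq : q.Coprime ℓ) : ZHat →* MulAut (Multiplicative ℤ_[ℓ]) :=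
  ((MulAutMultiplicative ℤ_[ℓ]).symm.toMonoidHom.comp
    (DistribMulAction.toAddAut ℤ_[ℓ]ˣ ℤ_[ℓ])).comp (frobPow hq).toMonoidHom

/-- The `q`-tame group `T_q = t^{ℤ_ℓ} ⋊ φ^{Ẑ}`, where `φ t φ⁻¹ = t ^ q`. -/
abbrev TameGroup (hq : q.Coprime ℓ) : Type :=
  Multiplicative ℤ_[ℓ] ⋊[tameAction hq] ZHat

namespace TameGroup

variable (hq : q.Coprime ℓ)

/-- The product topology. -/
instance : TopologicalSpace (TameGroup hq) :=
  TopologicalSpace.induced SemidirectProduct.equivProd inferInstance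

/-- The topological generator `t`. -/
def t : TameGroup hq := SemidirectProduct.inl (Multiplicative.ofAdd (1 : ℤ_[ℓ]))

/-- The topological generator `φ_q`. -/
def phi : TameGroup hq := SemidirectProduct.inr ZHat.gen

theorem phi_mul_t_mul_phi_inv : phi hq * t hq * (phi hq)⁻¹ = t hq ^ q := by
  have h : tameAction hq ZHat.gen (Multiplicative.ofAdd (1 : ℤ_[ℓ])) =
        Multiplicative.ofAdd (1 : ℤ_[ℓ]) ^ q := by
    change Multiplicative.ofAdd ((frobPow hq ZHat.gen) • (1 : ℤ_[ℓ])) = _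
    rw [frobPow_gen, Units.smul_def, smul_eq_mul, mul_one, ← ofAdd_nsmul, nsmul_eq_mul, mul_one]
    rfl
  rw [phi, t, ← map_inv, ← SemidirectProduct.inl_aut, h, map_pow]

theorem continuous_left : Continuous (fun x : TameGroup hq => x.left) :=
  continuous_fst.comp (continuous_induced_dom (f := SemidirectProduct.equivProd))

theorem continuous_right : Continuous (fun x : TameGroup hq => x.right) :=
  continuous_snd.comp (continuous_induced_dom (f := SemidirectProduct.equivProd))

theorem continuous_act {X : Type*} [TopologicalSpace X] {f : X → ZHat}
    {g : X → Multiplicative ℤ_[ℓ]} (hf : Continuous f) (hg : Continuous g) :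
    Continuous (fun x => tameAction hq (f x) (g x)) := by
  change Continuous (fun x =>
    Multiplicative.ofAdd (((frobPow hq (f x) : ℤ_[ℓ]ˣ) : ℤ_[ℓ]) * Multiplicative.toAdd (g x)))
  have h : Continuous (fun x => ((frobPow hq (f x) : ℤ_[ℓ]ˣ) : ℤ_[ℓ])) :=
    Units.continuous_val.comp ((frobPow hq).continuous_toFun.comp hf)
  exact continuous_ofAdd.comp (h.mul (continuous_toAdd.comp hg))

instance : IsTopologicalGroup (TameGroup hq) where
  continuous_mul := by
    have hl1 := (continuous_left hq).comp (continuous_fst (X := TameGroup hq) (Y := TameGroup hq))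
    have hl2 := (continuous_left hq).comp (continuous_snd (X := TameGroup hq) (Y := TameGroup hq))
    have hr1 := (continuous_right hq).comp (continuous_fst (X := TameGroup hq) (Y := TameGroup hq))
    have hr2 := (continuous_right hq).comp (continuous_snd (X := TameGroup hq) (Y := TameGroup hq))
    refine continuous_induced_rng.2 ?_
    refine ((hl1.mul (continuous_act hq hr1 hl2)).prodMk (hr1.mul hr2)).congr fun p => ?_
    simp [SemidirectProduct.equivProd]
  continuous_inv := by
    refine continuous_induced_rng.2 ?_
    refine ((continuous_act hq (continuous_right hq).inv (continuous_left hq).inv).prodMk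
      (continuous_right hq).inv).congr fun p => ?_
    simp [SemidirectProduct.equivProd]

/-- The subgroup `T_{q^b}` of `T_q`, topologically generated by `t` and `φ_q ^ b`. -/
def powSubgroup (b : ℕ) : Subgroup (TameGroup hq) :=
  (Subgroup.closure {t hq, phi hq ^ b}).topologicalClosure

end TameGroup

end Tame

noncomputable section GroupG

open Matrix

variable (n : ℕ) (R : Type*) [CommRing R]

/-- The automorphism `g ↦ ᵗg⁻¹` of `GL_n`. -/
def glContra : GL (Fin n) R →* GL (Fin n) R where
  toFun g :=
    ⟨(↑g⁻¹ : Matrix (Fin n) (Fin n) R)ᵀ, (↑g : Matrix (Fin n) (Fin n) R)ᵀ,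
      by rw [← transpose_mul, Units.mul_inv, transpose_one],
      by rw [← transpose_mul, Units.inv_mul, transpose_one]⟩
  map_one' := Units.ext (by simp)
  map_mul' g h := Units.ext (by simp [transpose_mul])

/-- The embedding of `GL_1` in `GL_n` as scalar matrices. -/
def glScalar : Rˣ →* GL (Fin n) R := Units.map (Matrix.scalar (Fin n)).toMonoidHom

theorem glContra_glContra (g : GL (Fin n) R) : glContra n R (glContra n R g) = g :=
  Units.ext (transpose_transpose (g : Matrix (Fin n) (Fin n) R))

theorem glContra_glScalar (a : Rˣ) : glContra n R (glScalar n R a) = (glScalar n R a)⁻¹ := by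
  refine Units.ext ?_
  rw [← map_inv]
  change (↑(glScalar n R a)⁻¹ : Matrix (Fin n) (Fin n) R)ᵀ = _
  rw [← map_inv]
  simp [glScalar]

theorem glScalar_comm (a : Rˣ) (g : GL (Fin n) R) :
    glScalar n R a * g = g * glScalar n R a :=
  Units.ext (Matrix.scalar_commute (a : R) (fun _ => Commute.all _ _) (g : Matrix (Fin n) (Fin n) R))

/-- The involution `(g, μ) ↦ (μ ᵗg⁻¹, μ)` of `GL_n × GL_1`. -/
def conjDual : MulAut (GL (Fin n) R × Rˣ) where
  toFun x := (glScalar n R x.2 * glContra n R x.1, x.2)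
  invFun x := (glScalar n R x.2 * glContra n R x.1, x.2)
  left_inv x := by
    ext1 <;> simp [glContra_glContra, glContra_glScalar]
  right_inv x := by
    ext1 <;> simp [glContra_glContra, glContra_glScalar]
  map_mul' x y := by
    refine Prod.ext ?_ rfl
    simp only [Prod.fst_mul, Prod.snd_mul, map_mul, mul_assoc]
    rw [← mul_assoc (glScalar n R y.2) (glContra n R x.1), glScalar_comm n R y.2, mul_assoc]

theorem conjDual_mul_self : conjDual n R * conjDual n R = 1 :=
  MulEquiv.ext fun x => (conjDual n R).left_inv x

/-- The action of `{1, 𝔠} = {1, -1}` on `GL_n × GL_1`, with `𝔠 = -1` acting through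
`(g, μ) ↦ (μ ᵗg⁻¹, μ)`. -/
def conjDualAction : ℤˣ →* MulAut (GL (Fin n) R × Rˣ) where
  toFun s := if s = 1 then 1 else conjDual n R
  map_one' := if_pos rfl
  map_mul' s s' := by
    rcases Int.units_eq_one_or s with rfl | rfl <;> rcases Int.units_eq_one_or s' with rfl | rfl <;>
      simp [conjDual_mul_self]

/-- The group `𝒢_n(R) = (GL_n(R) × GL_1(R)) ⋊ {1, 𝔠}`, where `{1, 𝔠}` is `ℤˣ = {1, -1}` and
`𝔠 (g, μ) 𝔠 = (μ ᵗg⁻¹, μ)`. -/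
abbrev GG : Type _ := (GL (Fin n) R × Rˣ) ⋊[conjDualAction n R] ℤˣ

namespace GG

variable {n R} {S : Type*} [CommRing S]

/-- The `GL_n`-component of an element of `𝒢_n(R)`. -/
def gl (x : GG n R) : GL (Fin n) R := x.left.1

/-- The embedding `g ↦ (g, 1) 1` of `GL_n(R)` in `𝒢_n(R)`. -/
def ofGL : GL (Fin n) R →* GG n R :=
  SemidirectProduct.inl.comp (MonoidHom.inl (GL (Fin n) R) Rˣ)

/-- The subgroup `GL_n(R) × R^×` of `𝒢_n(R)`. -/
def identityPart (n : ℕ) (R : Type*) [CommRing R] : Subgroup (GG n R) :=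
  (SemidirectProduct.rightHom : GG n R →* ℤˣ).ker

/-- The similitude character `ν : 𝒢_n(R) → R^×`: the projection to `GL_1` on `GL_n × GL_1`,
and `ν(𝔠) = -1`. -/
def nu : GG n R →* Rˣ where
  toFun x := x.left.2 * Units.map (Int.castRingHom R).toMonoidHom x.right
  map_one' := by simp
  map_mul' x y := by
    have h : ∀ (s : ℤˣ) (z : GL (Fin n) R × Rˣ), (conjDualAction n R s z).2 = z.2 := by
      intro s z
      rcases Int.units_eq_one_or s with rfl | rfl <;> simp [conjDualAction, conjDual]
    simp only [SemidirectProduct.mul_left, SemidirectProduct.mul_right, Prod.snd_mul, h, map_mul]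
    exact mul_mul_mul_comm _ _ _ _

theorem map_glContra (f : R →+* S) (g : GL (Fin n) R) :
    GeneralLinearGroup.map f (glContra n R g) = glContra n S (GeneralLinearGroup.map f g) :=
  Units.ext (by
    ext i j
    change f ((↑g⁻¹ : Matrix (Fin n) (Fin n) R) j i) =
      (↑(GeneralLinearGroup.map f g)⁻¹ : Matrix (Fin n) (Fin n) S) j i
    rw [← map_inv]
    rfl)

theorem map_glScalar (f : R →+* S) (a : Rˣ) :
    GeneralLinearGroup.map f (glScalar n R a) = glScalar n S (Units.map f.toMonoidHom a) :=
  Units.ext (by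
    ext i j
    by_cases h : i = j <;> simp [glScalar, h, Matrix.scalar_apply, Matrix.diagonal])

/-- The homomorphism `𝒢_n(R) → 𝒢_n(S)` induced by a ring homomorphism `R → S`. -/
def map (f : R →+* S) : GG n R →* GG n S :=
  SemidirectProduct.map
    (MonoidHom.prodMap (GeneralLinearGroup.map f) (Units.map f.toMonoidHom)) (MonoidHom.id ℤˣ)
    (by
      intro s
      refine MonoidHom.ext fun z => ?_
      rcases Int.units_eq_one_or s with rfl | rfl
      · simp
      · simp [conjDualAction, conjDual, map_glContra, map_glScalar])

/-- The topology on `𝒢_n(R)` for a topological ring `R`: the product topology of the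
topologies of the unit groups `GL_n(R)`, `R^×` and of the discrete group `{1, 𝔠}`. -/
instance [TopologicalSpace R] : TopologicalSpace (GG n R) :=
  TopologicalSpace.induced SemidirectProduct.equivProd inferInstance

/-- The adjoint action of `𝒢_n(R)` on `M_n(R)`: `ad(g, μ)(x) = g x g⁻¹` and `ad(𝔠)(x) = -ᵗx`. -/
def ad (x : GG n R) : Matrix (Fin n) (Fin n) R →ₗ[R] Matrix (Fin n) (Fin n) R where
  toFun X := (x.gl : Matrix (Fin n) (Fin n) R) * (if x.right = 1 then X else -Xᵀ) *
    (↑x.gl⁻¹ : Matrix (Fin n) (Fin n) R)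
  map_add' X Y := by split_ifs <;> simp [mul_add, add_mul]; abel
  map_smul' a X := by split_ifs <;> simp

end GG

end GroupG

noncomputable section Deformations

open IsLocalRing

/-- The category `𝒞_𝒪`: complete Noetherian local `𝒪`-algebras `R` for which `𝒪 → R` is local and
induces an isomorphism on residue fields. Its morphisms are the homomorphisms of `𝒪`-algebras;
these are automatically local. -/
structure CompleteLocalAlg (O : Type u) [CommRing O] [IsLocalRing O] where
  carrier : Type u
  [commRing : CommRing carrier]
  [algebra : Algebra O carrier]
  [isLocalRing : IsLocalRing carrier]
  [isNoetherianRing : IsNoetherianRing carrier]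
  [isAdicComplete : IsAdicComplete (maximalIdeal carrier) carrier]
  [isLocalHom : IsLocalHom (algebraMap O carrier)]
  residue_bijective : Function.Bijective (ResidueField.map (algebraMap O carrier))

namespace CompleteLocalAlg

instance (O : Type u) [CommRing O] [IsLocalRing O] :
    CoeSort (CompleteLocalAlg O) (Type u) := ⟨carrier⟩

attribute [instance] commRing algebra isLocalRing isNoetherianRing isAdicComplete isLocalHom

variable {O : Type u} [CommRing O] [IsLocalRing O]

/-- The map `k → R / 𝔪_R` (an isomorphism) induced by `𝒪 → R`, where `k` is the residue field
of `𝒪`. -/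
def resMap (R : CompleteLocalAlg O) : ResidueField O →+* ResidueField R :=
  ResidueField.map (algebraMap O R)

end CompleteLocalAlg

/-- Continuity of a homomorphism `Γ → 𝒢_n(R)` for the `𝔪_R`-adic topology on the local ring `R`
(which is discrete if `R` is a field). -/
def AdicContinuous {Γ : Type*} [Group Γ] [TopologicalSpace Γ] {n : ℕ} {R : Type*} [CommRing R]
    [IsLocalRing R] (r : Γ →* GG n R) : Prop :=
  letI : TopologicalSpace R := (maximalIdeal R).adicTopology
  Continuous r

/-- Continuity of a character `Γ → R^×` for the `𝔪_R`-adic topology on the local ring `R`. -/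
def AdicContinuousChar {Γ : Type*} [Group Γ] [TopologicalSpace Γ] {R : Type*} [CommRing R]
    [IsLocalRing R] (χ : Γ →* Rˣ) : Prop :=
  letI : TopologicalSpace R := (maximalIdeal R).adicTopology
  Continuous χ

variable {O : Type u} [CommRing O] [IsLocalRing O] {Γ : Type} [Group Γ] [TopologicalSpace Γ]
  {n : ℕ}

/-- `r` is a lifting of `rbar : Γ → 𝒢_n(k)`, with similitude character `χ`, to the object `R`. -/
structure IsLifting (rbar : Γ →* GG n (ResidueField O)) (χ : Γ →* Oˣ)
    (R : CompleteLocalAlg O) (r : Γ →* GG n R) : Prop where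
  continuous : AdicContinuous r
  reduction : ∀ g, GG.map (residue R) (r g) = GG.map R.resMap (rbar g)
  similitude : ∀ g, (r g).nu = Units.map (algebraMap O R).toMonoidHom (χ g)

/-- A universal lifting `r^univ : Γ → 𝒢_n(R^loc)`. -/
structure UniversalLifting (rbar : Γ →* GG n (ResidueField O)) (χ : Γ →* Oˣ) where
  ring : CompleteLocalAlg O
  lift : Γ →* GG n ring
  isLifting : IsLifting rbar χ ring lift
  universal : ∀ (R : CompleteLocalAlg O) (r : Γ →* GG n R), IsLifting rbar χ R r →
    ∃! f : ring →ₐ[O] R, ∀ g, GG.map f.toRingHom (lift g) = r g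

variable {rbar : Γ →* GG n (ResidueField O)} {χ : Γ →* Oˣ}

/-- For an ideal `I` of `R^loc`, the set of `R`-valued points of the closed formal subscheme
`Spf (R^loc / I)`, as a set of liftings. -/
def UniversalLifting.points (U : UniversalLifting rbar χ) (I : Ideal U.ring)
    (R : CompleteLocalAlg O) : Set (Γ →* GG n R) :=
  {r | ∃ f : U.ring →ₐ[O] R, I ≤ RingHom.ker f ∧ ∀ g, GG.map f.toRingHom (U.lift g) = r g}

/-- A local deformation problem: a (nonempty) closed formal subscheme of `Spf R^loc`, given by a
(proper, automatically closed) ideal of `R^loc`, that is stable under conjugation by the formal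
completion of `GL_n` along its unit section. -/
structure LocalDeformationProblem (U : UniversalLifting rbar χ) where
  ideal : Ideal U.ring
  ideal_le : ideal ≤ maximalIdeal U.ring
  stable : ∀ (R : CompleteLocalAlg O), ∀ r ∈ U.points ideal R, ∀ x : GL (Fin n) R,
    (∀ i j, ((x : Matrix (Fin n) (Fin n) R) - 1) i j ∈ maximalIdeal R) →
    (MulAut.conj (GG.ofGL x)).toMonoidHom.comp r ∈ U.points ideal R

/-- The element `1 + ε X` of `GL_n(k[ε])`. -/
def oneAddEps {k : Type*} [Field k] (X : Matrix (Fin n) (Fin n) k) :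
    GL (Fin n) (DualNumber k) where
  val := 1 + X.map TrivSqZeroExt.inr
  inv := 1 - X.map TrivSqZeroExt.inr
  val_inv := by
    have h : X.map (TrivSqZeroExt.inr : k → DualNumber k) * X.map TrivSqZeroExt.inr = 0 := by
      ext i j <;> simp [Matrix.mul_apply]
    rw [add_mul, one_mul, mul_sub, mul_one, h]; abel
  inv_val := by
    have h : X.map (TrivSqZeroExt.inr : k → DualNumber k) * X.map TrivSqZeroExt.inr = 0 := by
      ext i j <;> simp [Matrix.mul_apply]
    rw [sub_mul, one_mul, mul_add, mul_one, h]; abel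

/-- The element `(1 + ε X) y` of `𝒢_n(k[ε])`. -/
def epsLift {k : Type*} [Field k] (X : Matrix (Fin n) (Fin n) k) (y : GG n k) :
    GG n (DualNumber k) :=
  GG.ofGL (n := n) (R := DualNumber k) (oneAddEps X) *
    GG.map (n := n) (R := k) (S := DualNumber k) (TrivSqZeroExt.inlHom k k) y

section Cohomology

variable {k : Type*} [Field k] (r : Γ →* GG n k)

/-- `H^0(Γ, ad r)`. -/
def adH0 : Submodule k (Matrix (Fin n) (Fin n) k) :=
  ⨅ g, LinearMap.ker ((r g).ad - LinearMap.id)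

/-- The continuous (for the discrete topology on `M_n(k)`) `1`-cocycles of `Γ` with values in
`ad r`. -/
def adZ1 : Submodule k (Γ → Matrix (Fin n) (Fin n) k) where
  carrier := {φ | IsLocallyConstant φ ∧ ∀ g h, φ (g * h) = φ g + (r g).ad (φ h)}
  zero_mem' := ⟨IsLocallyConstant.const 0, by simp⟩
  add_mem' := by
    rintro φ ψ ⟨h1, h2⟩ ⟨h3, h4⟩
    refine ⟨h1.add h3, fun g h => ?_⟩
    simp only [Pi.add_apply, h2, h4, map_add]
    abel
  smul_mem' := by
    rintro a φ ⟨h1, h2⟩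
    exact ⟨h1.comp (fun X => a • X), fun g h => by simp [h2]⟩

/-- The `1`-coboundaries `g ↦ ad(r(g)) X - X`. -/
def adB1 : Submodule k (Γ → Matrix (Fin n) (Fin n) k) :=
  LinearMap.range (LinearMap.pi fun g => (r g).ad - LinearMap.id)

/-- `H^1(Γ, ad r)`. -/
abbrev adH1 : Type _ := adZ1 r ⧸ (adB1 r).submoduleOf (adZ1 r)

end Cohomology

theorem map_eq_epsLift_iff {k : Type*} [Field k] {R : Type*} [CommRing R]
    (f : R →+* DualNumber k) (x : GG n R) (X : Matrix (Fin n) (Fin n) k) (y : GG n k) :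
    GG.map f x = epsLift X y ↔
      (∀ i j, f ((x.gl : Matrix (Fin n) (Fin n) R) i j) =
        TrivSqZeroExt.inl ((y.gl : Matrix (Fin n) (Fin n) k) i j) +
        TrivSqZeroExt.inr ((X * (y.gl : Matrix (Fin n) (Fin n) k)) i j)) ∧
      f x.left.2 = TrivSqZeroExt.inl (y.left.2 : k) ∧ x.right = y.right := by
  have e1 : ∀ i j, ((epsLift X y).gl : Matrix (Fin n) (Fin n) (DualNumber k)) i j =
      TrivSqZeroExt.inl ((y.gl : Matrix (Fin n) (Fin n) k) i j) +
        TrivSqZeroExt.inr ((X * (y.gl : Matrix (Fin n) (Fin n) k)) i j) := by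
    intro i j
    have h0 : ((epsLift X y).gl : Matrix (Fin n) (Fin n) (DualNumber k)) =
        (1 + X.map TrivSqZeroExt.inr) *
          (y.gl : Matrix (Fin n) (Fin n) k).map TrivSqZeroExt.inl := by
      simp only [epsLift, GG.gl, GG.ofGL, GG.map]
      rfl
    have h00 : (X.map TrivSqZeroExt.inr * (y.gl : Matrix (Fin n) (Fin n) k).map TrivSqZeroExt.inl :
        Matrix (Fin n) (Fin n) (DualNumber k)) i j =
        TrivSqZeroExt.inr ((X * (y.gl : Matrix (Fin n) (Fin n) k)) i j) := by
      rw [Matrix.mul_apply, Matrix.mul_apply, TrivSqZeroExt.inr_sum]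
      refine Finset.sum_congr rfl fun l _ => ?_
      rw [Matrix.map_apply, Matrix.map_apply, TrivSqZeroExt.inr_mul_inl]
      rfl
    rw [h0, add_mul, one_mul, Matrix.add_apply, h00, Matrix.map_apply]
  have e2 : ((epsLift X y).left.2 : DualNumber k) = TrivSqZeroExt.inl (y.left.2 : k) := by
    simp [epsLift, GG.ofGL, GG.map]
  have e3 : (epsLift X y).right = y.right := by
    simp [epsLift, GG.ofGL, GG.map]
  constructor
  · intro h
    refine ⟨fun i j => ?_, ?_, ?_⟩
    · rw [← e1, ← h]; rfl
    · rw [← e2, ← h]; rfl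
    · rw [← e3, ← h]; rfl
  · rintro ⟨h1, h2, h3⟩
    refine SemidirectProduct.ext (Prod.ext (Units.ext ?_) (Units.ext ?_)) ?_
    · ext1 i j
      exact (h1 i j).trans (e1 i j).symm
    · exact h2.trans e2.symm
    · exact h3.trans e3.symm


namespace CompleteLocalAlg

/-- A homomorphism of `𝒪`-algebras `R → k` is the reduction modulo `𝔪_R`. -/
theorem algHom_residueField_unique (R : CompleteLocalAlg O) (f : R →ₐ[O] ResidueField O) (x : R) :
    R.resMap (f x) = residue R x := by
  obtain ⟨o, ho⟩ := residue_surjective (f x)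
  have h1 : f (x - algebraMap O R o) = 0 := by
    rw [map_sub, f.commutes, ← ho]
    exact sub_self _
  have h2 : residue R (x - algebraMap O R o) = 0 := by
    rw [residue_eq_zero_iff, mem_maximalIdeal]
    intro hu
    exact (hu.map f).ne_zero h1
  rw [map_sub, sub_eq_zero] at h2
  rw [h2, ← ho]
  rfl

/-- The reduction map `R → k`. -/
def red (R : CompleteLocalAlg O) : R →ₐ[O] ResidueField O where
  toRingHom := (RingEquiv.ofBijective R.resMap R.residue_bijective).symm.toRingHom.comp (residue R)
  commutes' o := by
    change (RingEquiv.ofBijective R.resMap R.residue_bijective).symm (residue R (algebraMap O R o)) = _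
    rw [RingEquiv.symm_apply_eq]
    rfl

theorem algHom_eq_red (R : CompleteLocalAlg O) (f : R →ₐ[O] ResidueField O) : f = R.red :=
  AlgHom.ext fun x => R.residue_bijective.1
    ((R.algHom_residueField_unique f x).trans (R.algHom_residueField_unique R.red x).symm)

/-- The `𝒪`-algebra homomorphism `R → k[ε]` given by a linear combination of the derivations
underlying two such homomorphisms. -/
def combine (R : CompleteLocalAlg O) (a : ResidueField O)
    (f g : R →ₐ[O] DualNumber (ResidueField O)) : R →ₐ[O] DualNumber (ResidueField O) :=
  AlgHom.ofLinearMap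
    { toFun := fun x => TrivSqZeroExt.inl (R.red x) +
        TrivSqZeroExt.inr (a * (f x).snd + (g x).snd)
      map_add' := fun x y => by
        ext <;> simp
        ring
      map_smul' := fun o x => by
        have hs : a * (f (o • x)).snd + (g (o • x)).snd = o • (a * (f x).snd + (g x).snd) := by
          rw [map_smul, map_smul, TrivSqZeroExt.snd_smul, TrivSqZeroExt.snd_smul, mul_smul_comm,
            smul_add]
        rw [hs, map_smul, TrivSqZeroExt.inl_smul, TrivSqZeroExt.inr_smul, RingHom.id_apply,
          smul_add] }
    (by ext <;> simp)
    (fun x y => by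
      have hf : ∀ z, (f z).fst = R.red z := fun z =>
        congrArg (fun h : R →ₐ[O] ResidueField O => h z)
          (R.algHom_eq_red ((TrivSqZeroExt.fstHom O _ _).comp f))
      have hg : ∀ z, (g z).fst = R.red z := fun z =>
        congrArg (fun h : R →ₐ[O] ResidueField O => h z)
          (R.algHom_eq_red ((TrivSqZeroExt.fstHom O _ _).comp g))
      ext
      · simp
      · simp [hf, hg]
        ring)

end CompleteLocalAlg


theorem IsLifting.map_inl_red {R : CompleteLocalAlg O} {r : Γ →* GG n R}
    (h : IsLifting rbar χ R r) (g : Γ) :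
    GG.map ((TrivSqZeroExt.inlAlgHom O (ResidueField O) (ResidueField O)).comp R.red).toRingHom
      (r g) = epsLift 0 (rbar g) := by
  have hr := h.reduction g
  have key : ∀ (x : R) (y : ResidueField O), residue R x = R.resMap y → R.red x = y :=
    fun x y hxy => (RingEquiv.symm_apply_eq (RingEquiv.ofBijective R.resMap R.residue_bijective)).2
      hxy
  rw [map_eq_epsLift_iff]
  refine ⟨fun i j => ?_, ?_, ?_⟩
  · have h1 : R.red ((r g).gl.val i j) = (rbar g).gl.val i j :=
      key _ _ (congrArg (fun z : GG n (ResidueField R) => (z.gl : Matrix (Fin n) (Fin n) (ResidueField R)) i j) hr)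
    rw [Matrix.zero_mul, Matrix.zero_apply, TrivSqZeroExt.inr_zero, add_zero, ← h1]
    rfl
  · have h1 : R.red (r g).left.2 = (rbar g).left.2 :=
      key _ _ (congrArg (fun z : GG n (ResidueField R) => (z.left.2 : ResidueField R)) hr)
    rw [← h1]
    rfl
  · exact congrArg (fun z : GG n (ResidueField R) => z.right) hr

theorem map_combine {R : CompleteLocalAlg O} (a : ResidueField O)
    {f g : R →ₐ[O] DualNumber (ResidueField O)} {x : GG n R}
    {X Y : Matrix (Fin n) (Fin n) (ResidueField O)} {y : GG n (ResidueField O)}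
    (hf : GG.map f.toRingHom x = epsLift X y) (hg : GG.map g.toRingHom x = epsLift Y y) :
    GG.map (R.combine a f g).toRingHom x = epsLift (a • X + Y) y := by
  have hred : ∀ z, R.red z = (f z).fst := fun z => (congrArg (fun h : R →ₐ[O] ResidueField O => h z)
    (R.algHom_eq_red ((TrivSqZeroExt.fstHom O _ _).comp f))).symm
  have hc : ∀ z, (R.combine a f g).toRingHom z = TrivSqZeroExt.inl (f z).fst +
      TrivSqZeroExt.inr (a * (f z).snd + (g z).snd) := fun z => by rw [← hred]; rfl
  rw [map_eq_epsLift_iff] at hf hg ⊢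
  refine ⟨fun i j => ?_, ?_, hf.2.2⟩
  · have h1 : f ((x.gl : Matrix (Fin n) (Fin n) R) i j) = _ := hf.1 i j
    have h2 : g ((x.gl : Matrix (Fin n) (Fin n) R) i j) = _ := hg.1 i j
    rw [hc, h1, h2, add_mul, Matrix.add_apply, Matrix.smul_mul, Matrix.smul_apply]
    ext <;> simp
  · have h1 : f (x.left.2 : R) = _ := hf.2.1
    have h2 : g (x.left.2 : R) = _ := hg.2.1
    rw [hc, h1, h2]
    ext <;> simp

theorem combine_ker {R : CompleteLocalAlg O} (a : ResidueField O)
    {f g : R →ₐ[O] DualNumber (ResidueField O)} {I : Ideal R}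
    (hf : I ≤ RingHom.ker f) (hg : I ≤ RingHom.ker g) : I ≤ RingHom.ker (R.combine a f g) := by
  intro z hz
  have h1 : f z = 0 := hf hz
  have h2 : g z = 0 := hg hz
  have h3 : R.red z = 0 := by
    rw [← R.algHom_eq_red ((TrivSqZeroExt.fstHom O _ _).comp f)]
    change (f z).fst = 0
    rw [h1, TrivSqZeroExt.fst_zero]
  change TrivSqZeroExt.inl (R.red z) + TrivSqZeroExt.inr (a * (f z).snd + (g z).snd) = 0
  rw [h1, h2, h3]
  ext <;> simp

/-- The subspace `L^1(𝒟) ⊆ Z^1(Γ, ad rbar)`: the cocycles `φ` for which `g ↦ (1 + ε φ(g)) rbar(g)`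
is the lifting to `k[ε]` given by a homomorphism `R^loc → k[ε]` that is trivial on the ideal of
`𝒟`, that is, by an element of `Hom_k(𝔪 / (𝔪², I, λ), k)`. -/
def LocalDeformationProblem.cocycles {U : UniversalLifting rbar χ}
    (D : LocalDeformationProblem U) : Submodule (ResidueField O) (adZ1 rbar) where
  carrier := {φ | ∃ f : U.ring →ₐ[O] DualNumber (ResidueField O), D.ideal ≤ RingHom.ker f ∧
    ∀ g, GG.map f.toRingHom (U.lift g) = epsLift (φ.1 g) (rbar g)}
  zero_mem' := by
    refine ⟨_, ?_, fun g => U.isLifting.map_inl_red g⟩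
    intro z hz
    have h1 : residue U.ring z = 0 := (residue_eq_zero_iff _).2 (D.ideal_le hz)
    have h2 : U.ring.red z = 0 := by
      refine U.ring.residue_bijective.1 ?_
      rw [map_zero]
      exact (U.ring.algHom_residueField_unique U.ring.red z).trans h1
    change TrivSqZeroExt.inl (U.ring.red z) = 0
    rw [h2, TrivSqZeroExt.inl_zero]
  add_mem' := by
    rintro φ ψ ⟨f, hf, hf'⟩ ⟨g, hg, hg'⟩
    refine ⟨U.ring.combine 1 f g, combine_ker 1 hf hg, fun x => ?_⟩
    rw [map_combine 1 (hf' x) (hg' x), one_smul]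
    rfl
  smul_mem' := by
    rintro a φ ⟨f, hf, hf'⟩
    refine ⟨U.ring.combine (a - 1) f f, combine_ker _ hf hf, fun x => ?_⟩
    rw [map_combine _ (hf' x) (hf' x), sub_smul, one_smul, sub_add_cancel]
    rfl

/-- The tangent space `L(𝒟) ⊆ H^1(Γ, ad rbar)`: the image of `L^1(𝒟)`. -/
def LocalDeformationProblem.tangentSpace {U : UniversalLifting rbar χ}
    (D : LocalDeformationProblem U) : Submodule (ResidueField O) (adH1 rbar) :=
  D.cocycles.map ((adB1 rbar).submoduleOf (adZ1 rbar)).mkQ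

/-- `R` is formally smooth over `𝒪`, for the `𝔞`-adic topology on `R`: every continuous
`𝒪`-algebra homomorphism `R → A / J`, where `J` is a nilpotent ideal of the discrete `𝒪`-algebra
`A`, lifts to a continuous `𝒪`-algebra homomorphism `R → A`. -/
def IsAdicallyFormallySmooth (O R : Type u) [CommRing O] [CommRing R] [Algebra O R]
    (𝔞 : Ideal R) : Prop :=
  ∀ (A : Type u) [CommRing A] [Algebra O A] (J : Ideal A), IsNilpotent J →
    ∀ f : R →ₐ[O] A ⧸ J, (∃ m : ℕ, 𝔞 ^ m ≤ RingHom.ker f) →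
      ∃ g : R →ₐ[O] A, (∃ m : ℕ, 𝔞 ^ m ≤ RingHom.ker g) ∧ (Ideal.Quotient.mkₐ O J).comp g = f

/-- The ring `A` has pure dimension `d`: it has dimension `d`, and so does every irreducible
component of its spectrum. -/
def HasPureDimension (A : Type*) [CommRing A] (d : ℕ) : Prop :=
  ringKrullDim A = d ∧ ∀ P ∈ minimalPrimes A, ringKrullDim (A ⧸ P) = d

/-- The local deformation problem `𝒟 = Spf (R^loc / I)` is formally smooth over `Spf 𝒪`, and of
pure relative dimension `d`: its special fibre, the spectrum of `(R^loc / I) ⊗ k`, is of pure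
dimension `d`. -/
structure LocalDeformationProblem.IsFormallySmooth {U : UniversalLifting rbar χ}
    (D : LocalDeformationProblem U) (d : ℕ) : Prop where
  formallySmooth : IsAdicallyFormallySmooth O (U.ring ⧸ D.ideal)
    ((maximalIdeal U.ring).map (Ideal.Quotient.mk D.ideal))
  pureDimension : HasPureDimension ((U.ring ⧸ D.ideal) ⧸
    (maximalIdeal O).map (algebraMap O (U.ring ⧸ D.ideal))) d

end Deformations

noncomputable section MinimallyRamified

open IsLocalRing

/-- The standard upper triangular nilpotent Jordan block `J_m`. -/
def jordanBlock (m : ℕ) (R : Type*) [CommRing R] : Matrix (Fin m) (Fin m) R :=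
  Matrix.of fun i j => if (i : ℕ) + 1 = j then 1 else 0

/-- The matrix `X` over a field is nilpotent with associated partition `p`: it is conjugate to a
block diagonal matrix whose blocks are the nilpotent Jordan blocks of the sizes in `p`. -/
def HasJordanType {K : Type*} [Field K] {n : ℕ} (p : n.Partition)
    (X : Matrix (Fin n) (Fin n) K) : Prop :=
  ∃ (r : ℕ) (m : Fin r → ℕ) (e : (Σ i, Fin (m i)) ≃ Fin n) (P : GL (Fin n) K),
    Multiset.ofList (List.ofFn m) = p.parts ∧
    X = (P : Matrix (Fin n) (Fin n) K) *
      Matrix.reindex e e (Matrix.blockDiagonal' fun i => jordanBlock (m i) K) *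
      (↑P⁻¹ : Matrix (Fin n) (Fin n) K)

section Exp

variable {n : ℕ} {R : Type*} [CommRing R]

/-- The truncated exponential map `1 + X + ⋯ + X ^ (n - 1) / (n - 1)!`. -/
def truncExp (X : Matrix (Fin n) (Fin n) R) : Matrix (Fin n) (Fin n) R :=
  ∑ i ∈ Finset.range n, Ring.inverse (i.factorial : R) • X ^ i

/-- The truncated logarithm map `∑_{i = 1}^{n - 1} (-1) ^ (i - 1) (A - 1) ^ i / i`. -/
def truncLog (A : Matrix (Fin n) (Fin n) R) : Matrix (Fin n) (Fin n) R :=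
  ∑ i ∈ Finset.Ico 1 n, ((-1) ^ (i - 1) * Ring.inverse (i : R)) • (A - 1) ^ i

end Exp

variable {O : Type u} [CommRing O] [IsLocalRing O] {n : ℕ}

/-- The functor `Nil_{Xbar}`: the set of `X ∈ M_n(R)` with `X ^ n = 0` that reduce to `Xbar` and
are of the form `C X₀ C⁻¹`, where `C ∈ GL_n(R)` and `X₀ ∈ M_n(𝒪)` satisfies `X₀ ^ n = 0` and has,
over the field `E ⊇ 𝒪`, the same associated partition as `Xbar` has over `k`. -/
def nilFunctor (E : Type*) [Field E] [Algebra O E]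
    (Xbar : Matrix (Fin n) (Fin n) (ResidueField O)) (R : CompleteLocalAlg O) :
    Set (Matrix (Fin n) (Fin n) R) :=
  {X | X ^ n = 0 ∧ X.map (residue R) = Xbar.map R.resMap ∧
    ∃ (X₀ : Matrix (Fin n) (Fin n) O) (C : GL (Fin n) R), X₀ ^ n = 0 ∧
      (∃ p : n.Partition, HasJordanType p (X₀.map (algebraMap O E)) ∧ HasJordanType p Xbar) ∧
      X = (C : Matrix (Fin n) (Fin n) R) * X₀.map (algebraMap O R) *
        (↑C⁻¹ : Matrix (Fin n) (Fin n) R)}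

variable {ℓ q : ℕ} [Fact ℓ.Prime] {hq : q.Coprime ℓ}

/-- A lifting `ρ` of `rhobar` to `R` is minimally ramified: `ρ^♮(t) = exp X` for some
`X ∈ Nil_{Xbar}(R)`, where `Xbar = log (rhobar^♮(t))`. -/
def IsMinimallyRamified (E : Type*) [Field E] [Algebra O E]
    (rhobar : TameGroup hq →* GG n (ResidueField O)) (R : CompleteLocalAlg O)
    (ρ : TameGroup hq →* GG n R) : Prop :=
  ∃ X ∈ nilFunctor E (truncLog ((rhobar (TameGroup.t hq)).gl : Matrix _ _ (ResidueField O))) R,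
    ((ρ (TameGroup.t hq)).gl : Matrix (Fin n) (Fin n) R) = truncExp X

/-- `𝒟` is the local deformation problem `𝒟^min` that classifies the minimally ramified
liftings. -/
def ClassifiesMinimallyRamified (E : Type*) [Field E] [Algebra O E]
    {rhobar : TameGroup hq →* GG n (ResidueField O)} {μ : TameGroup hq →* Oˣ}
    {U : UniversalLifting rhobar μ} (D : LocalDeformationProblem U) : Prop :=
  ∀ (R : CompleteLocalAlg O) (ρ : TameGroup hq →* GG n R),
    ρ ∈ U.points D.ideal R ↔ IsLifting rhobar μ R ρ ∧ IsMinimallyRamified E rhobar R ρ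

end MinimallyRamified

/-! A lifting amounts to a pair of matrices `A`, `B` with prescribed reductions and `A ^ q * B * Aᵀ
= B`: `t` goes to `(A, 1)` and `φ` to `(B, -μ(φ)) 𝔠`. Continuity costs nothing, because the rings
`R` are profinite (the residue field is finite) and the reduction of `A` has `ℓ`-power order. So
`R^loc` is a power series ring in `2 n ^ 2` variables modulo the entries of the relation.

Since `n ≤ ℓ`, the positive integers below `n` are units, and the truncated exponential and
logarithm are inverse to each other between the `X` with `X ^ n = 0` and the `A` with `(A - 1) ^ n =
0`. For `A = exp X` the relation becomes linear in `X`: `B * Xᵀ = -q • (X * B)`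
(`truncExp_pow_mul_iff`).

Let `J` be a Jordan matrix of the reduction of `X`; it is a partial permutation matrix. Commuting
with `J` only equates entries or makes them vanish, so the centralizer of `J` has the same dimension
over every field and is the image of a projection `commProj` that commutes with base change. Two
facts then carry the proof.

First, a matrix over `O` that is conjugate to `J` over `E` and over `k` is conjugate to `J` over `O`
(`exists_conj_of_generic_special`). Hence minimal ramification means `X = G * J * G⁻¹` with `G`
congruent to a fixed `P`. Such a `G` is unique up to right multiplication by elements of the
centralizer congruent to `1`, and it becomes unique if `P⁻¹ * G - 1` is required to lie in the
kernel of `commProj`.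

Second, there is an explicit invertible `b` with `b * Jᵀ = -q • (J * b)`. Writing `B = G * Z' * b *
Gᵀ`, the relation says exactly that `Z'` centralizes `J`, and its reduction is prescribed. The
normalized `G` and the matrix `Z'` are together encoded by one arbitrary matrix `M` with entries in
the maximal ideal: its component in the kernel of `commProj` gives `G`, its component in the image
gives `Z'`.

So the minimally ramified liftings have `n ^ 2` free coordinates and are represented by `S = O[[x_1,
…, x_{n²}]]`. Since the coordinates are determined by the lifting, `R^loc → S` is surjective
(`CompleteLocalAlg.surjective_of_separates`), and its kernel is the ideal sought. Smoothness and
dimension are read off from `S`; stability under conjugation holds because conjugating `A`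
conjugates `X`.

For the tangent space, the homomorphisms `S → k[ε]` number `|k| ^ (n ^ 2)`, so the cocycles of
`𝒟^min` have dimension `n ^ 2`. By stability they contain all coboundaries, which have dimension `n
^ 2 - dim H⁰`; the quotient has dimension `dim H⁰`. -/

noncomputable section TruncatedExponential

/-! ### Truncated exponential and logarithm -/

open Polynomial

variable {R : Type*} [CommRing R]

/-- Uniqueness for a linear differential equation with zero initial value, up to order `n`: the
coefficients of `f` vanish one after another, since the `d`-th enters the equation multiplied by the
unit `d`. Each identity between exponentials and logarithms below is obtained by exhibiting such an
equation for the difference of its two sides. -/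
theorem X_pow_dvd_of_linear_ode {n : ℕ} (hR : ∀ i, 0 < i → i < n → IsUnit (i : R))
    {f g h : R[X]} (h0 : f.coeff 0 = 0)
    (hf : X ^ (n - 1) ∣ (1 + X * g) * derivative f - h * f) : X ^ n ∣ f := by
  have key : ∀ m, m ≤ n → X ^ m ∣ f := by
    intro m
    induction m with
    | zero => intro; simp
    | succ m ih =>
      intro hm
      have hd := ih (by omega)
      rw [X_pow_dvd_iff] at hd ⊢
      intro d hdm
      rcases Nat.lt_succ_iff_lt_or_eq.1 hdm with hlt | rfl
      · exact hd d hlt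
      · rcases Nat.eq_zero_or_pos d with rfl | hpos
        · exact h0
        have hX : (X : R[X]) ^ d ∣ (1 + X * g) * derivative f := by
          have h1 := (pow_dvd_pow (X : R[X]) (show d ≤ n - 1 by omega)).trans hf
          have h2 : (X : R[X]) ^ d ∣ h * f := (ih (by omega)).mul_left h
          simpa using dvd_add h1 h2
        -- The leading factor `1 + X * g` is prime to `X` and can be cancelled, which leaves `X ^ d
        -- ∣ f'`.
        have hc : IsCoprime ((X : R[X]) ^ d) (1 + X * g) :=
          IsCoprime.pow_left ⟨-g, 1, by ring⟩
        have h3 := (X_pow_dvd_iff.1 (hc.dvd_of_dvd_mul_left hX)) (d - 1) (by omega)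
        rw [coeff_derivative, Nat.sub_add_cancel hpos] at h3
        have h4 : f.coeff d * (d : R) = 0 := by
          rw [← h3, ← Nat.cast_one (R := R), ← Nat.cast_add, Nat.sub_add_cancel hpos]
        exact ((hR d hpos (by omega)).mul_left_eq_zero).1 h4
  exact key n le_rfl

variable (R) in
/-- The truncated exponential series as a polynomial. -/
def expPoly (n : ℕ) : R[X] := ∑ i ∈ Finset.range n, C (Ring.inverse (i.factorial : R)) * X ^ i

variable (R) in
/-- The truncated series of `log (1 + X)` as a polynomial. -/
def logPoly (n : ℕ) : R[X] :=
  ∑ i ∈ Finset.Ico 1 n, C ((-1) ^ (i - 1) * Ring.inverse (i : R)) * X ^ i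

theorem isUnit_factorial {n : ℕ} (hR : ∀ i, 0 < i → i < n → IsUnit (i : R)) :
    ∀ i, i < n → IsUnit (i.factorial : R) := by
  intro i
  induction i with
  | zero => simp
  | succ i ih =>
    intro hi
    rw [Nat.factorial_succ, Nat.cast_mul]
    exact (hR _ (by omega) hi).mul (ih (by omega))

theorem derivative_expPoly {n : ℕ} (hR : ∀ i, 0 < i → i < n → IsUnit (i : R)) (hn : 0 < n) :
    X ^ (n - 1) ∣ derivative (expPoly R n) - expPoly R n := by
  obtain ⟨m, rfl⟩ := Nat.exists_eq_succ_of_ne_zero hn.ne'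
  refine ⟨-C (Ring.inverse (m.factorial : R)), ?_⟩
  have h : derivative (expPoly R (m + 1)) =
      ∑ i ∈ Finset.range m, C (Ring.inverse (i.factorial : R)) * X ^ i := by
    rw [expPoly, derivative_sum, Finset.sum_range_succ']
    simp only [pow_zero, derivative_mul, derivative_C, derivative_X_pow, zero_mul, zero_add]
    simp only [derivative_one, mul_zero, add_zero]
    refine Finset.sum_congr rfl fun i hi => ?_
    have hu := isUnit_factorial hR i (by have := Finset.mem_range.1 hi; omega)
    have hu1 := isUnit_factorial hR (i + 1) (by have := Finset.mem_range.1 hi; omega)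
    have he : Ring.inverse ((i + 1).factorial : R) * ((i + 1 : ℕ) : R) =
        Ring.inverse (i.factorial : R) := by
      have h1 := Ring.inverse_mul_cancel _ hu1
      rw [Nat.factorial_succ, Nat.cast_mul] at h1 ⊢
      calc _ = Ring.inverse (((i + 1 : ℕ) : R) * (i.factorial : R)) * ((i + 1 : ℕ) : R) *
            ((i.factorial : R) * Ring.inverse (i.factorial : R)) := by
              rw [Ring.mul_inverse_cancel _ hu, mul_one]
        _ = (Ring.inverse (((i + 1 : ℕ) : R) * (i.factorial : R)) *
            (((i + 1 : ℕ) : R) * (i.factorial : R))) * Ring.inverse (i.factorial : R) := by ring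
        _ = _ := by rw [h1, one_mul]
    rw [← he, C_mul, Nat.add_sub_cancel, mul_assoc]
  rw [Nat.succ_eq_add_one, h, expPoly, Finset.sum_range_succ, Nat.add_sub_cancel]
  ring

/-- The derivative is the finite geometric series in `-X`, so the error term is explicit and the
equation holds exactly. -/
theorem derivative_logPoly {n : ℕ} (hR : ∀ i, 0 < i → i < n → IsUnit (i : R)) (hn : 0 < n) :
    (1 + X) * derivative (logPoly R n) = 1 - (-X) ^ (n - 1) := by
  obtain ⟨m, rfl⟩ := Nat.exists_eq_succ_of_ne_zero hn.ne'
  have h : derivative (logPoly R (m + 1)) = ∑ i ∈ Finset.range m, (-X) ^ i := by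
    rw [logPoly, derivative_sum, Finset.sum_Ico_eq_sum_range]
    refine Finset.sum_congr rfl fun i hi => ?_
    have hu := hR (1 + i) (by omega) (by have := Finset.mem_range.1 hi; omega)
    rw [derivative_mul, derivative_C, zero_mul, zero_add, derivative_X_pow, Nat.add_sub_cancel_left,
      ← mul_assoc, ← C_mul, mul_assoc, Ring.inverse_mul_cancel _ hu, mul_one, neg_pow (X : R[X]), C_pow,
      C_neg, C_1]
  rw [Nat.succ_eq_add_one, h, Nat.add_sub_cancel, mul_comm,
    show (1 + X : R[X]) = 1 - (-X) by ring, geom_sum_mul_neg]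

theorem X_dvd_expPoly_sub_one {n : ℕ} (hn : 0 < n) : X ∣ expPoly R n - 1 := by
  obtain ⟨m, rfl⟩ := Nat.exists_eq_succ_of_ne_zero hn.ne'
  rw [expPoly, Finset.sum_range_succ']
  simp only [Nat.factorial_zero, Nat.cast_one, Ring.inverse_one, C_1, pow_zero, mul_one,
    add_sub_cancel_right]
  exact Finset.dvd_sum fun i _ => (dvd_pow_self X (Nat.succ_ne_zero i)).mul_left _

theorem X_dvd_logPoly (n : ℕ) : X ∣ logPoly R n :=
  Finset.dvd_sum fun i hi =>
    (dvd_pow_self X (by have := (Finset.mem_Ico.1 hi).1; omega)).mul_left _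

theorem comp_dvd_of_X_dvd {f g : R[X]} {m : ℕ} (hf : X ^ m ∣ f) (hg : X ∣ g) :
    X ^ m ∣ f.comp g := by
  obtain ⟨c, rfl⟩ := hf
  rw [mul_comp, X_pow_comp]
  exact (pow_dvd_pow_of_dvd hg m).mul_right _

/-- By the chain rule the derivative of the difference vanishes up to order `n - 1`. -/
theorem X_pow_dvd_log_exp {n : ℕ} (hR : ∀ i, 0 < i → i < n → IsUnit (i : R)) (hn : 0 < n) :
    X ^ n ∣ (logPoly R n).comp (expPoly R n - 1) - X := by
  have hE := X_dvd_expPoly_sub_one (R := R) hn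
  refine X_pow_dvd_of_linear_ode hR (g := 0) (h := 0) ?_ ?_
  · rw [← X_dvd_iff]
    have := comp_dvd_of_X_dvd (m := 1) (by simpa using X_dvd_logPoly (R := R) n) hE
    exact dvd_sub (by simpa using this) dvd_rfl
  · obtain ⟨a, ha⟩ := derivative_expPoly hR hn
    have hl := congrArg (fun p => p.comp (expPoly R n - 1)) (derivative_logPoly hR hn)
    simp only [mul_comp, add_comp, one_comp, X_comp, sub_comp, pow_comp, neg_comp] at hl
    obtain ⟨b, hb⟩ := pow_dvd_pow_of_dvd (dvd_neg.2 hE) (n - 1)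
    rw [derivative_sub, derivative_comp, derivative_sub, derivative_one, derivative_X, sub_zero]
    rw [add_sub_cancel] at hl
    rw [sub_eq_iff_eq_add] at ha
    rw [hb] at hl
    refine ⟨a * (derivative (logPoly R n)).comp (expPoly R n - 1) - b, ?_⟩
    rw [ha]
    linear_combination hl

/-- Both terms solve `(1 + X) y' = y` up to order `n - 1`, with value `1` at `0`. -/
theorem X_pow_dvd_exp_log {n : ℕ} (hR : ∀ i, 0 < i → i < n → IsUnit (i : R)) (hn : 0 < n) :
    X ^ n ∣ (expPoly R n).comp (logPoly R n) - (1 + X) := by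
  have hL := X_dvd_logPoly (R := R) n
  refine X_pow_dvd_of_linear_ode hR (g := 1) (h := 1) ?_ ?_
  · rw [← X_dvd_iff]
    have := comp_dvd_of_X_dvd (m := 1) (by simpa using X_dvd_expPoly_sub_one (R := R) hn) hL
    rw [sub_comp, one_comp] at this
    have := dvd_sub (by simpa using this) (dvd_refl (X : R[X]))
    convert! this using 1
    ring
  · obtain ⟨a, ha⟩ := comp_dvd_of_X_dvd (derivative_expPoly hR hn) hL
    have hl := derivative_logPoly hR hn
    rw [derivative_sub, derivative_comp, derivative_add, derivative_one, derivative_X]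
    rw [sub_comp, sub_eq_iff_eq_add] at ha
    refine ⟨a * ((1 + X) * derivative (logPoly R n)) -
      (-1) ^ (n - 1) * (expPoly R n).comp (logPoly R n), ?_⟩
    rw [ha]
    rw [neg_pow] at hl
    linear_combination (expPoly R n).comp (logPoly R n) * hl

/-- Both terms solve `y' = q y` up to order `n - 1`, with value `1` at `0`. -/
theorem X_pow_dvd_exp_pow {n : ℕ} (hR : ∀ i, 0 < i → i < n → IsUnit (i : R)) (hn : 0 < n)
    (q : ℕ) : X ^ n ∣ (expPoly R n).comp ((q : R[X]) * X) - expPoly R n ^ q := by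
  have hE := X_dvd_expPoly_sub_one (R := R) hn
  have hqX : (X : R[X]) ∣ (q : R[X]) * X := dvd_mul_left _ _
  refine X_pow_dvd_of_linear_ode hR (g := 0) (h := (q : R[X])) ?_ ?_
  · rw [← X_dvd_iff]
    have h1 := comp_dvd_of_X_dvd (m := 1) (by simpa using hE) hqX
    have h2 := hE.trans (sub_one_dvd_pow_sub_one (expPoly R n) q)
    rw [sub_comp, one_comp, pow_one] at h1
    simpa using dvd_sub h1 h2
  · obtain ⟨a, ha⟩ := derivative_expPoly hR hn
    obtain ⟨b, hb⟩ := comp_dvd_of_X_dvd (derivative_expPoly hR hn) hqX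
    rw [sub_comp, sub_eq_iff_eq_add] at hb
    rw [sub_eq_iff_eq_add] at ha
    rw [derivative_sub, derivative_comp, derivative_pow, hb, ha, derivative_mul, derivative_natCast,
      derivative_X]
    refine ⟨q * b - q * expPoly R n ^ (q - 1) * a, ?_⟩
    rcases Nat.eq_zero_or_pos q with rfl | hq
    · simp
    · have : expPoly R n ^ q = expPoly R n ^ (q - 1) * expPoly R n := by
        rw [← pow_succ, Nat.sub_add_cancel hq]
      rw [this]
      simp only [C_eq_natCast]
      ring

theorem X_pow_dvd_exp_neg {n : ℕ} (hR : ∀ i, 0 < i → i < n → IsUnit (i : R)) (hn : 0 < n) :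
    X ^ n ∣ expPoly R n * (expPoly R n).comp (-X) - 1 := by
  have hE := X_dvd_expPoly_sub_one (R := R) hn
  have hqX : (X : R[X]) ∣ -X := by simp
  refine X_pow_dvd_of_linear_ode hR (g := 0) (h := 0) ?_ ?_
  · rw [← X_dvd_iff]
    have h1 := comp_dvd_of_X_dvd (m := 1) (by simpa using hE) hqX
    rw [sub_comp, one_comp, pow_one] at h1
    have := dvd_add (h1.mul_left (expPoly R n)) hE
    convert! this using 1
    ring
  · obtain ⟨a, ha⟩ := derivative_expPoly hR hn
    obtain ⟨b, hb⟩ := comp_dvd_of_X_dvd (derivative_expPoly hR hn) hqX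
    rw [sub_comp, sub_eq_iff_eq_add] at hb
    rw [sub_eq_iff_eq_add] at ha
    rw [derivative_sub, derivative_mul, derivative_comp, hb, ha, derivative_neg, derivative_one,
      derivative_X]
    exact ⟨a * (expPoly R n).comp (-X) - expPoly R n * b, by ring⟩

variable {n : ℕ}

theorem truncExp_eq_aeval (Y : Matrix (Fin n) (Fin n) R) : truncExp Y = aeval Y (expPoly R n) := by
  simp [truncExp, expPoly, Algebra.smul_def]

theorem truncLog_eq_aeval (A : Matrix (Fin n) (Fin n) R) :
    truncLog A = aeval (A - 1) (logPoly R n) := by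
  simp [truncLog, logPoly, Algebra.smul_def]

/-- This turns the congruences modulo `X ^ n` into identities for matrices whose `n`-th power is
zero. -/
theorem aeval_eq_of_X_pow_dvd_sub {Y : Matrix (Fin n) (Fin n) R} (hY : Y ^ n = 0) {f g : R[X]}
    (h : X ^ n ∣ f - g) : aeval Y f = aeval Y g := by
  obtain ⟨c, hc⟩ := h
  rw [← sub_eq_zero, ← map_sub, hc, map_mul, map_pow, aeval_X, hY, zero_mul]

theorem aeval_pow_eq_zero {Y : Matrix (Fin n) (Fin n) R} (hY : Y ^ n = 0) {f : R[X]}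
    (h : X ∣ f) : aeval Y f ^ n = 0 := by
  rw [← map_pow, aeval_eq_of_X_pow_dvd_sub hY (g := 0), map_zero]
  simpa using pow_dvd_pow_of_dvd h n

theorem truncExp_sub_one_pow (hn : 0 < n) {Y : Matrix (Fin n) (Fin n) R} (hY : Y ^ n = 0) :
    (truncExp Y - 1) ^ n = 0 := by
  have := aeval_pow_eq_zero hY (X_dvd_expPoly_sub_one (R := R) hn)
  rwa [map_sub, map_one, ← truncExp_eq_aeval] at this

theorem truncLog_pow {A : Matrix (Fin n) (Fin n) R} (hA : (A - 1) ^ n = 0) :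
    truncLog A ^ n = 0 := by
  rw [truncLog_eq_aeval]
  exact aeval_pow_eq_zero hA (X_dvd_logPoly n)

theorem truncLog_truncExp (hR : ∀ i, 0 < i → i < n → IsUnit (i : R)) (hn : 0 < n)
    {Y : Matrix (Fin n) (Fin n) R} (hY : Y ^ n = 0) : truncLog (truncExp Y) = Y := by
  have := aeval_eq_of_X_pow_dvd_sub hY (X_pow_dvd_log_exp hR hn)
  rwa [aeval_comp, aeval_X, map_sub, map_one, ← truncExp_eq_aeval, ← truncLog_eq_aeval] at this

theorem truncExp_truncLog (hR : ∀ i, 0 < i → i < n → IsUnit (i : R)) (hn : 0 < n)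
    {A : Matrix (Fin n) (Fin n) R} (hA : (A - 1) ^ n = 0) : truncExp (truncLog A) = A := by
  have := aeval_eq_of_X_pow_dvd_sub hA (X_pow_dvd_exp_log hR hn)
  rwa [aeval_comp, map_add, map_one, aeval_X, ← truncLog_eq_aeval, ← truncExp_eq_aeval,
    add_sub_cancel] at this

theorem truncExp_natCast_smul (hR : ∀ i, 0 < i → i < n → IsUnit (i : R)) (hn : 0 < n)
    {Y : Matrix (Fin n) (Fin n) R} (hY : Y ^ n = 0) (q : ℕ) :
    truncExp ((q : R) • Y) = truncExp Y ^ q := by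
  have := aeval_eq_of_X_pow_dvd_sub hY (X_pow_dvd_exp_pow hR hn q)
  rw [aeval_comp, map_mul, map_natCast, aeval_X, map_pow, ← truncExp_eq_aeval,
    ← truncExp_eq_aeval] at this
  rw [← this, Nat.cast_smul_eq_nsmul, nsmul_eq_mul]

theorem truncExp_mul_truncExp_neg (hR : ∀ i, 0 < i → i < n → IsUnit (i : R)) (hn : 0 < n)
    {Y : Matrix (Fin n) (Fin n) R} (hY : Y ^ n = 0) : truncExp Y * truncExp (-Y) = 1 := by
  have := aeval_eq_of_X_pow_dvd_sub hY (X_pow_dvd_exp_neg hR hn)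
  rwa [map_mul, aeval_comp, map_neg, aeval_X, map_one, ← truncExp_eq_aeval,
    ← truncExp_eq_aeval] at this

theorem truncExp_transpose (Y : Matrix (Fin n) (Fin n) R) :
    truncExp Y.transpose = (truncExp Y).transpose := by
  simp [truncExp, Matrix.transpose_sum, Matrix.transpose_pow]

theorem mul_truncExp_of_mul_eq {Y Z B : Matrix (Fin n) (Fin n) R} (h : B * Y = Z * B) :
    B * truncExp Y = truncExp Z * B := by
  have hp : ∀ i, B * Y ^ i = Z ^ i * B := fun i => SemiconjBy.pow_right h i
  simp only [truncExp, Finset.mul_sum, Finset.sum_mul, Matrix.mul_smul, Matrix.smul_mul, hp]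

theorem mul_truncLog_of_mul_eq {Y Z B : Matrix (Fin n) (Fin n) R} (h : B * Y = Z * B) :
    B * truncLog Y = truncLog Z * B := by
  have h1 : B * (Y - 1) = (Z - 1) * B := by rw [mul_sub, sub_mul, h, mul_one, one_mul]
  have hp : ∀ i, B * (Y - 1) ^ i = (Z - 1) ^ i * B := fun i => SemiconjBy.pow_right h1 i
  simp only [truncLog, Finset.mul_sum, Finset.sum_mul, Matrix.mul_smul, Matrix.smul_mul, hp]

/-- `Ring.inverse` is `0` off the units, so it is compatible with ring homomorphisms only at units.
This is why base change of `truncExp` and `truncLog` asks for invertible denominators. -/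
theorem map_ringInverse {S : Type*} [CommRing S] (f : R →+* S) {x : R} (hx : IsUnit x) :
    f (Ring.inverse x) = Ring.inverse (f x) := by
  obtain ⟨v, rfl⟩ := hx
  rw [Ring.inverse_unit]
  have := Ring.inverse_unit (Units.map (f : R →* S) v)
  simpa using this.symm

theorem truncExp_map {S : Type*} [CommRing S] (f : R →+* S)
    (hR : ∀ i, 0 < i → i < n → IsUnit (i : R)) (Y : Matrix (Fin n) (Fin n) R) :
    (truncExp Y).map f = truncExp (Y.map f) := by
  change f.mapMatrix _ = truncExp (f.mapMatrix Y)
  simp only [truncExp, map_sum]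
  refine Finset.sum_congr rfl fun i hi => ?_
  rw [← map_pow, ← map_natCast f, ← map_ringInverse f (isUnit_factorial hR i (Finset.mem_range.1 hi))]
  ext a b
  simp

theorem truncLog_map {S : Type*} [CommRing S] (f : R →+* S)
    (hR : ∀ i, 0 < i → i < n → IsUnit (i : R)) (Y : Matrix (Fin n) (Fin n) R) :
    (truncLog Y).map f = truncLog (Y.map f) := by
  change f.mapMatrix _ = truncLog (f.mapMatrix Y)
  simp only [truncLog, map_sum]
  refine Finset.sum_congr rfl fun i hi => ?_
  rw [← map_one f.mapMatrix, ← map_sub, ← map_pow, ← map_natCast f,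
    ← map_ringInverse f (hR i (Finset.mem_Ico.1 hi).1 (Finset.mem_Ico.1 hi).2)]
  ext a b
  simp

end TruncatedExponential

/-! ### Centralizers of partial permutation matrices and conjugacy over a discrete valuation ring -/

noncomputable section EntrySelection

variable {ι : Type*}

/-- The relation on positions of entries that identifies the two entries that are equated by the
condition of commuting with the matrix of `f`; `none` is the position of a zero entry. -/
def commRel (f : ι ≃. ι) (a b : Option (ι × ι)) : Prop :=
  ∃ x y, a = (f x).map (fun u => (u, y)) ∧ b = (f.symm y).map (fun u => (x, u))

open Classical in
/-- A representative of each class of positions, `none` being preferred. -/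
def commRep (f : ι ≃. ι) (o : Option (ι × ι)) : Option (ι × ι) :=
  if Relation.EqvGen (commRel f) o none then none else
    Quotient.out (s := Relation.EqvGen.setoid (commRel f)) (Quotient.mk _ o)

theorem commRep_none (f : ι ≃. ι) : commRep f none = none :=
  if_pos (Relation.EqvGen.refl _)

theorem eqvGen_commRep (f : ι ≃. ι) (o : Option (ι × ι)) :
    Relation.EqvGen (commRel f) (commRep f o) o := by
  rw [commRep]
  split_ifs with h
  · exact h.symm
  · exact Quotient.mk_out (s := Relation.EqvGen.setoid (commRel f)) o

theorem commRep_eq_of_eqvGen (f : ι ≃. ι) {a b : Option (ι × ι)}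
    (h : Relation.EqvGen (commRel f) a b) : commRep f a = commRep f b := by
  have h1 : Relation.EqvGen (commRel f) a none ↔ Relation.EqvGen (commRel f) b none :=
    ⟨fun h' => h.symm.trans _ _ _ h', fun h' => h.trans _ _ _ h'⟩
  have h2 : Quotient.mk (Relation.EqvGen.setoid (commRel f)) a = Quotient.mk _ b :=
    Quotient.sound h
  classical
  rw [commRep, commRep, h2]
  simp only [h1]

theorem commRep_commRep (f : ι ≃. ι) (o : Option (ι × ι)) :
    commRep f (commRep f o) = commRep f o :=
  commRep_eq_of_eqvGen f (eqvGen_commRep f o)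

variable {R S : Type*} [CommRing R] [CommRing S]

/-- The entry of a matrix at a position, which is `0` at `none`. -/
def entry (Y : Matrix ι ι R) (o : Option (ι × ι)) : R := o.elim 0 fun p => Y p.1 p.2

theorem entry_map (g : R →+* S) (Y : Matrix ι ι R) (o : Option (ι × ι)) :
    entry (Y.map g) o = g (entry Y o) := by
  cases o <;> simp [entry]

/-- The projection of `M_n(R)` onto the centralizer of the matrix of `f`, which selects entries. -/
def commProj (f : ι ≃. ι) : Matrix ι ι R →ₗ[R] Matrix ι ι R where
  toFun Y := Matrix.of fun x y => entry Y (commRep f (some (x, y)))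
  map_add' Y Z := by
    ext x y
    cases h : commRep f (some (x, y)) <;> simp [entry, h]
  map_smul' a Y := by
    ext x y
    cases h : commRep f (some (x, y)) <;> simp [entry, h]

theorem entry_commProj (f : ι ≃. ι) (Y : Matrix ι ι R) (o : Option (ι × ι)) :
    entry (commProj f Y) o = entry Y (commRep f o) := by
  cases o with
  | none => rw [commRep_none]; rfl
  | some p => rfl

theorem commProj_map (f : ι ≃. ι) (g : R →+* S) (Y : Matrix ι ι R) :
    (commProj f Y).map g = commProj f (Y.map g) := by
  ext x y
  exact (entry_map g Y _).symm

variable [Fintype ι] [DecidableEq ι]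

/-- Multiplication by a partial permutation matrix, on either side, only moves entries or replaces
them by zero. So commutation is a list of equations between entries that does not depend on the
ring. -/
theorem toMatrix_commute_iff (f : ι ≃. ι) (Y : Matrix ι ι R) :
    f.toMatrix * Y = Y * f.toMatrix ↔ ∀ a b, commRel f a b → entry Y a = entry Y b := by
  have h1 : ∀ x y, ((f.toMatrix : Matrix ι ι R) * Y) x y =
      entry Y ((f x).map (fun u => (u, y))) := by
    intro x y
    rw [PEquiv.toMatrix_mul_apply]
    cases f x <;> rfl
  have h2 : ∀ x y, (Y * (f.toMatrix : Matrix ι ι R)) x y =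
      entry Y ((f.symm y).map (fun u => (x, u))) := by
    intro x y
    rw [PEquiv.mul_toMatrix_apply]
    cases f.symm y <;> rfl
  constructor
  · rintro h a b ⟨x, y, rfl, rfl⟩
    rw [← h1, ← h2, h]
  · intro h
    ext x y
    rw [h1, h2]
    exact h _ _ ⟨x, y, rfl, rfl⟩

theorem commProj_commute (f : ι ≃. ι) (Y : Matrix ι ι R) :
    f.toMatrix * commProj f Y = commProj f Y * f.toMatrix := by
  rw [toMatrix_commute_iff]
  intro a b h
  rw [entry_commProj, entry_commProj, commRep_eq_of_eqvGen f (Relation.EqvGen.rel _ _ h)]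

/-- A commuting matrix is constant on the classes of the generated equivalence relation, and zero on
the class of `none`. So `commProj` is an idempotent whose image is the centralizer, and it is
defined by the same recipe over every ring. -/
theorem commProj_eq_self_iff (f : ι ≃. ι) {Y : Matrix ι ι R} :
    commProj f Y = Y ↔ f.toMatrix * Y = Y * f.toMatrix := by
  refine ⟨fun h => h ▸ commProj_commute f Y, fun h => ?_⟩
  rw [toMatrix_commute_iff] at h
  have key : ∀ a b, Relation.EqvGen (commRel f) a b → entry Y a = entry Y b := by
    intro a b hab
    induction hab with
    | rel a b hab => exact h a b hab
    | refl a => rfl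
    | symm a b _ ih => exact ih.symm
    | trans a b c _ _ ih1 ih2 => exact ih1.trans ih2
  ext x y
  exact key _ _ (eqvGen_commRep f (some (x, y)))

theorem commProj_one (f : ι ≃. ι) : commProj f (1 : Matrix ι ι R) = 1 :=
  (commProj_eq_self_iff f).2 (by rw [mul_one, one_mul])

theorem commProj_commProj (f : ι ≃. ι) (Y : Matrix ι ι R) :
    commProj f (commProj f Y) = commProj f Y :=
  (commProj_eq_self_iff f).2 (commProj_commute f Y)

/-- The centralizer of the matrix of `f` is isomorphic to the space of functions on the set of
positions that represent their class. -/
def commEquiv (K : Type*) [Field K] (f : ι ≃. ι) :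
    LinearMap.range (commProj (R := K) f) ≃ₗ[K]
      ({p : ι × ι // commRep f (some p) = some p} → K) where
  toFun Y p := Y.1 p.1.1 p.1.2
  map_add' Y Z := rfl
  map_smul' a Y := rfl
  invFun g := ⟨Matrix.of fun x y =>
      match h : commRep f (some (x, y)) with
      | none => 0
      | some p => g ⟨p, by rw [← h, commRep_commRep]⟩, by
    -- A preimage under `commProj`: the values of `g` at the representatives, zero at all other
    -- positions.
    refine ⟨Matrix.of fun x y =>
      if h : commRep f (some (x, y)) = some (x, y) then g ⟨(x, y), h⟩ else 0, ?_⟩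
    ext x y
    change entry _ (commRep f (some (x, y))) = _
    rw [Matrix.of_apply]
    split
    · rename_i h
      exact congrArg (entry _) h
    · rename_i p h
      have hp : commRep f (some p) = some p := by rw [← h, commRep_commRep]
      exact (congrArg (entry _) h).trans (dif_pos hp)⟩
  left_inv := by
    rintro ⟨_, Y, rfl⟩
    refine Subtype.ext ?_
    ext x y
    change Matrix.of _ x y = entry Y (commRep f (some (x, y)))
    rw [Matrix.of_apply]
    split
    · rename_i h
      rw [h]
      rfl
    · rename_i p h
      have hp : commRep f (some p) = some p := by rw [← h, commRep_commRep]
      change entry Y (commRep f (some p)) = _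
      rw [hp, h]
  right_inv g := by
    ext ⟨p, hp⟩
    change Matrix.of _ p.1 p.2 = _
    rw [Matrix.of_apply]
    split
    · rename_i h
      rw [Prod.mk.eta, hp] at h
      exact absurd h (by simp)
    · rename_i p' h
      rw [Prod.mk.eta, hp] at h
      obtain rfl := Option.some.inj h
      rfl

/-- The space of the intertwiners `Y`, `X Y = Y J`. -/
def intertwiners (X J : Matrix ι ι R) : Submodule R (Matrix ι ι R) :=
  LinearMap.ker (LinearMap.mulLeft R X - LinearMap.mulRight R J)

theorem mem_intertwiners {X J Y : Matrix ι ι R} : Y ∈ intertwiners X J ↔ X * Y = Y * J := by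
  rw [intertwiners, LinearMap.mem_ker, LinearMap.sub_apply, sub_eq_zero]
  rfl

/-- Left multiplication by `P⁻¹` identifies the intertwiners with the centralizer of the matrix of
`f`. The answer is a combinatorial number attached to `f`, hence the same over the fraction field
and over the residue field. -/
theorem finrank_intertwiners {K : Type*} [Field K] (f : ι ≃. ι) {X P : Matrix ι ι K}
    (hP : IsUnit P) (h : X * P = P * f.toMatrix) :
    Module.finrank K (intertwiners X (f.toMatrix : Matrix ι ι K)) =
      Nat.card {p : ι × ι // commRep f (some p) = some p} := by
  classical
  rw [Nat.card_eq_fintype_card, ← Module.finrank_fintype_fun_eq_card K]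
  obtain ⟨v, rfl⟩ := hP
  have hX : (↑v⁻¹ : Matrix ι ι K) * X = f.toMatrix * (↑v⁻¹ : Matrix ι ι K) := by
    rw [Units.inv_mul_eq_iff_eq_mul, ← mul_assoc, ← h, mul_assoc, Units.mul_inv, mul_one]
  let e : intertwiners X (f.toMatrix : Matrix ι ι K) ≃ₗ[K] LinearMap.range (commProj (R := K) f) :=
    { toFun := fun Y => ⟨(↑v⁻¹ : Matrix ι ι K) * Y.1, _, (commProj_eq_self_iff f).2 (by
        rw [← mul_assoc, ← hX, mul_assoc, mul_assoc, mem_intertwiners.1 Y.2])⟩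
      map_add' := fun Y Z => Subtype.ext (mul_add _ _ _)
      map_smul' := fun a Y => Subtype.ext (Matrix.mul_smul _ _ _)
      invFun := fun Z => ⟨(v : Matrix ι ι K) * Z.1, mem_intertwiners.2 (by
        obtain ⟨_, Z, rfl⟩ := Z
        rw [← mul_assoc, h, mul_assoc, mul_assoc, commProj_commute])⟩
      left_inv := fun Y => Subtype.ext (by simp)
      right_inv := fun Z => Subtype.ext (by simp) }
  exact (e.trans (commEquiv K f)).finrank_eq

theorem isUnit_matrix_of_residue {A : Type*} [CommRing A] [IsLocalRing A] {Y : Matrix ι ι A}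
    (h : IsUnit (Y.map (IsLocalRing.residue A))) : IsUnit Y := by
  rw [Matrix.isUnit_iff_isUnit_det] at h ⊢
  have : (Y.map (IsLocalRing.residue A)).det = IsLocalRing.residue A Y.det :=
    ((IsLocalRing.residue A).map_det Y).symm
  rw [this] at h
  exact (isUnit_map_iff _ _).1 h

/-- A matrix over a discrete valuation ring that is conjugate to the matrix of `f` over the
fraction field and over the residue field is conjugate to it. -/
theorem exists_conj_of_generic_special {A E : Type*} [CommRing A] [IsDomain A] [IsLocalRing A]
    [IsPrincipalIdealRing A] [Field E] [Algebra A E] [IsFractionRing A E] (f : ι ≃. ι)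
    (X : Matrix ι ι A)
    (hE : ∃ P : Matrix ι ι E, IsUnit P ∧ X.map (algebraMap A E) * P = P * f.toMatrix)
    (hk : ∃ P : Matrix ι ι (IsLocalRing.ResidueField A), IsUnit P ∧
      X.map (IsLocalRing.residue A) * P = P * f.toMatrix) :
    ∃ Q : Matrix ι ι A, IsUnit Q ∧ X * Q = Q * f.toMatrix := by
  classical
  obtain ⟨P, hP, hXP⟩ := hE
  obtain ⟨P', hP', hXP'⟩ := hk
  set H := intertwiners X (f.toMatrix : Matrix ι ι A)
  let b := Module.finBasis A H
  set d := Module.finrank A H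
  have hmap : ∀ {B : Type _} [CommRing B] (g : A →+* B) (i : Fin d),
      X.map g * (b i).1.map g = (b i).1.map g * f.toMatrix := by
    intro B _ g i
    have := congrArg (fun M : Matrix ι ι A => M.map g) (mem_intertwiners.1 (b i).2)
    simp only [Matrix.map_mul, PEquiv.map_toMatrix] at this
    exact this
  -- Clearing denominators, a basis of the module `H` of integral intertwiners spans the
  -- intertwiners over `E`, so the rank `d` is at least the generic dimension.
  have hd : Nat.card {p : ι × ι // commRep f (some p) = some p} ≤ d := by
    rw [← finrank_intertwiners f hP hXP]
    have hle : intertwiners (X.map (algebraMap A E)) (f.toMatrix : Matrix ι ι E) ≤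
        Submodule.span E (Set.range fun i => (b i).1.map (algebraMap A E)) := by
      intro Y hY
      obtain ⟨c, hc⟩ := IsLocalization.exist_integer_multiples_of_finite (nonZeroDivisors A)
        (fun p : ι × ι => Y p.1 p.2)
      choose Z hZ using hc
      have hc0 : algebraMap A E c ≠ 0 :=
        IsFractionRing.to_map_ne_zero_of_mem_nonZeroDivisors c.2
      have hZY : (Matrix.of fun x y => Z (x, y)).map (algebraMap A E) =
          algebraMap A E c • Y := by
        ext x y
        rw [Matrix.map_apply, Matrix.of_apply, hZ, Algebra.smul_def]
        rfl
      have hZH : Matrix.of (fun x y => Z (x, y)) ∈ H := by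
        rw [mem_intertwiners]
        refine Matrix.map_injective (IsFractionRing.injective A E) ?_
        change (algebraMap A E).mapMatrix _ = (algebraMap A E).mapMatrix _
        rw [map_mul, map_mul]
        simp only [RingHom.mapMatrix_apply]
        rw [hZY, PEquiv.map_toMatrix, Matrix.mul_smul, mem_intertwiners.1 hY, Matrix.smul_mul]
      have hrep := congrArg (fun M : H => M.1.map (algebraMap A E)) (b.sum_repr ⟨_, hZH⟩)
      simp only at hrep
      rw [hZY] at hrep
      have : Y = (algebraMap A E c)⁻¹ • (algebraMap A E c • Y) := by
        rw [smul_smul, inv_mul_cancel₀ hc0, one_smul]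
      rw [this, ← hrep]
      refine Submodule.smul_mem _ _ ?_
      rw [Submodule.coe_sum]
      change (algebraMap A E).mapMatrix _ ∈ _
      rw [map_sum]
      refine Submodule.sum_mem _ fun i _ => ?_
      have : (algebraMap A E).mapMatrix (((b.repr ⟨_, hZH⟩) i • b i : H) : Matrix ι ι A) =
          algebraMap A E ((b.repr ⟨_, hZH⟩) i) • (b i).1.map (algebraMap A E) := by
        ext x y
        simp
      rw [this]
      exact Submodule.smul_mem _ _ (Submodule.subset_span ⟨i, rfl⟩)
    exact (Submodule.finrank_mono hle).trans
      ((finrank_range_le_card _).trans_eq (Fintype.card_fin d))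
  let b' : Fin d → intertwiners (X.map (IsLocalRing.residue A))
      (f.toMatrix : Matrix ι ι (IsLocalRing.ResidueField A)) :=
    fun i => ⟨(b i).1.map (IsLocalRing.residue A), mem_intertwiners.2 (hmap _ i)⟩
  -- The module `H` is saturated: if `ϖ • M` is an intertwiner, so is `M`. Hence a relation modulo
  -- the maximal ideal between the basis elements has all its coefficients in the maximal ideal.
  have hli : LinearIndependent (IsLocalRing.ResidueField A) b' := by
    rw [Fintype.linearIndependent_iff]
    intro g hg i
    choose c hc using fun i => IsLocalRing.residue_surjective (g i)
    obtain ⟨ϖ, hϖ⟩ := IsPrincipalIdealRing.principal (IsLocalRing.maximalIdeal A)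
    have h1 : ∀ x y, ∃ z, (∑ i, c i • b i : H).1 x y = z * ϖ := by
      intro x y
      have h2 : IsLocalRing.residue A ((∑ i, c i • b i : H).1 x y) = 0 := by
        have h3 := congrArg (fun M : intertwiners _ _ => M.1 x y) hg
        simp only [Submodule.coe_sum, Matrix.sum_apply] at h3 ⊢
        rw [map_sum]
        refine Eq.trans (Finset.sum_congr rfl fun j _ => ?_) h3
        rw [← hc]
        simp [b']
      rw [IsLocalRing.residue_eq_zero_iff, hϖ] at h2
      obtain ⟨z, hz⟩ := Submodule.mem_span_singleton.1 h2
      exact ⟨z, hz.symm⟩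
    choose z hz using h1
    have hzH : (∑ i, c i • b i : H).1 = ϖ • Matrix.of z := by
      ext x y
      rw [hz, mul_comm]
      rfl
    -- The ring `A` may be a field, where `ϖ = 0` and division by `ϖ` is not available.
    by_cases h0 : ϖ = 0
    · have : (∑ i, c i • b i : H) = 0 := Subtype.ext (by rw [hzH, h0, zero_smul]; rfl)
      rw [← hc, (Fintype.linearIndependent_iff.1 b.linearIndependent) c this i, map_zero]
    have hmem : Matrix.of z ∈ H := by
      rw [mem_intertwiners]
      have h5 := mem_intertwiners.1 (∑ i, c i • b i : H).2
      rw [hzH, Matrix.mul_smul, Matrix.smul_mul] at h5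
      exact smul_right_injective _ h0 h5
    have h6 : (∑ i, c i • b i : H) = ϖ • ⟨Matrix.of z, hmem⟩ := Subtype.ext hzH
    have h7 := congrArg (fun M => b.repr M i) h6
    simp only [map_smul, Finsupp.smul_apply] at h7
    rw [b.repr_sum_self] at h7
    rw [← hc, h7, IsLocalRing.residue_eq_zero_iff, hϖ]
    exact Submodule.mem_span_singleton.2 ⟨_, mul_comm _ _⟩
  -- The dimensions over the two fields agree, so every intertwiner over the residue field lifts to
  -- `H`. A lift of the invertible `P'` is invertible.
  have hspan := hli.span_eq_top_of_card_eq_finrank' (by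
    refine le_antisymm hli.fintype_card_le_finrank ?_
    rw [finrank_intertwiners f hP' hXP', Fintype.card_fin]
    exact hd)
  have hP'' : (⟨P', mem_intertwiners.2 hXP'⟩ : intertwiners _ _) ∈ Submodule.span _ (Set.range b') :=
    hspan ▸ Submodule.mem_top
  obtain ⟨g, hg⟩ := (Submodule.mem_span_range_iff_exists_fun _).1 hP''
  choose c hc using fun i => IsLocalRing.residue_surjective (g i)
  refine ⟨(∑ i, c i • b i : H).1, isUnit_matrix_of_residue ?_, mem_intertwiners.1 (∑ i, c i • b i : H).2⟩
  convert hP' using 1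
  have hg' := congrArg Subtype.val hg
  simp only at hg'
  rw [← hg']
  ext x y
  simp only [Submodule.coe_sum, Matrix.sum_apply, Matrix.map_apply]
  rw [map_sum]
  refine Finset.sum_congr rfl fun j _ => ?_
  rw [← hc]
  simp [b']

end EntrySelection

/-! ### Nilpotent Jordan matrices: existence of the normal form and duality -/

noncomputable section JordanShift

open Matrix

variable {r : ℕ} (m : Fin r → ℕ)

/-- The partial bijection underlying a block diagonal matrix of nilpotent Jordan blocks. -/
def jordanShift : (Σ i, Fin (m i)) ≃. (Σ i, Fin (m i)) where
  toFun x := if h : (x.2 : ℕ) + 1 < m x.1 then some ⟨x.1, ⟨x.2 + 1, h⟩⟩ else none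
  invFun x := if (x.2 : ℕ) = 0 then none else some ⟨x.1, ⟨x.2 - 1, by omega⟩⟩
  inv := by
    rintro ⟨i, a⟩ ⟨j, b⟩
    dsimp only
    constructor
    · intro h
      split_ifs at h with h0
      · obtain ⟨rfl, h⟩ := Sigma.mk.inj_iff.1 (Option.some.inj h)
        have h1 := congrArg Fin.val (eq_of_heq h)
        simp only at h1 h0
        rw [dif_pos (by omega)]
        exact congrArg some (Sigma.ext rfl (heq_of_eq (Fin.ext (by simp only; omega))))
    · intro h
      split_ifs at h with h0
      · obtain ⟨rfl, h⟩ := Sigma.mk.inj_iff.1 (Option.some.inj h)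
        have h1 := congrArg Fin.val (eq_of_heq h)
        simp only at h1 h0
        rw [if_neg (by omega)]
        exact congrArg some (Sigma.ext rfl (heq_of_eq (Fin.ext (by simp only; omega))))

theorem jordanShift_eq_some_iff (x y : Σ i, Fin (m i)) :
    jordanShift m x = some y ↔ x.1 = y.1 ∧ (x.2 : ℕ) + 1 = y.2 := by
  change (if h : (x.2 : ℕ) + 1 < m x.1 then some ⟨x.1, ⟨x.2 + 1, h⟩⟩ else none) = some y ↔ _
  obtain ⟨i, a⟩ := x
  obtain ⟨j, b⟩ := y
  constructor
  · intro h
    split_ifs at h with h0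
    · obtain ⟨rfl, h⟩ := Sigma.mk.inj_iff.1 (Option.some.inj h)
      exact ⟨rfl, congrArg Fin.val (eq_of_heq h)⟩
  · rintro ⟨rfl, h⟩
    simp only at h
    rw [dif_pos (by simp only; omega)]
    exact congrArg some (Sigma.ext rfl (heq_of_eq (Fin.ext h)))

theorem blockDiagonal'_jordanBlock (R : Type*) [CommRing R] :
    (blockDiagonal' fun i => jordanBlock (m i) R) = (jordanShift m).toMatrix := by
  ext ⟨i, a⟩ ⟨j, b⟩
  rw [blockDiagonal'_apply, PEquiv.toMatrix_apply]
  simp only [Option.mem_def, jordanShift_eq_some_iff]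
  by_cases h : i = j
  · subst h
    simp [jordanBlock]
  · simp [h]

variable {n : ℕ}

/-- The partial bijection of `Fin n` underlying a nilpotent Jordan matrix. -/
def jordanPEquiv (e : (Σ i, Fin (m i)) ≃ Fin n) : Fin n ≃. Fin n :=
  (e.symm.toPEquiv.trans (jordanShift m)).trans e.toPEquiv

variable {m}

theorem jordanPEquiv_eq_some_iff (e : (Σ i, Fin (m i)) ≃ Fin n) (x y : Fin n) :
    jordanPEquiv m e x = some y ↔ jordanShift m (e.symm x) = some (e.symm y) := by
  rw [jordanPEquiv, PEquiv.trans_eq_some]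
  simp only [PEquiv.trans_eq_some, Equiv.toPEquiv_apply, Option.some.injEq]
  constructor
  · rintro ⟨z, ⟨_, rfl, hz⟩, rfl⟩
    rw [hz, e.symm_apply_apply]
  · intro h
    exact ⟨_, ⟨_, rfl, h⟩, e.apply_symm_apply y⟩

theorem reindex_blockDiagonal' (e : (Σ i, Fin (m i)) ≃ Fin n) (R : Type*) [CommRing R] :
    reindex e e (blockDiagonal' fun i => jordanBlock (m i) R) = (jordanPEquiv m e).toMatrix := by
  ext x y
  rw [blockDiagonal'_jordanBlock, reindex_apply, submatrix_apply, PEquiv.toMatrix_apply,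
    PEquiv.toMatrix_apply]
  simp only [Option.mem_def, jordanPEquiv_eq_some_iff]

/-- The two sequences of block sizes agree after sorting, so they differ by a permutation of the
blocks, which respects the position inside each block. -/
theorem exists_sigma_equiv {r' : ℕ} {m' : Fin r' → ℕ}
    (h : Multiset.ofList (List.ofFn m) = Multiset.ofList (List.ofFn m')) :
    ∃ τ : (Σ i, Fin (m i)) ≃ (Σ i, Fin (m' i)), ∀ x y,
      jordanShift m x = some y ↔ jordanShift m' (τ x) = some (τ y) := by
  have hr : r = r' := by
    have := congrArg Multiset.card h
    simpa using this
  subst hr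
  have hs : m ∘ Tuple.sort m = m' ∘ Tuple.sort m' :=
    List.ofFn_injective <| (((Tuple.sort m).ofFn_comp_perm m).trans ((Multiset.coe_eq_coe.1 h).trans
      ((Tuple.sort m').ofFn_comp_perm m').symm)).eq_of_pairwise'
        (Tuple.monotone_sort m).sortedLE_ofFn.pairwise (Tuple.monotone_sort m').sortedLE_ofFn.pairwise
  obtain ⟨σ, rfl⟩ : ∃ σ : Equiv.Perm (Fin r), m = m' ∘ σ :=
    ⟨(Tuple.sort m).symm.trans (Tuple.sort m'), funext fun x => by
      have := congrFun hs ((Tuple.sort m).symm x)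
      simpa using this⟩
  refine ⟨⟨fun x => ⟨σ x.1, x.2⟩, fun x => ⟨σ.symm x.1, ⟨x.2, by simp⟩⟩, ?_, ?_⟩, ?_⟩
  · rintro ⟨i, a⟩
    refine Sigma.ext (σ.symm_apply_apply i) ?_
    refine (Fin.heq_ext_iff ?_).2 rfl
    simp
  · rintro ⟨i, a⟩
    refine Sigma.ext (σ.apply_symm_apply i) ?_
    refine (Fin.heq_ext_iff ?_).2 rfl
    simp
  · intro x y
    rw [jordanShift_eq_some_iff, jordanShift_eq_some_iff]
    simp

theorem hasJordanType_iff {K : Type*} [Field K] {p : n.Partition} {X : Matrix (Fin n) (Fin n) K} :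
    HasJordanType p X ↔ ∃ (r : ℕ) (m : Fin r → ℕ) (e : (Σ i, Fin (m i)) ≃ Fin n)
      (P : Matrix (Fin n) (Fin n) K), Multiset.ofList (List.ofFn m) = p.parts ∧ IsUnit P ∧
      X * P = P * (jordanPEquiv m e).toMatrix := by
  constructor
  · rintro ⟨r, m, e, P, h, rfl⟩
    refine ⟨r, m, e, P, h, P.isUnit, ?_⟩
    rw [mul_assoc, Units.inv_mul, mul_one, reindex_blockDiagonal']
  · rintro ⟨r, m, e, P, h, ⟨v, rfl⟩, hX⟩
    refine ⟨r, m, e, v, h, ?_⟩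
    rw [reindex_blockDiagonal', ← hX, mul_assoc, Units.mul_inv, mul_one]

/-- The conjugating permutation matrix of two Jordan matrices of the same type. -/
theorem exists_conj_jordan {r' : ℕ} {m' : Fin r' → ℕ} (e : (Σ i, Fin (m i)) ≃ Fin n)
    (e' : (Σ i, Fin (m' i)) ≃ Fin n)
    (h : Multiset.ofList (List.ofFn m) = Multiset.ofList (List.ofFn m')) (R : Type*) [CommRing R] :
    ∃ Q : Matrix (Fin n) (Fin n) R, IsUnit Q ∧
      (jordanPEquiv m e).toMatrix * Q = Q * (jordanPEquiv m' e').toMatrix := by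
  obtain ⟨τ, hτ⟩ := exists_sigma_equiv h
  let σ : Equiv.Perm (Fin n) := e.symm.trans (τ.trans e')
  refine ⟨σ.toPEquiv.toMatrix, ?_, ?_⟩
  · refine IsUnit.of_mul_eq_one (σ.symm.toPEquiv.toMatrix) ?_
    rw [← PEquiv.toMatrix_trans, ← Equiv.toPEquiv_trans, Equiv.self_trans_symm,
      Equiv.toPEquiv_refl, PEquiv.toMatrix_refl]
  · rw [PEquiv.mul_toMatrix_toPEquiv, PEquiv.toMatrix_toPEquiv_mul]
    ext x y
    simp only [submatrix_apply, id, PEquiv.toMatrix_apply, Option.mem_def,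
      jordanPEquiv_eq_some_iff, hτ]
    simp [σ]

/-- The involution `τ` reverses each Jordan block, which turns the shift into its transpose; `d x`
is the distance of `x` to the end of its block, so that one step of the shift lowers `d` by one. -/
theorem exists_dual_jordanPEquiv (e : (Σ i, Fin (m i)) ≃ Fin n) :
    ∃ (τ : Equiv.Perm (Fin n)) (d : Fin n → ℕ), (∀ x, τ (τ x) = x) ∧
      (∀ x y, jordanPEquiv m e y = some (τ x) ↔ jordanPEquiv m e x = some (τ y)) ∧
      ∀ x y, jordanPEquiv m e x = some y → d x = d y + 1 := by
  let ρ : Equiv.Perm (Σ i, Fin (m i)) := Equiv.sigmaCongrRight fun i => Fin.revPerm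
  have hρ : ∀ x, ρ (ρ x) = x := fun x => by simp [ρ]
  have hρ2 : ∀ x, ((ρ x).2 : ℕ) + x.2 + 1 = m x.1 := fun x => by
    obtain ⟨i, a⟩ := x
    change (a.rev : ℕ) + a + 1 = m i
    rw [Fin.val_rev]
    omega
  have he : ∀ x, e.symm ((e.symm.trans (ρ.trans e)) x) = ρ (e.symm x) := fun x => by simp
  refine ⟨e.symm.trans (ρ.trans e), fun x => (ρ (e.symm x)).2, fun x => by simp [hρ], ?_, ?_⟩
  · intro x y
    rw [jordanPEquiv_eq_some_iff, jordanPEquiv_eq_some_iff, jordanShift_eq_some_iff,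
      jordanShift_eq_some_iff, he, he]
    have hx := hρ2 (e.symm x)
    have hy := hρ2 (e.symm y)
    constructor
    · rintro ⟨h, h'⟩
      have hm : m (e.symm y).1 = m (e.symm x).1 := congrArg m h
      exact ⟨h.symm, by omega⟩
    · rintro ⟨h, h'⟩
      have hm : m (e.symm x).1 = m (e.symm y).1 := congrArg m h
      exact ⟨h.symm, by omega⟩
  · intro x y h
    rw [jordanPEquiv_eq_some_iff, jordanShift_eq_some_iff] at h
    have hx := hρ2 (e.symm x)
    have hy := hρ2 (e.symm y)
    have hm : m (e.symm x).1 = m (e.symm y).1 := congrArg m h.1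
    dsimp only
    omega

/-- The matrix of the permutation `τ`, with its rows scaled by powers of `c`. -/
def scaledPerm {R : Type*} [CommRing R] (τ : Equiv.Perm (Fin n)) (d : Fin n → ℕ) (c : R) :
    Matrix (Fin n) (Fin n) R :=
  Matrix.diagonal (fun x => c ^ d x) * τ.toPEquiv.toMatrix

theorem scaledPerm_map {R S : Type*} [CommRing R] [CommRing S] (g : R →+* S)
    (τ : Equiv.Perm (Fin n)) (d : Fin n → ℕ) (c : R) :
    (scaledPerm τ d c).map g = scaledPerm τ d (g c) := by
  rw [scaledPerm, Matrix.map_mul, PEquiv.map_toMatrix, Matrix.diagonal_map (map_zero g), scaledPerm]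
  simp

theorem isUnit_scaledPerm {R : Type*} [CommRing R] (τ : Equiv.Perm (Fin n)) (d : Fin n → ℕ) {c : R}
    (hc : IsUnit c) : IsUnit (scaledPerm τ d c) := by
  refine IsUnit.mul ?_ ?_
  · rw [Matrix.isUnit_iff_isUnit_det, Matrix.det_diagonal]
    exact IsUnit.prod_univ_iff.2 fun x => hc.pow _
  · refine IsUnit.of_mul_eq_one (τ.symm.toPEquiv.toMatrix) ?_
    rw [← PEquiv.toMatrix_trans, ← Equiv.toPEquiv_trans, Equiv.self_trans_symm,
      Equiv.toPEquiv_refl, PEquiv.toMatrix_refl]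

/-- Reversing the blocks turns the transpose into the matrix itself, and scaling row `x` by `c ^ d
x` produces one factor `c` per step. With `c = -q` this is the linearized relation between `φ` and
`t`. -/
theorem scaledPerm_mul_transpose {R : Type*} [CommRing R] {f : Fin n ≃. Fin n}
    {τ : Equiv.Perm (Fin n)} {d : Fin n → ℕ} (hτ : ∀ x, τ (τ x) = x)
    (h1 : ∀ x y, f y = some (τ x) ↔ f x = some (τ y))
    (h2 : ∀ x y, f x = some y → d x = d y + 1) (c : R) :
    scaledPerm τ d c * (f.toMatrix)ᵀ = c • (f.toMatrix * scaledPerm τ d c) := by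
  have hb : ∀ (M : Matrix (Fin n) (Fin n) R) x y,
      (scaledPerm τ d c * M) x y = c ^ d x * M (τ x) y := by
    intro M x y
    rw [scaledPerm, mul_assoc, Matrix.diagonal_mul, PEquiv.toMatrix_toPEquiv_mul]
    rfl
  ext x y
  rw [hb, Matrix.smul_apply, PEquiv.toMatrix_mul_apply, transpose_apply, PEquiv.toMatrix_apply]
  simp only [Option.mem_def, h1 x y]
  have hv : ∀ u v, scaledPerm τ d c u v = if u = τ v then c ^ d u else 0 := by
    intro u v
    have := hb 1 u v
    rw [mul_one] at this
    rw [this, Matrix.one_apply, mul_ite, mul_one, mul_zero]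
    exact if_congr ⟨fun h => by rw [← h, hτ], fun h => by rw [h, hτ]⟩ rfl rfl
  cases h : f x with
  | none => simp
  | some z =>
    simp only [hv, Option.some.injEq]
    split_ifs with hz
    · rw [h2 x z h, pow_succ, smul_eq_mul]
      ring
    · simp

/-- The data of a Jordan basis for an endomorphism. -/
theorem exists_jordan_basis {K V : Type*} [Field K] [AddCommGroup V] [Module K V]
    [FiniteDimensional K V] (N : Module.End K V) (hN : IsNilpotent N) :
    ∃ (r : ℕ) (m : Fin r → ℕ) (b : Module.Basis (Σ i, Fin (m i)) K V), (∀ i, 0 < m i) ∧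
      ∀ i (a : Fin (m i)), N (b ⟨i, a⟩) =
        if h : (a : ℕ) + 1 < m i then b ⟨i, ⟨a + 1, h⟩⟩ else 0 := by
  classical
  obtain ⟨s, hs⟩ := hN
  -- Through `N` the space becomes a torsion module over `K[X]`, a sum of modules `K[X] / (X ^ k
  -- i)`; the powers of `X` are a basis of each summand, and `N` moves one power to the next.
  have htors : Module.IsTorsion' (Module.AEval' N) (Submonoid.powers (Polynomial.X : Polynomial K)) := by
    intro x
    refine ⟨⟨Polynomial.X ^ s, s, rfl⟩, ?_⟩
    change (Polynomial.X ^ s : Polynomial K) • x = 0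
    obtain ⟨v, rfl⟩ := (Module.AEval'.of N).surjective x
    rw [Module.AEval'.X_pow_smul_of, hs, zero_smul, map_zero]
  obtain ⟨d, k, ⟨φ⟩⟩ := Module.torsion_by_prime_power_decomposition
    (R := Polynomial K) (M := Module.AEval' N) Polynomial.irreducible_X htors
  have hmon : ∀ i, ((Polynomial.X : Polynomial K) ^ k i).Monic := fun i => Polynomial.monic_X_pow _
  let c : ∀ i, Module.Basis (Fin (k i)) K (Polynomial K ⧸
      Submodule.span (Polynomial K) {(Polynomial.X : Polynomial K) ^ k i}) :=
    fun i => ((AdjoinRoot.powerBasis' (hmon i)).basis.reindex (finCongr (by simp)))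
  have hc : ∀ i a, c i a = Submodule.Quotient.mk ((Polynomial.X : Polynomial K) ^ (a : ℕ)) := by
    intro i a
    change (AdjoinRoot.powerBasis' (hmon i)).basis.reindex _ a = _
    rw [Module.Basis.reindex_apply, PowerBasis.basis_eq_pow]
    rfl
  let bM : Module.Basis (Σ i, Fin (k i)) K (Module.AEval' N) :=
    (DFinsupp.basis c).map (φ.restrictScalars K).symm
  have hbM : ∀ i a, bM ⟨i, a⟩ = φ.symm (DirectSum.lof (Polynomial K) _ _ i (c i a)) := by
    intro i a
    simp only [bM, Module.Basis.map_apply]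
    refine congrArg φ.symm ((DFinsupp.basis c).repr.injective ?_)
    rw [Module.Basis.repr_self]
    ext ⟨j, z⟩
    simp only [DFinsupp.basis]
    change _ = (c j).repr ((DFinsupp.single i (c i a) : Π₀ i, (Polynomial K ⧸
      Submodule.span (Polynomial K) {(Polynomial.X : Polynomial K) ^ k i})) j) z
    by_cases h : i = j
    · subst h
      rw [DFinsupp.single_eq_same, Module.Basis.repr_self]
      by_cases ha : a = z
      · subst ha
        rw [Finsupp.single_eq_same, Finsupp.single_eq_same]
      · rw [Finsupp.single_eq_of_ne (Ne.symm ha), Finsupp.single_eq_of_ne (fun h => ha (by simpa using h.symm))]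
    · rw [DFinsupp.single_eq_of_ne (Ne.symm h), map_zero, Finsupp.zero_apply,
        Finsupp.single_eq_of_ne (fun h' => h (congrArg Sigma.fst h').symm)]
  let b : Module.Basis (Σ i, Fin (k i)) K V := bM.map (Module.AEval'.of N).symm
  have hb : ∀ i (a : Fin (k i)), N (b ⟨i, a⟩) =
        if h : (a : ℕ) + 1 < k i then b ⟨i, ⟨a + 1, h⟩⟩ else 0 := by
    intro i a
    have h1 : N (b ⟨i, a⟩) = (Module.AEval'.of N).symm ((Polynomial.X : Polynomial K) • bM ⟨i, a⟩) := by
      rw [LinearEquiv.eq_symm_apply, ← Module.AEval'.X_smul_of]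
      simp [b]
    rw [h1, hbM, ← map_smul, ← map_smul, hc, ← Submodule.Quotient.mk_smul, smul_eq_mul, ← pow_succ']
    split_ifs with h
    · simp only [b, Module.Basis.map_apply]
      rw [hbM, hc]
    · have : (Submodule.Quotient.mk (Polynomial.X ^ ((a : ℕ) + 1)) : Polynomial K ⧸
          Submodule.span (Polynomial K) {(Polynomial.X : Polynomial K) ^ k i}) = 0 := by
        rw [Submodule.Quotient.mk_eq_zero]
        exact Ideal.mem_span_singleton.2 (pow_dvd_pow _ (by omega))
      rw [this, map_zero, map_zero, map_zero]
  -- Zero summands are dropped, since the parts of a partition are positive.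
  let g := Fintype.equivFin {i // 0 < k i}
  let F : (Σ i : Fin (Fintype.card {i // 0 < k i}), Fin (k (g.symm i).1)) → (Σ i, Fin (k i)) :=
    fun x => ⟨(g.symm x.1).1, x.2⟩
  have hF : Function.Bijective F := by
    constructor
    · rintro ⟨i, a⟩ ⟨j, b⟩ h
      obtain ⟨h1, h2⟩ := Sigma.mk.inj_iff.1 h
      obtain rfl := g.symm.injective (Subtype.ext h1)
      exact Sigma.ext rfl h2
    · rintro ⟨i, a⟩
      refine ⟨⟨g ⟨i, by have := a.2; omega⟩, ⟨a, by simp⟩⟩, ?_⟩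
      refine Sigma.ext (by simp [F]) ((Fin.heq_ext_iff (by simp [F])).2 rfl)
  refine ⟨_, fun i => k (g.symm i).1, b.reindex (Equiv.ofBijective F hF).symm,
    fun i => (g.symm i).2, fun i a => ?_⟩
  simp only [Module.Basis.reindex_apply, Equiv.symm_symm, Equiv.ofBijective_apply]
  exact hb _ _

theorem exists_hasJordanType {K : Type*} [Field K] (X : Matrix (Fin n) (Fin n) K)
    (hX : IsNilpotent X) : ∃ p : n.Partition, HasJordanType p X := by
  have hN : IsNilpotent (Matrix.toLin' X) := by
    obtain ⟨s, hs⟩ := hX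
    exact ⟨s, by rw [← Matrix.toLin'_pow, hs, map_zero]⟩
  obtain ⟨r, m, b, hm, hb⟩ := exists_jordan_basis _ hN
  -- In the basis found, `N` raises the index inside a block, whereas an upper triangular Jordan
  -- block lowers it; each block is therefore reversed.
  let ρ : Equiv.Perm (Σ i, Fin (m i)) := Equiv.sigmaCongrRight fun i => Fin.revPerm
  let e := (b.reindex ρ).indexEquiv (Pi.basisFun K (Fin n))
  let b' := (b.reindex ρ).reindex e
  have hsum : (Multiset.ofList (List.ofFn m)).sum = n := by
    have := Fintype.card_congr e
    simp at this
    rw [Multiset.sum_coe, List.sum_ofFn, this]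
  refine ⟨⟨Multiset.ofList (List.ofFn m), ?_, hsum⟩, ?_⟩
  · intro i hi
    rw [Multiset.mem_coe, List.mem_ofFn] at hi
    obtain ⟨j, rfl⟩ := hi
    exact hm j
  rw [hasJordanType_iff]
  refine ⟨r, m, e, Matrix.of fun x y => b' y x, rfl, ?_, ?_⟩
  · have : Matrix.of (fun x y => b' y x) = (Pi.basisFun K (Fin n)).toMatrix b' := rfl
    rw [this]
    have := (Pi.basisFun K (Fin n)).invertibleToMatrix b'
    exact isUnit_of_invertible _
  · have hb1 : ∀ y, X *ᵥ (b' y) = ((jordanPEquiv m e).symm y).elim 0 b' := by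
      intro y
      have hb' : ∀ y, b' y = b (ρ (e.symm y)) := by
        intro y
        simp only [b', Module.Basis.reindex_apply]
        rfl
      rw [hb', ← Matrix.toLin'_apply]
      cases h : (jordanPEquiv m e).symm y with
      | none =>
        generalize he : e.symm y = y' at *
        obtain ⟨i, a⟩ := y'
        refine (hb _ _).trans (dif_neg fun ha => ?_)
        change (a.rev : ℕ) + 1 < m i at ha
        rw [Fin.val_rev] at ha
        have hz : jordanPEquiv m e (e ⟨i, ⟨a - 1, by omega⟩⟩) = some y := by
          rw [jordanPEquiv_eq_some_iff, jordanShift_eq_some_iff, e.symm_apply_apply, he]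
          refine ⟨rfl, ?_⟩
          dsimp only
          omega
        rw [← PEquiv.eq_some_iff, h] at hz
        exact absurd hz (by simp)
      | some z =>
        rw [PEquiv.eq_some_iff, jordanPEquiv_eq_some_iff, jordanShift_eq_some_iff] at h
        rw [Option.elim_some, hb']
        generalize e.symm y = y' at *
        generalize e.symm z = z' at *
        obtain ⟨i, a⟩ := y'
        obtain ⟨j, a'⟩ := z'
        obtain ⟨h1, h2⟩ := h
        dsimp only at h1 h2
        subst h1
        have h3 : (a.rev : ℕ) + 1 < m j := by rw [Fin.val_rev]; omega
        refine (hb _ _).trans ((dif_pos h3).trans (congrArg b (Sigma.ext rfl (heq_of_eq ?_))))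
        refine Fin.ext ?_
        change (a.rev : ℕ) + 1 = a'.rev
        rw [Fin.val_rev, Fin.val_rev]
        omega
    ext x y
    rw [PEquiv.mul_toMatrix_apply]
    have h2 := congrFun (hb1 y) x
    refine Eq.trans ?_ (h2.trans ?_)
    · rfl
    · cases (jordanPEquiv m e).symm y <;> rfl

end JordanShift

/-! ### Complete local algebras and their quotients -/

noncomputable section CompleteLocalAlgebras

open IsLocalRing

theorem IsPrecomplete.of_surjective {R M N : Type*} [CommRing R] (I : Ideal R) [AddCommGroup M]
    [Module R M] [AddCommGroup N] [Module R N] [IsPrecomplete I M] (f : M →ₗ[R] N)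
    (hf : Function.Surjective f) : IsPrecomplete I N := by
  rw [← AdicCompletion.of_surjective_iff]
  intro y
  obtain ⟨x', rfl⟩ := AdicCompletion.map_surjective I hf y
  obtain ⟨x, rfl⟩ := AdicCompletion.of_surjective I M x'
  exact ⟨f x, (AdicCompletion.map_of I f x).symm⟩

/-- Precompleteness passes to quotients because completion preserves surjections; separatedness is
Krull's intersection theorem. -/
theorem IsAdicComplete.quotient_maximalIdeal {R : Type*} [CommRing R] [IsLocalRing R]
    [IsNoetherianRing R] [IsAdicComplete (maximalIdeal R) R] (I : Ideal R) [IsLocalRing (R ⧸ I)] :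
    IsAdicComplete (maximalIdeal (R ⧸ I)) (R ⧸ I) := by
  have h1 : IsPrecomplete (maximalIdeal R) (R ⧸ I) :=
    IsPrecomplete.of_surjective _ (Submodule.mkQ I) (Submodule.mkQ_surjective I)
  have h2 : maximalIdeal (R ⧸ I) = (maximalIdeal R).map (algebraMap R (R ⧸ I)) :=
    (IsLocalRing.map_maximalIdeal_of_surjective _ Ideal.Quotient.mk_surjective).symm
  have h3 : IsPrecomplete (maximalIdeal (R ⧸ I)) (R ⧸ I) := by
    rw [h2]
    exact IsPrecomplete.map_algebraMap_iff.2 h1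
  exact { toIsPrecomplete := h3, toIsHausdorff := inferInstance }

/-- Precompleteness passes to an ideal with the same radical. -/
theorem IsPrecomplete.of_pow_le {R : Type*} [CommRing R] {I J : Ideal R} [IsPrecomplete I R] {e : ℕ}
    (he : 0 < e) (h1 : J ^ e ≤ I) (h2 : I ≤ J) : IsPrecomplete J R := by
  constructor
  intro f hf
  simp only [smul_eq_mul, Ideal.mul_top] at hf ⊢
  -- The subsequence at the indices `e * n` is Cauchy for the smaller ideal `I`, because `J ^ (e *
  -- n) ≤ I ^ n`. Its limit is also the limit of the whole sequence for `J`.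
  obtain ⟨L, hL⟩ := IsPrecomplete.prec (I := I) (M := R) inferInstance (f := fun n => f (e * n)) (by
    intro m n hmn
    have := hf (Nat.mul_le_mul_left e hmn)
    rw [SModEq.sub_mem] at this ⊢
    simp only [smul_eq_mul, Ideal.mul_top]
    rw [pow_mul] at this
    exact Ideal.pow_right_mono h1 m this)
  refine ⟨L, fun n => ?_⟩
  have h3 := hL n
  simp only [smul_eq_mul, Ideal.mul_top] at h3
  exact (hf (Nat.le_mul_of_pos_left n he)).trans (SModEq.mono (Ideal.pow_right_mono h2 n) h3)

namespace CompleteLocalAlg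

variable {O : Type u} [CommRing O] [IsLocalRing O]

theorem exists_sub_mem (R : CompleteLocalAlg O) (x : R) :
    ∃ o : O, x - algebraMap O R o ∈ maximalIdeal R := by
  obtain ⟨y, hy⟩ := R.residue_bijective.2 (residue R x)
  obtain ⟨o, rfl⟩ := residue_surjective y
  refine ⟨o, ?_⟩
  rw [← residue_eq_zero_iff, map_sub, ← hy, sub_eq_zero]
  rfl

theorem algebraMap_mem (R : CompleteLocalAlg O) {o : O} (ho : o ∈ maximalIdeal O) :
    algebraMap O R o ∈ maximalIdeal R := by
  have h : (maximalIdeal O).map (algebraMap O R) ≤ maximalIdeal R :=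
    ((IsLocalRing.local_hom_TFAE (algebraMap O R)).out 0 2).1 R.isLocalHom
  exact h (Ideal.mem_map_of_mem _ ho)

/-- Homomorphisms of `O`-algebras are automatically local. If `f x` is congruent to a unit `o` of
`O`, then `x - o` is a unit of `R`, while its image `f x - o` lies in the maximal ideal of `S`. -/
theorem map_mem (R S : CompleteLocalAlg O) (f : R →ₐ[O] S) {x : R} (hx : x ∈ maximalIdeal R) :
    f x ∈ maximalIdeal S := by
  obtain ⟨o, ho⟩ := S.exists_sub_mem (f x)
  by_cases hu : IsUnit o
  · exfalso
    have h1 : IsUnit (x - algebraMap O R o) := by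
      by_contra h
      have h2 := (maximalIdeal R).sub_mem hx ((mem_maximalIdeal _).2 h)
      rw [sub_sub_cancel] at h2
      exact (mem_maximalIdeal _).1 h2 (hu.map _)
    have h3 := h1.map f
    rw [map_sub, f.commutes] at h3
    exact (mem_maximalIdeal _).1 ho h3
  · have := (maximalIdeal S).add_mem ho (S.algebraMap_mem ((mem_maximalIdeal _).2 hu))
    rwa [sub_add_cancel] at this

/-- An object of the category of complete Noetherian local `O`-algebras, from its properties. -/
def mk' (B : Type u) [CommRing B] [Algebra O B] [IsLocalRing B] [IsNoetherianRing B]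
    [IsAdicComplete (maximalIdeal B) B]
    (h1 : ∀ o ∈ maximalIdeal O, algebraMap O B o ∈ maximalIdeal B)
    (h2 : ∀ b : B, ∃ o : O, b - algebraMap O B o ∈ maximalIdeal B) : CompleteLocalAlg O :=
  have hl : IsLocalHom (algebraMap O B) :=
    ((IsLocalRing.local_hom_TFAE (algebraMap O B)).out 0 2).2 (Ideal.map_le_iff_le_comap.2 h1)
  { carrier := B
    residue_bijective := ⟨RingHom.injective _, fun y => by
      obtain ⟨b, rfl⟩ := residue_surjective y
      obtain ⟨o, ho⟩ := h2 b
      refine ⟨residue O o, ?_⟩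
      rw [← residue_eq_zero_iff, map_sub, sub_eq_zero] at ho
      exact ho.symm⟩ }

/-- The quotient of an object by a proper ideal. -/
def quot (R : CompleteLocalAlg O) (I : Ideal R) (hI : I ≤ maximalIdeal R) : CompleteLocalAlg O :=
  have : Nontrivial (R ⧸ I) := Ideal.Quotient.nontrivial_iff.2
    fun h => (Ideal.IsPrime.ne_top' (I := maximalIdeal R)) (top_le_iff.1 (h ▸ hI))
  have : IsLocalRing (R ⧸ I) :=
    IsLocalRing.of_surjective' (Ideal.Quotient.mk I) Ideal.Quotient.mk_surjective
  have : IsAdicComplete (maximalIdeal (R ⧸ I)) (R ⧸ I) := IsAdicComplete.quotient_maximalIdeal I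
  have hm : ∀ x ∈ maximalIdeal R, Ideal.Quotient.mk I x ∈ maximalIdeal (R ⧸ I) := fun x hx => by
    rw [← IsLocalRing.map_maximalIdeal_of_surjective _ (Ideal.Quotient.mk_surjective (I := I))]
    exact Ideal.mem_map_of_mem _ hx
  mk' (R ⧸ I) (fun o ho => hm _ (R.algebraMap_mem ho)) (fun b => by
    obtain ⟨x, rfl⟩ := Ideal.Quotient.mk_surjective b
    obtain ⟨o, ho⟩ := R.exists_sub_mem x
    refine ⟨o, ?_⟩
    have := hm _ ho
    rwa [map_sub] at this)

/-- The projection to the quotient. -/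
def quotMk (R : CompleteLocalAlg O) (I : Ideal R) (hI : I ≤ maximalIdeal R) :
    R →ₐ[O] R.quot I hI :=
  Ideal.Quotient.mkₐ O I

theorem quotMk_surjective (R : CompleteLocalAlg O) (I : Ideal R) (hI : I ≤ maximalIdeal R) :
    Function.Surjective (R.quotMk I hI) :=
  Ideal.Quotient.mk_surjective

theorem quotMk_eq_zero_iff (R : CompleteLocalAlg O) (I : Ideal R) (hI : I ≤ maximalIdeal R) {x : R} :
    R.quotMk I hI x = 0 ↔ x ∈ I :=
  Ideal.Quotient.eq_zero_iff_mem

/-- A homomorphism that is trivial on the ideal factors through the quotient. -/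
def quotLift (R : CompleteLocalAlg O) (I : Ideal R) (hI : I ≤ maximalIdeal R)
    {B : Type*} [CommRing B] [Algebra O B] (f : R →ₐ[O] B) (hf : ∀ x ∈ I, f x = 0) :
    R.quot I hI →ₐ[O] B :=
  Ideal.Quotient.liftₐ I f hf

theorem quotLift_quotMk (R : CompleteLocalAlg O) (I : Ideal R) (hI : I ≤ maximalIdeal R)
    {B : Type*} [CommRing B] [Algebra O B] (f : R →ₐ[O] B) (hf : ∀ x ∈ I, f x = 0) (x : R) :
    R.quotLift I hI f hf (R.quotMk I hI x) = f x :=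
  rfl

theorem algHom_ext_of_quotients {A : Type*} [CommRing A] [Algebra O A] (R : CompleteLocalAlg O)
    {f g : A →ₐ[O] R} (h : ∀ (m : ℕ) (x : A), f x - g x ∈ maximalIdeal R ^ m) : f = g := by
  refine AlgHom.ext fun x => sub_eq_zero.1 (IsHausdorff.haus (I := maximalIdeal R) inferInstance _
    fun m => ?_)
  rw [SModEq.zero, smul_eq_mul, Ideal.mul_top]
  exact h m x

variable (O) in
/-- The object `O` itself. -/
def self [IsNoetherianRing O] [IsAdicComplete (maximalIdeal O) O] : CompleteLocalAlg O :=
  mk' O (fun _ ho => ho) (fun b => ⟨b, by simp⟩)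

end CompleteLocalAlg

end CompleteLocalAlgebras

/-! ### Power series over complete local algebras -/

noncomputable section PowerSeriesAlgebras

open IsLocalRing PowerSeries

theorem PowerSeries.mem_maximalIdeal_iff {R : Type*} [CommRing R] [IsLocalRing R] (p : R⟦X⟧) :
    p ∈ maximalIdeal R⟦X⟧ ↔ constantCoeff p ∈ maximalIdeal R := by
  rw [mem_maximalIdeal, mem_maximalIdeal, mem_nonunits_iff, mem_nonunits_iff,
    isUnit_iff_constantCoeff]

/-- The maximal ideal is generated by `X` and the maximal ideal of `R`, and each factor `X` pays for
one power. This allows convergence to be checked coefficient by coefficient. -/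
theorem PowerSeries.mem_maximalIdeal_pow_iff {R : Type*} [CommRing R] [IsLocalRing R] (k : ℕ)
    (p : R⟦X⟧) : p ∈ maximalIdeal R⟦X⟧ ^ k ↔ ∀ i, coeff i p ∈ maximalIdeal R ^ (k - i) := by
  constructor
  · revert p
    induction k with
    | zero => intro p _ i; simp
    | succ k ih =>
      intro p hp i
      rw [pow_succ] at hp
      refine Submodule.mul_induction_on hp (fun a ha b hb => ?_) (fun a b ha hb => ?_)
      · rw [coeff_mul]
        refine Ideal.sum_mem _ fun x hx => ?_
        have hx' := Finset.HasAntidiagonal.mem_antidiagonal.1 hx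
        have h1 := ih a ha x.1
        by_cases h0 : x.2 = 0
        · have h2 : coeff x.2 b ∈ maximalIdeal R := by
            rw [h0, coeff_zero_eq_constantCoeff_apply]
            exact (mem_maximalIdeal_iff b).1 hb
          have h3 := Ideal.mul_mem_mul h1 h2
          rw [← pow_succ] at h3
          exact Ideal.pow_le_pow_right (by omega) h3
        · exact Ideal.mul_mem_right _ _ (Ideal.pow_le_pow_right (by omega) h1)
      · rw [map_add]
        exact Ideal.add_mem _ ha hb
  · intro hp
    have hX : (X : R⟦X⟧) ∈ maximalIdeal R⟦X⟧ := by
      rw [mem_maximalIdeal_iff, constantCoeff_X]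
      exact zero_mem _
    have hC : (maximalIdeal R).map (C (R := R)) ≤ maximalIdeal R⟦X⟧ := by
      rw [Ideal.map_le_iff_le_comap]
      intro a ha
      rw [Ideal.mem_comap, mem_maximalIdeal_iff, constantCoeff_C]
      exact ha
    rw [eq_X_pow_mul_shift_add_trunc k p]
    refine Ideal.add_mem _ (Ideal.mul_mem_right _ _ (Ideal.pow_mem_pow hX k)) ?_
    rw [Polynomial.as_sum_support (trunc k p), ← Polynomial.coeToPowerSeries.ringHom_apply, map_sum]
    refine Ideal.sum_mem _ fun i hi => ?_
    rw [Polynomial.coeToPowerSeries.ringHom_apply, Polynomial.coe_monomial, monomial_eq_C_mul_X_pow,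
      coeff_trunc]
    split_ifs with hik
    swap
    · rw [map_zero, zero_mul]
      exact zero_mem _
    have h1 : C (coeff i p) ∈ maximalIdeal R⟦X⟧ ^ (k - i) := by
      have := Ideal.mem_map_of_mem (C (R := R)) (hp i)
      rw [Ideal.map_pow] at this
      exact Ideal.pow_right_mono hC _ this
    have h2 := Ideal.mul_mem_mul h1 (Ideal.pow_mem_pow hX i)
    rw [← pow_add] at h2
    exact Ideal.pow_le_pow_right (by omega) h2

instance PowerSeries.isAdicComplete_maximalIdeal {R : Type*} [CommRing R] [IsLocalRing R]
    [IsNoetherianRing R] [IsAdicComplete (maximalIdeal R) R] :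
    IsAdicComplete (maximalIdeal R⟦X⟧) R⟦X⟧ := by
  have h : IsPrecomplete (maximalIdeal R⟦X⟧) R⟦X⟧ := by
    constructor
    intro f hf
    simp only [smul_eq_mul, Ideal.mul_top, SModEq.sub_mem, mem_maximalIdeal_pow_iff, map_sub] at hf ⊢
    -- The `i`-th coefficient of a member of the `k`-th power is only controlled to order `k - i`,
    -- so its limit is taken along the sequence delayed by `i`.
    have hL : ∀ i, ∃ L : R, ∀ n, coeff i (f (n + i)) - L ∈ maximalIdeal R ^ n := by
      intro i
      obtain ⟨L, hL⟩ := IsPrecomplete.prec (I := maximalIdeal R) (M := R) inferInstance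
        (f := fun n => coeff i (f (n + i))) (by
          intro m n hmn
          have := hf (Nat.add_le_add_right hmn i) i
          rw [SModEq.sub_mem, smul_eq_mul, Ideal.mul_top]
          rwa [Nat.add_sub_cancel] at this)
      refine ⟨L, fun n => ?_⟩
      have := hL n
      rwa [SModEq.sub_mem, smul_eq_mul, Ideal.mul_top] at this
    choose L hL using hL
    refine ⟨PowerSeries.mk L, fun n i => ?_⟩
    rw [coeff_mk]
    rcases le_total i n with h | h
    · have := hL i (n - i)
      rwa [Nat.sub_add_cancel h] at this
    · rw [Nat.sub_eq_zero_of_le h, pow_zero, Ideal.one_eq_top]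
      exact Submodule.mem_top
  exact { toIsPrecomplete := h, toIsHausdorff := inferInstance }

section Evaluation

variable {O : Type*} [CommRing O] {R : Type*} [CommRing R] [Algebra O R]
  {A : Type*} [CommRing A] [Algebra O A]

/-- If `X` has nilpotent image, the tail `X ^ K * _` is killed and the homomorphism is determined by
polynomials, without any continuity assumption. -/
theorem PowerSeries.apply_eq_eval₂_trunc (g : R⟦X⟧ →+* A) {K : ℕ} (hK : g X ^ K = 0) (p : R⟦X⟧) :
    g p = (trunc K p).eval₂ (g.comp C) (g X) := by
  have h : ∀ s : Polynomial R, g (s : R⟦X⟧) = s.eval₂ (g.comp C) (g X) := by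
    intro s
    induction s using Polynomial.induction_on' with
    | add a b ha hb => rw [Polynomial.coe_add, map_add, ha, hb, Polynomial.eval₂_add]
    | monomial i r =>
      rw [Polynomial.coe_monomial, monomial_eq_C_mul_X_pow, map_mul, map_pow,
        Polynomial.eval₂_monomial]
      rfl
  conv_lhs => rw [eq_X_pow_mul_shift_add_trunc K p]
  rw [map_add, map_mul, map_pow, hK, zero_mul, zero_add, h]

theorem PowerSeries.ringHom_ext_of_isNilpotent {f g : R⟦X⟧ →+* A} (h1 : f.comp C = g.comp C)
    (h2 : f X = g X) (h3 : IsNilpotent (f X)) : f = g := by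
  obtain ⟨K, hK⟩ := h3
  ext p
  rw [apply_eq_eval₂_trunc f hK, apply_eq_eval₂_trunc g (h2 ▸ hK), h1, h2]

theorem PowerSeries.exists_algHom_of_isNilpotent (φ : R →ₐ[O] A) {a : A} (ha : IsNilpotent a) :
    ∃ g : R⟦X⟧ →ₐ[O] A, (∀ r, g (C r) = φ r) ∧ g X = a := by
  obtain ⟨K, hK⟩ := ha
  -- Truncation at length at least `2` keeps `X` itself intact, even if `K` is `0` or `1`.
  have hK' : a ^ (K + 2) = 0 := by rw [pow_add, hK, zero_mul]
  have hmul : ∀ p q : R⟦X⟧, (trunc (K + 2) (p * q)).eval₂ (φ : R →+* A) a =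
      (trunc (K + 2) p).eval₂ (φ : R →+* A) a * (trunc (K + 2) q).eval₂ (φ : R →+* A) a := by
    intro p q
    rw [← Polynomial.eval₂_mul, ← sub_eq_zero, ← Polynomial.eval₂_sub]
    have : Polynomial.X ^ (K + 2) ∣ trunc (K + 2) (p * q) - trunc (K + 2) p * trunc (K + 2) q := by
      rw [Polynomial.X_pow_dvd_iff]
      intro d hd
      rw [Polynomial.coeff_sub, sub_eq_zero, coeff_trunc, if_pos hd,
        coeff_mul_eq_coeff_trunc_mul_trunc p q hd, ← Polynomial.coe_mul, Polynomial.coeff_coe]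
    obtain ⟨c, hc⟩ := this
    rw [hc, Polynomial.eval₂_mul, Polynomial.eval₂_X_pow, hK', zero_mul]
  refine ⟨AlgHom.mk (RingHom.mk (MonoidHom.mk (OneHom.mk
    (fun p => (trunc (K + 2) p).eval₂ (φ : R →+* A) a) ?_) hmul) ?_ ?_) ?_, ?_, ?_⟩
  · rw [trunc_one, Polynomial.eval₂_one]
  · simp
  · intro p q
    simp only [map_add, Polynomial.eval₂_add]
  · intro o
    change (trunc (K + 2) (algebraMap O R⟦X⟧ o)).eval₂ (φ : R →+* A) a = _
    rw [PowerSeries.algebraMap_apply, trunc_C, Polynomial.eval₂_C]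
    exact φ.commutes o
  · intro r
    change (trunc (K + 2) (C r)).eval₂ (φ : R →+* A) a = _
    rw [trunc_C, Polynomial.eval₂_C]
    rfl
  · change (trunc (K + 2) X).eval₂ (φ : R →+* A) a = _
    rw [trunc_X, Polynomial.eval₂_X]

end Evaluation

variable {O : Type u} [CommRing O] [IsLocalRing O]

namespace CompleteLocalAlg

/-- The power series ring `R[[X]]`. -/
def powerSeries (R : CompleteLocalAlg O) : CompleteLocalAlg O :=
  mk' R⟦X⟧
    (fun o ho => by
      rw [PowerSeries.mem_maximalIdeal_iff, PowerSeries.algebraMap_apply, constantCoeff_C]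
      exact R.algebraMap_mem ho)
    (fun b => by
      obtain ⟨o, ho⟩ := R.exists_sub_mem (constantCoeff b)
      refine ⟨o, ?_⟩
      rw [PowerSeries.mem_maximalIdeal_iff, PowerSeries.algebraMap_apply, map_sub, constantCoeff_C]
      exact ho)

/-- The inclusion `R → R[[X]]`. -/
def powerSeriesC (R : CompleteLocalAlg O) : R →ₐ[O] R.powerSeries :=
  { (C (R := R) : R →+* R⟦X⟧) with
    commutes' := fun o => (PowerSeries.algebraMap_apply (r := o) (A := R)).symm }

/-- The variable of `R[[X]]`. -/
def powerSeriesX (R : CompleteLocalAlg O) : R.powerSeries := (X : R⟦X⟧)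

theorem powerSeriesX_mem (R : CompleteLocalAlg O) :
    R.powerSeriesX ∈ maximalIdeal R.powerSeries :=
  (PowerSeries.mem_maximalIdeal_iff (X : R⟦X⟧)).2 (by rw [constantCoeff_X]; exact zero_mem _)

theorem isNilpotent_mk_pow (T : CompleteLocalAlg O) {a : T} (ha : a ∈ maximalIdeal T) (m : ℕ) :
    IsNilpotent (Ideal.Quotient.mk (maximalIdeal T ^ m) a) :=
  ⟨m, by rw [← map_pow, Ideal.Quotient.eq_zero_iff_mem]; exact Ideal.pow_mem_pow ha m⟩

/-- Modulo each power of the maximal ideal of `T` the image of the variable is nilpotent, so the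
homomorphisms agree there; `T` is separated. -/
theorem powerSeries_algHom_ext (R T : CompleteLocalAlg O) {f g : R.powerSeries →ₐ[O] T}
    (h1 : f.comp R.powerSeriesC = g.comp R.powerSeriesC)
    (h2 : f R.powerSeriesX = g R.powerSeriesX) : f = g := by
  refine T.algHom_ext_of_quotients fun m x => ?_
  rw [← Ideal.Quotient.eq_zero_iff_mem, map_sub, sub_eq_zero]
  have := PowerSeries.ringHom_ext_of_isNilpotent (R := R)
    (f := (Ideal.Quotient.mk (maximalIdeal T ^ m)).comp (f : R.powerSeries →+* T))
    (g := (Ideal.Quotient.mk (maximalIdeal T ^ m)).comp (g : R.powerSeries →+* T))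
    (by
      ext r
      have h3 : f (R.powerSeriesC r) = g (R.powerSeriesC r) := DFunLike.congr_fun h1 r
      exact congrArg (Ideal.Quotient.mk (maximalIdeal T ^ m)) h3)
    (congrArg (Ideal.Quotient.mk (maximalIdeal T ^ m)) h2)
    (T.isNilpotent_mk_pow (map_mem _ _ f R.powerSeriesX_mem) m)
  exact DFunLike.congr_fun this x

/-- Evaluation at `a` is defined modulo each power of the maximal ideal of `T`, where `a` is
nilpotent. These homomorphisms are compatible, and `T` is complete. -/
theorem exists_powerSeries_algHom (R T : CompleteLocalAlg O) (φ : R →ₐ[O] T) {a : T}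
    (ha : a ∈ maximalIdeal T) :
    ∃ f : R.powerSeries →ₐ[O] T, f.comp R.powerSeriesC = φ ∧ f R.powerSeriesX = a := by
  choose f hf1 hf2 using fun m : ℕ => PowerSeries.exists_algHom_of_isNilpotent
    ((Ideal.Quotient.mkₐ O (maximalIdeal T ^ m)).comp φ) (T.isNilpotent_mk_pow ha m)
  let F : R.powerSeries →ₐ[O] T := IsAdicComplete.liftAlgHom (maximalIdeal T) f (by
    intro m n hmn
    refine AlgHom.coe_ringHom_injective ?_
    refine PowerSeries.ringHom_ext_of_isNilpotent ?_ ?_ ?_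
    · ext r
      change Ideal.Quotient.factorₐ O (Ideal.pow_le_pow_right hmn) (f n (C r)) = f m (C r)
      rw [hf1, hf1]
      rfl
    · change Ideal.Quotient.factorₐ O (Ideal.pow_le_pow_right hmn) (f n X) = f m X
      rw [hf2, hf2]
      rfl
    · change IsNilpotent (Ideal.Quotient.factorₐ O (Ideal.pow_le_pow_right hmn) (f n X))
      rw [hf2]
      exact (T.isNilpotent_mk_pow ha n).map _)
  have hF : ∀ m x, Ideal.Quotient.mk (maximalIdeal T ^ m) (F x) = f m x := fun m x =>
    IsAdicComplete.mk_liftAlgHom _ _ _ m x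
  refine ⟨F, T.algHom_ext_of_quotients fun m x => ?_, ?_⟩
  · rw [← Ideal.Quotient.eq_zero_iff_mem, map_sub, sub_eq_zero]
    exact (hF m _).trans (hf1 m x)
  · refine sub_eq_zero.1 (IsHausdorff.haus (I := maximalIdeal T) inferInstance _ fun m => ?_)
    rw [SModEq.zero, smul_eq_mul, Ideal.mul_top, ← Ideal.Quotient.eq_zero_iff_mem, map_sub,
      sub_eq_zero]
    exact (hF m _).trans (hf2 m)

end CompleteLocalAlg

end PowerSeriesAlgebras

/-! ### Formal affine spaces: universal property, smoothness, dimension -/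

noncomputable section FormalAffineSpace

open IsLocalRing PowerSeries

variable {O : Type u} [CommRing O] [IsLocalRing O]

theorem Ideal.exists_pow_le_ker_of_isNilpotent {S A : Type*} [CommRing S] [CommRing A]
    [IsNoetherianRing S] (𝔞 : Ideal S) (g : S →+* A) (h : ∀ x ∈ 𝔞, IsNilpotent (g x)) :
    ∃ m : ℕ, 𝔞 ^ m ≤ RingHom.ker g := by
  refine Ideal.exists_pow_le_of_le_radical_of_fg (fun x hx => ?_) (IsNoetherian.noetherian 𝔞)
  obtain ⟨m, hm⟩ := h x hx
  exact ⟨m, by rw [RingHom.mem_ker, map_pow, hm]⟩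

theorem isNilpotent_of_mk_isNilpotent {A : Type*} [CommRing A] {J : Ideal A} (hJ : IsNilpotent J)
    {a : A} (ha : IsNilpotent (Ideal.Quotient.mk J a)) : IsNilpotent a := by
  obtain ⟨m, hm⟩ := ha
  obtain ⟨k, hk⟩ := hJ
  rw [← map_pow, Ideal.Quotient.eq_zero_iff_mem] at hm
  refine ⟨m * k, ?_⟩
  have := Ideal.pow_mem_pow hm k
  rw [hk] at this
  rw [pow_mul]
  exact this

theorem isNilpotent_of_pow_le_ker {S B : Type*} [CommRing S] [CommRing B] {𝔞 : Ideal S} {f : S →+* B}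
    (hf : ∃ m : ℕ, 𝔞 ^ m ≤ RingHom.ker f) {x : S} (hx : x ∈ 𝔞) : IsNilpotent (f x) := by
  obtain ⟨m, hm⟩ := hf
  exact ⟨m, by rw [← map_pow]; exact hm (Ideal.pow_mem_pow hx m)⟩

theorem isAdicallyFormallySmooth_self [IsNoetherianRing O] :
    IsAdicallyFormallySmooth O O (maximalIdeal O) := by
  intro A _ _ J hJ f hf
  refine ⟨Algebra.ofId O A, Ideal.exists_pow_le_ker_of_isNilpotent _ _ fun x hx => ?_,
    Subsingleton.elim _ _⟩
  refine isNilpotent_of_mk_isNilpotent hJ ?_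
  have h1 := isNilpotent_of_pow_le_ker (f := (f : O →+* A ⧸ J)) hf hx
  have h2 : f x = Ideal.Quotient.mk J (Algebra.ofId O A x) :=
    f.commutes x
  exact h2 ▸ h1

/-- The restriction to `R` lifts by hypothesis, and the image of the variable may be lifted
arbitrarily: a lift of a nilpotent element modulo a nilpotent ideal is nilpotent, so evaluation at
it makes sense. -/
theorem isAdicallyFormallySmooth_powerSeries (R : CompleteLocalAlg O)
    (hR : IsAdicallyFormallySmooth O R (maximalIdeal R)) :
    IsAdicallyFormallySmooth O R.powerSeries (maximalIdeal R.powerSeries) := by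
  intro A _ _ J hJ f hf
  have hnil : ∀ x ∈ maximalIdeal R.powerSeries, IsNilpotent (f x) := fun x hx =>
    isNilpotent_of_pow_le_ker (f := (f : R.powerSeries →+* A ⧸ J)) hf hx
  obtain ⟨g₀, hg₀, hfg⟩ := hR A J hJ (f.comp R.powerSeriesC)
    (Ideal.exists_pow_le_ker_of_isNilpotent _ ((f.comp R.powerSeriesC : R →ₐ[O] A ⧸ J) : R →+* A ⧸ J)
      fun x hx => hnil _ (R.map_mem R.powerSeries R.powerSeriesC hx))
  obtain ⟨a, ha⟩ := Ideal.Quotient.mk_surjective (f R.powerSeriesX)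
  have hXn := hnil _ R.powerSeriesX_mem
  have han : IsNilpotent a := isNilpotent_of_mk_isNilpotent hJ (ha ▸ hXn)
  obtain ⟨g, hg1, hg2⟩ := PowerSeries.exists_algHom_of_isNilpotent g₀ han
  refine ⟨g, Ideal.exists_pow_le_ker_of_isNilpotent (S := R.powerSeries) _ (g : R⟦X⟧ →+* A)
    fun x hx => ?_, ?_⟩
  · have h1 : constantCoeff (R := R) x ∈ maximalIdeal R :=
      (PowerSeries.mem_maximalIdeal_iff (R := R) x).1 hx
    have h2 : g x = g (C (constantCoeff (R := R) x)) +
        g (PowerSeries.mk fun p => coeff (R := R) (p + 1) x) * a := by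
      conv_lhs => rw [PowerSeries.eq_shift_mul_X_add_const (R := R) x]
      rw [map_add, map_mul, hg2, add_comm]
    change IsNilpotent (g x)
    rw [h2, hg1]
    exact (Commute.all _ _).isNilpotent_add
      (isNilpotent_of_pow_le_ker (f := (g₀ : R →+* A)) hg₀ h1)
      ((Commute.all _ _).isNilpotent_mul_left han)
  · refine AlgHom.coe_ringHom_injective ?_
    refine PowerSeries.ringHom_ext_of_isNilpotent (R := R) ?_ ?_ ?_
    · ext r
      change Ideal.Quotient.mk J (g (C r)) = _
      rw [hg1]
      exact DFunLike.congr_fun hfg r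
    · change Ideal.Quotient.mk J (g X) = _
      rw [hg2]
      exact ha
    · change IsNilpotent (Ideal.Quotient.mk J (g X))
      rw [hg2, ha]
      exact hXn

/-- The ring `S` is the ring of power series over `O` in the variables `x`. -/
structure IsFormalAffineSpace (N : ℕ) (S : CompleteLocalAlg O) (x : Fin N → S) : Prop where
  mem : ∀ i, x i ∈ maximalIdeal S
  exists_algHom : ∀ (T : CompleteLocalAlg O) (a : Fin N → T), (∀ i, a i ∈ maximalIdeal T) →
    ∃ f : S →ₐ[O] T, ∀ i, f (x i) = a i
  algHom_ext : ∀ (T : CompleteLocalAlg O) (f g : S →ₐ[O] T), (∀ i, f (x i) = g (x i)) → f = g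
  smooth : IsAdicallyFormallySmooth O S (maximalIdeal S)
  isPrime : ((maximalIdeal O).map (algebraMap O S)).IsPrime
  dim : ringKrullDim (S ⧸ (maximalIdeal O).map (algebraMap O S)) = N

/-- `R[[X]] / (c) ≅ (R / (c))[[X]]`. -/
def quotientSpanPowerSeriesEquiv {R : Type*} [CommRing R] (c : R) :
    (R⟦X⟧ ⧸ Ideal.span {C c}) ≃+* (R ⧸ Ideal.span {c})⟦X⟧ :=
  (Ideal.quotEquivOfEq (by
    ext p
    rw [RingHom.mem_ker, Ideal.mem_span_singleton]
    constructor
    · rintro ⟨s, rfl⟩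
      ext i
      rw [coeff_map, coeff_C_mul, map_zero, Ideal.Quotient.eq_zero_iff_mem]
      exact Ideal.mul_mem_right _ _ (Ideal.mem_span_singleton_self c)
    · intro h
      have h1 : ∀ i, ∃ d, coeff i p = c * d := fun i => by
        have := congrArg (coeff i) h
        rw [coeff_map, map_zero, Ideal.Quotient.eq_zero_iff_mem, Ideal.mem_span_singleton] at this
        exact this
      choose d hd using h1
      exact ⟨PowerSeries.mk d, by ext i; rw [hd, coeff_C_mul, coeff_mk]⟩)).trans
    (RingHom.quotientKerEquivOfSurjective
      (PowerSeries.map_surjective (Ideal.Quotient.mk (Ideal.span {c})) Ideal.Quotient.mk_surjective))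

/-- The variable is a nonzerodivisor in the maximal ideal of a Noetherian local ring, and dividing
by it drops the dimension by one and gives `D`. -/
theorem ringKrullDim_powerSeries_eq {D : Type*} [CommRing D] [IsLocalRing D] [IsNoetherianRing D] :
    ringKrullDim D⟦X⟧ = ringKrullDim D + 1 := by
  have hX : (X : D⟦X⟧) ∈ maximalIdeal D⟦X⟧ :=
    (PowerSeries.mem_maximalIdeal_iff _).2 (by rw [constantCoeff_X]; exact zero_mem _)
  have hreg : (X : D⟦X⟧) ∈ nonZeroDivisors D⟦X⟧ := by
    rw [mem_nonZeroDivisors_iff_right]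
    intro p hp
    ext i
    have := congrArg (coeff (i + 1)) hp
    rwa [coeff_succ_mul_X] at this
  rw [← ringKrullDim_quotient_span_singleton_succ_eq_ringKrullDim_of_mem_nonZeroDivisors hreg hX]
  congr 1
  refine ringKrullDim_eq_of_ringEquiv ((Ideal.quotEquivOfEq ?_).trans
    (RingHom.quotientKerEquivOfSurjective (f := constantCoeff (R := D))
      (PowerSeries.constantCoeff_surj)))
  ext p
  rw [RingHom.mem_ker, Ideal.mem_span_singleton, X_dvd_iff]

theorem isFormalAffineSpace_self [IsNoetherianRing O] [IsAdicComplete (maximalIdeal O) O] :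
    IsFormalAffineSpace 0 (CompleteLocalAlg.self O) (fun i => i.elim0) where
  mem i := i.elim0
  exists_algHom T a ha := ⟨(Algebra.ofId O T : O →ₐ[O] T), fun i => i.elim0⟩
  algHom_ext T f g _ := AlgHom.ext fun o : O => (f.commutes o).trans (g.commutes o).symm
  smooth := isAdicallyFormallySmooth_self
  isPrime := by
    change ((maximalIdeal O).map (RingHom.id O)).IsPrime
    rw [Ideal.map_id]
    infer_instance
  dim := by
    change ringKrullDim (O ⧸ (maximalIdeal O).map (RingHom.id O)) = _
    rw [Ideal.map_id]
    exact ringKrullDim_eq_zero_of_field (ResidueField O)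

/-- The maximal ideal of `O` is principal, so the special fibre of `S[[X]]` is the power series ring
over the special fibre of `S`; this gives both the domain property and the dimension. -/
theorem IsFormalAffineSpace.powerSeries [IsPrincipalIdealRing O] {N : ℕ} {S : CompleteLocalAlg O}
    {x : Fin N → S} (h : IsFormalAffineSpace N S x) :
    IsFormalAffineSpace (N + 1) S.powerSeries
      (Fin.snoc (α := fun _ => S.powerSeries) (fun i => S.powerSeriesC (x i)) S.powerSeriesX) := by
  obtain ⟨ϖ, hϖ⟩ := IsPrincipalIdealRing.principal (maximalIdeal O)
  have hS : (maximalIdeal O).map (algebraMap O S) = Ideal.span {algebraMap O S ϖ} := by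
    rw [hϖ, Ideal.submodule_span_eq, Ideal.map_span, Set.image_singleton]
  have hS' : (maximalIdeal O).map (algebraMap O S.powerSeries) =
      (Ideal.span {C (algebraMap O S ϖ)} : Ideal (S : Type u)⟦X⟧) := by
    rw [hϖ, Ideal.submodule_span_eq, Ideal.map_span, Set.image_singleton]
    exact congrArg (fun z => Ideal.span {z}) (S.powerSeriesC.commutes ϖ).symm
  have hle : (maximalIdeal O).map (algebraMap O S) ≤ maximalIdeal S :=
    Ideal.map_le_iff_le_comap.2 fun o ho => S.algebraMap_mem ho
  have hprime := h.isPrime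
  have hdim := h.dim
  rw [hS] at hle hprime hdim
  have hnt : Nontrivial (S ⧸ Ideal.span {algebraMap O S ϖ}) :=
    Ideal.Quotient.nontrivial_iff.2 hprime.ne_top
  have : IsLocalRing (S ⧸ Ideal.span {algebraMap O S ϖ}) :=
    IsLocalRing.of_surjective' (Ideal.Quotient.mk _) Ideal.Quotient.mk_surjective
  let e := quotientSpanPowerSeriesEquiv (algebraMap O S ϖ)
  exact
  { mem := fun i => by
      induction i using Fin.lastCases with
      | last => rw [Fin.snoc_last]; exact S.powerSeriesX_mem
      | cast i => rw [Fin.snoc_castSucc]; exact S.map_mem S.powerSeries _ (h.mem i)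
    exists_algHom := fun T a ha => by
      obtain ⟨φ, hφ⟩ := h.exists_algHom T (fun i => a i.castSucc) (fun i => ha _)
      obtain ⟨f, hf1, hf2⟩ := S.exists_powerSeries_algHom T φ (ha (Fin.last N))
      refine ⟨f, fun i => ?_⟩
      induction i using Fin.lastCases with
      | last => rw [Fin.snoc_last, hf2]
      | cast i =>
        rw [Fin.snoc_castSucc, ← hφ, ← hf1]
        rfl
    algHom_ext := fun T f g hfg => by
      refine S.powerSeries_algHom_ext T (h.algHom_ext T _ _ fun i => ?_) ?_
      · have := hfg i.castSucc
        rw [Fin.snoc_castSucc] at this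
        exact this
      · have := hfg (Fin.last N)
        rw [Fin.snoc_last] at this
        exact this
    smooth := isAdicallyFormallySmooth_powerSeries S h.smooth
    isPrime := by
      rw [hS']
      exact (Ideal.Quotient.isDomain_iff_prime (R := (S : Type u)⟦X⟧) _).1
        (e.toMulEquiv.isDomain _)
    dim := by
      rw [hS']
      refine (ringKrullDim_eq_of_ringEquiv e).trans ?_
      rw [ringKrullDim_powerSeries_eq, hdim]
      push_cast
      rfl }

variable (O) in
theorem exists_isFormalAffineSpace [IsPrincipalIdealRing O] [IsAdicComplete (maximalIdeal O) O]
    (N : ℕ) : ∃ (S : CompleteLocalAlg O) (x : Fin N → S), IsFormalAffineSpace N S x := by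
  induction N with
  | zero => exact ⟨_, _, isFormalAffineSpace_self⟩
  | succ N ih =>
    obtain ⟨S, x, h⟩ := ih
    exact ⟨_, _, h.powerSeries⟩

/-- A homomorphism into a formal affine space is surjective if it separates the points of the
formal affine space. -/
theorem CompleteLocalAlg.surjective_of_separates (U S : CompleteLocalAlg O) (f : U →ₐ[O] S)
    (h : ∀ (Q : CompleteLocalAlg O) (g₁ g₂ : S →ₐ[O] Q), g₁.comp f = g₂.comp f → g₁ = g₂) :
    Function.Surjective f := by
  have hle : (maximalIdeal U).map (f : U →+* S) ≤ maximalIdeal S := by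
    refine Ideal.map_le_iff_le_comap.2 fun x hx => ?_
    exact U.map_mem S f hx
  have hO : ∀ o ∈ maximalIdeal O, algebraMap O (S.quot _ hle) o = 0 := by
    intro o ho
    rw [← (S.quotMk _ hle).commutes, S.quotMk_eq_zero_iff, ← f.commutes]
    exact Ideal.mem_map_of_mem (f : U →+* S) (U.algebraMap_mem ho)
  -- On the quotient of `S` by the ideal generated by the maximal ideal of `U`, the projection is
  -- compared with the map that factors through the residue field. They agree after composition with
  -- `f`, hence are equal by separation; so the maximal ideal of `U` generates that of `S`.
  let g₀ : ResidueField O →ₐ[O] S.quot _ hle :=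
    Ideal.Quotient.liftₐ (maximalIdeal O) (Algebra.ofId O (S.quot _ hle)) hO
  have hcomp : (S.quotMk _ hle).comp f = (g₀.comp S.red).comp f := by
    ext x
    obtain ⟨o, ho⟩ := U.exists_sub_mem x
    have h1 : S.quotMk _ hle (f (x - algebraMap O U o)) = 0 := by
      rw [S.quotMk_eq_zero_iff]
      exact Ideal.mem_map_of_mem (f : U →+* S) ho
    have h2 : g₀ (S.red (f (x - algebraMap O U o))) = 0 := by
      have h3 : S.red (f (x - algebraMap O U o)) = 0 := by
        refine S.residue_bijective.1 ?_
        rw [map_zero]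
        exact (S.algHom_residueField_unique S.red _).trans
          ((residue_eq_zero_iff _).2 (U.map_mem S f ho))
      rw [h3, map_zero]
    rw [map_sub, map_sub, sub_eq_zero] at h1
    rw [map_sub, map_sub, map_sub, sub_eq_zero] at h2
    refine h1.trans (Eq.trans ?_ h2.symm)
    simp only [AlgHom.commutes]
  have hge : maximalIdeal S ≤ (maximalIdeal U).map (f : U →+* S) := by
    intro s hs
    rw [← S.quotMk_eq_zero_iff _ hle, h _ _ _ hcomp]
    have h3 : S.red s = 0 := by
      refine S.residue_bijective.1 ?_
      rw [map_zero]
      exact (S.algHom_residueField_unique S.red _).trans ((residue_eq_zero_iff _).2 hs)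
    change g₀ (S.red s) = 0
    rw [h3, map_zero]
  have heq := le_antisymm hle hge
  have : IsHausdorff ((maximalIdeal U).map (f : U →+* S)) S := by rw [heq]; infer_instance
  -- By completeness it suffices to be surjective modulo the maximal ideal, where the constants from
  -- `O` are enough.
  refine surjective_of_mk_map_comp_surjective (I := maximalIdeal U) (f : U →+* S) ?_
  intro y
  obtain ⟨s, rfl⟩ := Ideal.Quotient.mk_surjective y
  obtain ⟨o, ho⟩ := S.exists_sub_mem s
  refine ⟨algebraMap O U o, ?_⟩
  rw [RingHom.comp_apply, eq_comm, ← sub_eq_zero, ← map_sub, Ideal.Quotient.eq_zero_iff_mem]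
  change s - f (algebraMap O U o) ∈ _
  rw [f.commutes]
  exact hge ho

/-- Formal smoothness is invariant under isomorphisms. -/
theorem IsAdicallyFormallySmooth.of_algEquiv {O R S : Type u} [CommRing O] [CommRing R] [Algebra O R] [CommRing S]
    [Algebra O S] {𝔞 : Ideal R} {𝔟 : Ideal S} (e : R ≃ₐ[O] S)
    (he : 𝔟 = 𝔞.map (e : R →+* S)) (h : IsAdicallyFormallySmooth O R 𝔞) :
    IsAdicallyFormallySmooth O S 𝔟 := by
  have key : ∀ {B : Type u} [CommRing B] [Algebra O B] (f : S →ₐ[O] B),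
      (∃ m : ℕ, 𝔟 ^ m ≤ RingHom.ker f) ↔ ∃ m : ℕ, 𝔞 ^ m ≤ RingHom.ker (f.comp e.toAlgHom) := by
    intro B _ _ f
    refine exists_congr fun m => ?_
    rw [he, ← Ideal.map_pow, Ideal.map_le_iff_le_comap]
    rfl
  intro A _ _ J hJ f hf
  obtain ⟨g, hg1, hg2⟩ := h A J hJ (f.comp e.toAlgHom) ((key f).1 hf)
  refine ⟨g.comp e.symm.toAlgHom, (key _).2 ?_, ?_⟩
  · have : (g.comp e.symm.toAlgHom).comp e.toAlgHom = g := by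
      ext x
      simp
    rwa [this]
  · ext x
    have := DFunLike.congr_fun hg2 (e.symm x)
    simpa using this

end FormalAffineSpace

/-! ### The ring of integers of a finite extension of `ℚ_ℓ` -/

section PadicIntegers

open IsLocalRing

theorem IsPrecomplete.pi {R M ι : Type*} [CommRing R] [Finite ι] (I : Ideal R) [AddCommGroup M]
    [Module R M] [IsPrecomplete I M] : IsPrecomplete I (ι → M) := by
  have := Fintype.ofFinite ι
  classical
  constructor
  intro f hf
  have h : ∀ i, ∃ L : M, ∀ n, f n i ≡ L [SMOD (I ^ n • ⊤ : Submodule R M)] := fun i =>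
    IsPrecomplete.prec (I := I) (M := M) inferInstance fun {m n} hmn => by
      have h1 := hf hmn
      rw [SModEq.sub_mem] at h1 ⊢
      have h2 := Submodule.mem_map_of_mem (f := LinearMap.proj (φ := fun _ : ι => M) i) h1
      rw [Submodule.map_smul''] at h2
      exact Submodule.smul_mono le_rfl le_top h2
  choose L hL using h
  refine ⟨L, fun n => ?_⟩
  rw [SModEq.sub_mem, ← Finset.univ_sum_single (f n - L)]
  refine Submodule.sum_mem _ fun i _ => ?_
  have h1 := hL i n
  rw [SModEq.sub_mem] at h1
  have h2 := Submodule.mem_map_of_mem (f := LinearMap.single R (fun _ : ι => M) i) h1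
  rw [Submodule.map_smul''] at h2
  exact Submodule.smul_mono le_rfl le_top h2

variable (ℓ : ℕ) [Fact ℓ.Prime] (E : Type u) [Field E] [Algebra ℚ_[ℓ] E]

/-- The structure of a `ℤ_ℓ`-algebra on an extension of `ℚ_ℓ`. -/
@[reducible]
noncomputable def padicIntAlgebra : Algebra ℤ_[ℓ] E := Algebra.compHom E (algebraMap ℤ_[ℓ] ℚ_[ℓ])

attribute [local instance] padicIntAlgebra

instance : IsScalarTower ℤ_[ℓ] ℚ_[ℓ] E := IsScalarTower.of_algebraMap_eq fun _ => rfl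

namespace padicIntegers

/-- The structure of a `ℤ_ℓ`-algebra on the ring of integers of an extension of `ℚ_ℓ`. -/
noncomputable instance : Algebra ℤ_[ℓ] (padicIntegers ℓ E) :=
  ((algebraMap ℤ_[ℓ] E).codRestrict (padicIntegers ℓ E) fun _ =>
    isIntegral_algebraMap).toAlgebra

instance : IsScalarTower ℤ_[ℓ] (padicIntegers ℓ E) E := IsScalarTower.of_algebraMap_eq fun _ => rfl

instance : IsIntegralClosure (padicIntegers ℓ E) ℤ_[ℓ] E where
  algebraMap_injective := Subtype.val_injective
  isIntegral_iff := fun {x} => ⟨fun h => ⟨⟨x, h⟩, rfl⟩, fun ⟨y, hy⟩ => hy ▸ y.2⟩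

instance : FaithfulSMul ℤ_[ℓ] (padicIntegers ℓ E) := by
  rw [faithfulSMul_iff_algebraMap_injective]
  intro x y hxy
  exact Subtype.ext ((algebraMap ℚ_[ℓ] E).injective (congrArg Subtype.val hxy))

variable [FiniteDimensional ℚ_[ℓ] E]

instance : IsFractionRing (padicIntegers ℓ E) E :=
  IsIntegralClosure.isFractionRing_of_finite_extension ℤ_[ℓ] ℚ_[ℓ] E _

instance : Module.Finite ℤ_[ℓ] (padicIntegers ℓ E) :=
  IsIntegralClosure.finite ℤ_[ℓ] ℚ_[ℓ] E _

instance : IsDedekindDomain (padicIntegers ℓ E) :=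
  IsIntegralClosure.isDedekindDomain ℤ_[ℓ] ℚ_[ℓ] E _

instance : IsPrincipalIdealRing (padicIntegers ℓ E) := inferInstance

instance : Finite (ResidueField (padicIntegers ℓ E)) :=
  ResidueField.finite_of_finite (R := ℤ_[ℓ]) inferInstance

theorem natCast_mem_maximalIdeal : (ℓ : padicIntegers ℓ E) ∈ maximalIdeal (padicIntegers ℓ E) := by
  have h : (ℓ : ℤ_[ℓ]) ∈ maximalIdeal ℤ_[ℓ] := by
    rw [PadicInt.maximalIdeal_eq_span_p]
    exact Ideal.mem_span_singleton_self _
  rw [← map_natCast (algebraMap ℤ_[ℓ] (padicIntegers ℓ E))]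
  rw [mem_maximalIdeal, mem_nonunits_iff] at h ⊢
  exact fun hu => h (isUnit_of_map_unit _ _ hu)

theorem map_maximalIdeal_le : (maximalIdeal ℤ_[ℓ]).map (algebraMap ℤ_[ℓ] (padicIntegers ℓ E)) ≤
    maximalIdeal (padicIntegers ℓ E) :=
  Ideal.map_le_iff_le_comap.2 fun _ hx hu => hx (isUnit_of_map_unit _ _ hu)

/-- The ideal generated by `ℓ` is nonzero in a local Dedekind domain, so the maximal ideal is the
only prime above it and hence its radical. -/
theorem exists_maximalIdeal_pow_le : ∃ e, maximalIdeal (padicIntegers ℓ E) ^ e ≤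
    (maximalIdeal ℤ_[ℓ]).map (algebraMap ℤ_[ℓ] (padicIntegers ℓ E)) := by
  have hℓ : algebraMap ℤ_[ℓ] (padicIntegers ℓ E) ℓ ≠ 0 := by
    rw [Ne, FaithfulSMul.algebraMap_eq_zero_iff]
    exact_mod_cast (Fact.out : ℓ.Prime).ne_zero
  have hr : ((maximalIdeal ℤ_[ℓ]).map (algebraMap ℤ_[ℓ] (padicIntegers ℓ E))).radical =
      maximalIdeal (padicIntegers ℓ E) := by
    rw [Ideal.radical_eq_sInf]
    refine le_antisymm (sInf_le ⟨?_, inferInstance⟩) (le_sInf fun P hP => ?_)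
    · exact map_maximalIdeal_le ℓ E
    · have hne : P ≠ ⊥ := fun h0 => hℓ (Ideal.mem_bot.1 (h0 ▸ hP.1 (Ideal.mem_map_of_mem _ (by
        rw [PadicInt.maximalIdeal_eq_span_p]
        exact Ideal.mem_span_singleton_self _))))
      exact (eq_maximalIdeal (hP.2.isMaximal hne)).ge
  obtain ⟨e, he⟩ := Ideal.exists_radical_pow_le_of_fg
    ((maximalIdeal ℤ_[ℓ]).map (algebraMap ℤ_[ℓ] (padicIntegers ℓ E)))
    (hr ▸ (maximalIdeal (padicIntegers ℓ E)).fg_of_isNoetherianRing)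
  exact ⟨e, hr ▸ he⟩

/-- As a quotient of a finite power of `ℤ_ℓ` the ring is `ℓ`-adically precomplete, and the `ℓ`-adic
topology is that of the maximal ideal. -/
instance : IsAdicComplete (maximalIdeal (padicIntegers ℓ E)) (padicIntegers ℓ E) := by
  obtain ⟨d, f, hf⟩ := Module.Finite.exists_fin' ℤ_[ℓ] (padicIntegers ℓ E)
  have := IsPrecomplete.pi (ι := Fin d) (M := ℤ_[ℓ]) (maximalIdeal ℤ_[ℓ])
  have h1 : IsPrecomplete (maximalIdeal ℤ_[ℓ]) (padicIntegers ℓ E) :=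
    IsPrecomplete.of_surjective _ f hf
  have h2 : IsPrecomplete ((maximalIdeal ℤ_[ℓ]).map (algebraMap ℤ_[ℓ] (padicIntegers ℓ E)))
    (padicIntegers ℓ E) := IsPrecomplete.map_algebraMap_iff.2 h1
  obtain ⟨e, he⟩ := exists_maximalIdeal_pow_le ℓ E
  have h3 : IsPrecomplete (maximalIdeal (padicIntegers ℓ E)) (padicIntegers ℓ E) :=
    IsPrecomplete.of_pow_le (e := e + 1) (Nat.succ_pos _)
      ((Ideal.pow_le_pow_right (Nat.le_succ e)).trans he)
      (map_maximalIdeal_le ℓ E)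
  have : IsHausdorff (maximalIdeal (padicIntegers ℓ E)) (padicIntegers ℓ E) := inferInstance
  exact { }

end padicIntegers

end PadicIntegers

/-! ### Continuous homomorphisms out of the tame group -/

section TopologicalGroups

open Filter Topology

/-- A homomorphism from a dense cyclic subgroup to a compact group extends to the whole group if it
is continuous. -/
theorem exists_continuousMonoidHom_of_dense_zpowers {A P : Type*} [Group A] [TopologicalSpace A]
    [IsTopologicalGroup A] [CompactSpace A] [T2Space A] [Group P] [TopologicalSpace P]
    [IsTopologicalGroup P] [CompactSpace P] [T2Space P] {a : A}
    (ha : Dense (Subgroup.zpowers a : Set A)) {g : P}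
    (h : ∀ U ∈ 𝓝 (1 : P), ∃ V ∈ 𝓝 (1 : A), ∀ m : ℤ, a ^ m ∈ V → g ^ m ∈ U) :
    ∃ f : A →* P, Continuous f ∧ f a = g := by
  -- The extension is found through its graph: `H` is the closure of the powers of `(a, g)`. The
  -- hypothesis makes the projection to `A` injective, density and compactness make it surjective,
  -- and a continuous bijection from a compact to a Hausdorff space is a homeomorphism.
  set H : Subgroup (A × P) := (Subgroup.zpowers (a, g)).topologicalClosure with hH
  have hHc : IsClosed (H : Set (A × P)) := Subgroup.isClosed_topologicalClosure _
  have : CompactSpace H := isCompact_iff_compactSpace.1 hHc.isCompact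
  let φ : H →* A := (MonoidHom.fst A P).comp H.subtype
  have hφc : Continuous φ := continuous_fst.comp continuous_subtype_val
  have hmem : ((a, g) : A × P) ∈ H := Subgroup.le_topologicalClosure _ (Subgroup.mem_zpowers _)
  have hinj : Function.Injective φ := by
    rw [injective_iff_map_eq_one]
    rintro ⟨⟨x, p⟩, hx⟩ (rfl : x = 1)
    by_contra hne
    have hp : p ≠ 1 := fun hp => hne (by subst hp; rfl)
    obtain ⟨W, U, hW, hU, hpW, hU1, hWU⟩ := t2_separation hp
    obtain ⟨V, hV, hVU⟩ := h U (hU.mem_nhds hU1)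
    have hn : V ×ˢ W ∈ 𝓝 ((1, p) : A × P) := prod_mem_nhds hV (hW.mem_nhds hpW)
    obtain ⟨_, ⟨h1, h2⟩, m, rfl⟩ := mem_closure_iff_nhds.1 hx _ hn
    exact Set.disjoint_left.1 hWU h2 (hVU m h1)
  have hsurj : Function.Surjective φ := by
    have h1 : IsClosed (Set.range φ) := (isCompact_range hφc).isClosed
    have h2 : (Subgroup.zpowers a : Set A) ⊆ Set.range φ := by
      rintro _ ⟨m, rfl⟩
      exact ⟨⟨(a, g), hmem⟩ ^ m, by rw [map_zpow]; rfl⟩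
    exact Set.range_eq_univ.1 (Set.eq_univ_of_univ_subset
      (ha.closure_eq ▸ closure_minimal h2 h1))
  let e : H ≃* A := MulEquiv.ofBijective φ ⟨hinj, hsurj⟩
  have hec : Continuous e.symm :=
    (hφc.homeoOfEquivCompactToT2 (f := e.toEquiv)).symm.continuous
  refine ⟨((MonoidHom.snd A P).comp H.subtype).comp e.symm.toMonoidHom,
    continuous_snd.comp (continuous_subtype_val.comp hec), ?_⟩
  have : e.symm a = ⟨(a, g), hmem⟩ := (MulEquiv.symm_apply_eq e).2 rfl
  change (e.symm a).1.2 = g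
  rw [this]

instance : T2Space ZHat := inferInstanceAs (T2Space ZHatGrp)

theorem ZHat.etaFn_ofAdd (m : ℤ) : ProfiniteGrp.ProfiniteCompletion.etaFn
    (GrpCat.of (Multiplicative ℤ)) (Multiplicative.ofAdd m) = (ZHat.gen ^ m : ZHat) := by
  let η : Multiplicative ℤ →* ZHat :=
    (ProfiniteGrp.ProfiniteCompletion.eta (GrpCat.of (Multiplicative ℤ))).hom
  change η (Multiplicative.ofAdd m) = (η (Multiplicative.ofAdd 1)) ^ m
  rw [← map_zpow, ← ofAdd_zsmul, smul_eq_mul, mul_one]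

theorem ZHat.dense_zpowers : Dense (Subgroup.zpowers ZHat.gen : Set ZHat) := by
  have h : DenseRange (fun x : Multiplicative ℤ => (ProfiniteGrp.ProfiniteCompletion.etaFn
    (GrpCat.of (Multiplicative ℤ)) x : ZHat)) :=
    ProfiniteGrp.ProfiniteCompletion.denseRange (GrpCat.of (Multiplicative ℤ))
  refine Dense.mono ?_ h
  rintro _ ⟨x, rfl⟩
  exact ⟨Multiplicative.toAdd x, (ZHat.etaFn_ofAdd _).symm⟩

/-- A finite cyclic group is a quotient of `Ẑ`. -/
theorem ZHat.exists_hom_finite {G : Type} [Group G] [Finite G] [TopologicalSpace G]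
    [DiscreteTopology G] (g : G) : ∃ f : ZHat →* G, Continuous f ∧ f ZHat.gen = g := by
  have : IsTopologicalGroup G := { }
  let F := (ProfiniteGrp.ProfiniteCompletion.lift (G := GrpCat.of (Multiplicative ℤ))
    (P := ProfiniteGrp.of G) (GrpCat.ofHom (zpowersHom G g))).hom
  refine ⟨F.toMonoidHom, F.continuous_toFun, ?_⟩
  have h := ProfiniteGrp.ProfiniteCompletion.lift_eta (G := GrpCat.of (Multiplicative ℤ))
    (P := ProfiniteGrp.of G) (GrpCat.ofHom (zpowersHom G g))
  have h2 := CategoryTheory.ConcreteCategory.congr_hom h (Multiplicative.ofAdd (1 : ℤ))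
  rw [CategoryTheory.ConcreteCategory.comp_apply] at h2
  have h3 : F ZHat.gen = zpowersHom G g (Multiplicative.ofAdd (1 : ℤ)) := h2
  change F ZHat.gen = g
  rw [h3]
  simp

theorem ZHat.exists_nhds_dvd (k : ℕ) [NeZero k] :
    ∃ V ∈ 𝓝 (1 : ZHat), ∀ m : ℤ, ZHat.gen ^ m ∈ V → (k : ℤ) ∣ m := by
  let : TopologicalSpace (Multiplicative (ZMod k)) := ⊥
  have : DiscreteTopology (Multiplicative (ZMod k)) := ⟨rfl⟩
  obtain ⟨f, hf, hf1⟩ := ZHat.exists_hom_finite (Multiplicative.ofAdd (1 : ZMod k))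
  refine ⟨f ⁻¹' {1}, ((isOpen_discrete _).preimage hf).mem_nhds (map_one f), fun m hm => ?_⟩
  have h1 : f (ZHat.gen ^ m) = 1 := hm
  rw [map_zpow, hf1, ← ofAdd_zsmul, ofAdd_eq_one, zsmul_one] at h1
  exact (ZMod.intCast_zmod_eq_zero_iff_dvd m k).1 h1

/-- For an open normal subgroup `N` of `P`, the power `g ^ m` lies in `N` once the finite index of
`N` divides `m`, and such divisibility defines a neighbourhood of `1` in `Ẑ`. The target may lie in
any universe. -/
theorem ZHat.exists_hom {P : Type*} [Group P] [TopologicalSpace P]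
    [IsTopologicalGroup P] [CompactSpace P] [TotallyDisconnectedSpace P] [T2Space P] (g : P) :
    ∃ f : ZHat →* P, Continuous f ∧ f ZHat.gen = g := by
  refine exists_continuousMonoidHom_of_dense_zpowers ZHat.dense_zpowers fun U hU => ?_
  obtain ⟨N, hN⟩ := ProfiniteGrp.exist_openNormalSubgroup_sub_open_nhds_of_one
    (isOpen_interior (s := U)) (mem_interior_iff_mem_nhds.2 hU)
  have hfin : Finite (P ⧸ N.toSubgroup) :=
    Subgroup.quotient_finite_of_isOpen N.toSubgroup N.isOpen'
  have : NeZero (Nat.card (P ⧸ N.toSubgroup)) := ⟨Nat.card_pos.ne'⟩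
  obtain ⟨V, hV, hVd⟩ := ZHat.exists_nhds_dvd (Nat.card (P ⧸ N.toSubgroup))
  refine ⟨V, hV, fun m hm => interior_subset (hN ?_)⟩
  obtain ⟨c, rfl⟩ := hVd m hm
  change g ^ _ ∈ N.toSubgroup
  rw [← QuotientGroup.eq_one_iff, QuotientGroup.mk_zpow, zpow_mul, zpow_natCast, pow_card_eq_one',
    one_zpow]

variable {ℓ : ℕ} [Fact ℓ.Prime]

theorem PadicInt.dense_zpowers :
    Dense (Subgroup.zpowers (Multiplicative.ofAdd (1 : ℤ_[ℓ])) : Set (Multiplicative ℤ_[ℓ])) := by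
  have h : DenseRange (fun m : ℤ => (m : ℤ_[ℓ])) := PadicInt.denseRange_intCast
  refine Dense.mono (s₁ := Set.range fun m : ℤ => Multiplicative.ofAdd (m : ℤ_[ℓ])) ?_ h
  rintro _ ⟨m, rfl⟩
  exact ⟨m, by simp [← ofAdd_zsmul]⟩

/-- For an open normal subgroup `N` some `g ^ ℓ ^ M` lies in `N`, so `g ^ m` does as soon as `m` is
`ℓ`-adically close to `0`. -/
theorem PadicInt.exists_hom {P : Type*} [Group P] [TopologicalSpace P]
    [IsTopologicalGroup P] [CompactSpace P] [TotallyDisconnectedSpace P] [T2Space P] (g : P)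
    (hg : Tendsto (fun N : ℕ => g ^ ℓ ^ N) atTop (𝓝 1)) :
    ∃ f : Multiplicative ℤ_[ℓ] →* P, Continuous f ∧ f (Multiplicative.ofAdd 1) = g := by
  refine exists_continuousMonoidHom_of_dense_zpowers PadicInt.dense_zpowers fun U hU => ?_
  obtain ⟨N, hN⟩ := ProfiniteGrp.exist_openNormalSubgroup_sub_open_nhds_of_one
    (isOpen_interior (s := U)) (mem_interior_iff_mem_nhds.2 hU)
  obtain ⟨M, hM⟩ := (hg.eventually (N.isOpen'.mem_nhds (one_mem N.toSubgroup))).exists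
  refine ⟨Multiplicative.toAdd ⁻¹' {x | ‖x‖ < (ℓ : ℝ) ^ (-(M : ℤ) + 1)}, ?_, fun m hm =>
    interior_subset (hN ?_)⟩
  · refine continuous_toAdd.continuousAt.preimage_mem_nhds ?_
    refine (isOpen_lt continuous_norm continuous_const).mem_nhds ?_
    have : (0 : ℝ) < ℓ := by exact_mod_cast (Fact.out : ℓ.Prime).pos
    change ‖(0 : ℤ_[ℓ])‖ < _
    rw [norm_zero]
    positivity
  · have h1 : ((ℓ ^ M : ℕ) : ℤ) ∣ m := by
      have h2 : ‖Multiplicative.toAdd (Multiplicative.ofAdd (1 : ℤ_[ℓ]) ^ m)‖ <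
        (ℓ : ℝ) ^ (-(M : ℤ) + 1) := hm
      rw [toAdd_zpow, toAdd_ofAdd, zsmul_one, ← PadicInt.norm_le_pow_iff_norm_lt_pow_add_one,
        PadicInt.norm_int_le_pow_iff_dvd] at h2
      exact_mod_cast h2
    obtain ⟨c, rfl⟩ := h1
    rw [zpow_mul, zpow_natCast]
    exact zpow_mem (K := N.toSubgroup) hM c

namespace TameGroup

variable {q : ℕ} (hq : q.Coprime ℓ)

theorem dense_closure : Dense (Subgroup.closure {t hq, phi hq} : Set (TameGroup hq)) := by
  set H := (Subgroup.closure {t hq, phi hq}).topologicalClosure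
  have hHc : IsClosed (H : Set (TameGroup hq)) := Subgroup.isClosed_topologicalClosure _
  have ht : t hq ∈ H := Subgroup.le_topologicalClosure _ (Subgroup.subset_closure (by simp))
  have hp : phi hq ∈ H := Subgroup.le_topologicalClosure _ (Subgroup.subset_closure (by simp))
  have hl : ∀ x, (SemidirectProduct.inl x : TameGroup hq) ∈ H := by
    intro x
    have hc : Continuous (SemidirectProduct.inl : Multiplicative ℤ_[ℓ] →* TameGroup hq) :=
      continuous_induced_rng.2 (continuous_id.prodMk continuous_const)
    have h1 : (Subgroup.zpowers (Multiplicative.ofAdd (1 : ℤ_[ℓ])) : Set _) ⊆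
        SemidirectProduct.inl ⁻¹' (H : Set (TameGroup hq)) := by
      rintro _ ⟨m, rfl⟩
      change SemidirectProduct.inl (_ ^ m) ∈ H
      rw [map_zpow]
      exact zpow_mem ht m
    exact closure_minimal h1 (hHc.preimage hc) (PadicInt.dense_zpowers x)
  have hr : ∀ x, (SemidirectProduct.inr x : TameGroup hq) ∈ H := by
    intro x
    have hc : Continuous (SemidirectProduct.inr : ZHat →* TameGroup hq) :=
      continuous_induced_rng.2 (continuous_const.prodMk continuous_id)
    have h1 : (Subgroup.zpowers ZHat.gen : Set ZHat) ⊆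
        SemidirectProduct.inr ⁻¹' (H : Set (TameGroup hq)) := by
      rintro _ ⟨m, rfl⟩
      change SemidirectProduct.inr (_ ^ m) ∈ H
      rw [map_zpow]
      exact zpow_mem hp m
    exact closure_minimal h1 (hHc.preimage hc) (ZHat.dense_zpowers x)
  intro x
  rw [← SemidirectProduct.inl_left_mul_inr_right x]
  exact mul_mem (hl _) (hr _)

/-- Continuous homomorphisms from the tame group are determined by the images of `t` and `φ`. -/
theorem hom_ext {P : Type*} [Group P] [TopologicalSpace P] [T2Space P] {f g : TameGroup hq →* P}
    (hf : Continuous f) (hg : Continuous g) (h1 : f (t hq) = g (t hq))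
    (h2 : f (phi hq) = g (phi hq)) : f = g := by
  have h : Set.EqOn f g (Subgroup.closure {t hq, phi hq}) :=
    MonoidHom.eqOn_closure (by rintro x (rfl | rfl) <;> assumption)
  exact DFunLike.coe_injective (Continuous.ext_on (dense_closure hq) hf hg h)

theorem tendsto_t_pow : Tendsto (fun N : ℕ => t hq ^ ℓ ^ N) atTop (𝓝 1) := by
  have hc : Continuous (SemidirectProduct.inl : Multiplicative ℤ_[ℓ] →* TameGroup hq) :=
    continuous_induced_rng.2 (continuous_id.prodMk continuous_const)
  have h1 : Tendsto (fun N : ℕ => (ℓ : ℤ_[ℓ]) ^ N) atTop (𝓝 0) := by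
    rw [tendsto_pow_atTop_nhds_zero_iff_norm_lt_one]
    rw [PadicInt.norm_p]
    exact inv_lt_one_of_one_lt₀ (by exact_mod_cast (Fact.out : ℓ.Prime).one_lt)
  have h2 := (hc.comp continuous_ofAdd).continuousAt.tendsto.comp h1
  refine (h2.congr fun N => ?_).trans_eq (by simp)
  change SemidirectProduct.inl (Multiplicative.ofAdd ((ℓ : ℤ_[ℓ]) ^ N)) = t hq ^ ℓ ^ N
  rw [t, ← map_pow, ← ofAdd_nsmul]
  simp

/-- A continuous homomorphism from the tame group to a profinite group is given by a pair of
elements subject to the relation between `t` and `φ`. -/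
theorem exists_hom {P : Type*} [Group P] [TopologicalSpace P] [IsTopologicalGroup P]
    [CompactSpace P] [TotallyDisconnectedSpace P] [T2Space P] (a b : P)
    (ha : Tendsto (fun N : ℕ => a ^ ℓ ^ N) atTop (𝓝 1)) (hab : b * a * b⁻¹ = a ^ q) :
    ∃ f : TameGroup hq →* P, Continuous f ∧ f (t hq) = a ∧ f (phi hq) = b := by
  obtain ⟨f₁, hf₁, rfl⟩ := PadicInt.exists_hom a ha
  obtain ⟨f₂, hf₂, rfl⟩ := ZHat.exists_hom b
  have hact : ∀ z y, f₁ (tameAction hq z y) = f₂ z * f₁ y * (f₂ z)⁻¹ := by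
    -- The elements of `Ẑ` for which the two actions correspond form a closed subgroup. It contains
    -- the generator by the relation between `a` and `b`, which is first extended from `t` to its
    -- closed span.
    let K : Subgroup ZHat :=
      { carrier := {z | ∀ y, f₁ (tameAction hq z y) = f₂ z * f₁ y * (f₂ z)⁻¹}
        one_mem' := fun y => by simp
        mul_mem' := fun {z w} hz hw y => by
          rw [map_mul, MulAut.mul_apply, hz, hw, map_mul]
          group
        inv_mem' := fun {z} hz y => by
          have h := hz (tameAction hq z⁻¹ y)
          rw [← MulAut.mul_apply, ← map_mul, mul_inv_cancel, map_one, MulAut.one_apply] at h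
          rw [h, map_inv f₂]
          simp only [mul_assoc, inv_inv, inv_mul_cancel, inv_mul_cancel_left, mul_one] }
    have hKc : IsClosed (K : Set ZHat) := by
      change IsClosed {z | ∀ y, f₁ (tameAction hq z y) = f₂ z * f₁ y * (f₂ z)⁻¹}
      simp only [Set.ofPred_forall]
      refine isClosed_iInter fun y => isClosed_eq
        (hf₁.comp (continuous_act hq continuous_id continuous_const)) ?_
      exact (hf₂.mul continuous_const).mul hf₂.inv
    have hgen : ZHat.gen ∈ K := by
      intro y
      have h1 : Continuous fun y => f₁ (tameAction hq ZHat.gen y) :=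
        hf₁.comp (continuous_act hq continuous_const continuous_id)
      have h2 : Continuous fun y => f₂ ZHat.gen * f₁ y * (f₂ ZHat.gen)⁻¹ :=
        (continuous_const.mul hf₁).mul continuous_const
      refine congrFun (Continuous.ext_on (PadicInt.dense_zpowers (ℓ := ℓ)) h1 h2 ?_) y
      rintro _ ⟨m, rfl⟩
      have h3 : tameAction hq ZHat.gen (Multiplicative.ofAdd (1 : ℤ_[ℓ])) =
          Multiplicative.ofAdd (1 : ℤ_[ℓ]) ^ q := by
        have h := phi_mul_t_mul_phi_inv hq
        rw [phi, t, ← map_inv, ← SemidirectProduct.inl_aut, ← map_pow] at h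
        exact SemidirectProduct.inl_injective h
      simp only [map_zpow, h3, map_pow, ← hab, conj_zpow]
    intro z
    exact closure_minimal (s := (Subgroup.zpowers ZHat.gen : Set ZHat)) (t := K)
      (Subgroup.zpowers_le.2 hgen) hKc (ZHat.dense_zpowers z)
  refine ⟨SemidirectProduct.lift f₁ f₂ fun z => MonoidHom.ext fun y => ?_, ?_, ?_, ?_⟩
  · simpa using hact z y
  · exact (hf₁.comp (continuous_left hq)).mul (hf₂.comp (continuous_right hq))
  · simp [t]
  · simp [phi]

end TameGroup

end TopologicalGroups

/-! ### The topological group `𝒢_n(R)` -/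

section GroupTopology

open Filter Topology Matrix

namespace GG

variable {n : ℕ} {R S : Type*} [CommRing R] [TopologicalSpace R] [CommRing S] [TopologicalSpace S]

theorem continuous_left : Continuous fun x : GG n R => x.left :=
  continuous_fst.comp (continuous_induced_dom (f := SemidirectProduct.equivProd))

theorem continuous_right : Continuous fun x : GG n R => x.right :=
  continuous_snd.comp (continuous_induced_dom (f := SemidirectProduct.equivProd))

theorem continuous_mk {X : Type*} [TopologicalSpace X] {f : X → GG n R}
    (hl : Continuous fun x => (f x).left) (hr : Continuous fun x => (f x).right) :
    Continuous f :=
  continuous_induced_rng.2 (hl.prodMk hr)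

theorem isEmbedding_equivProd :
    IsEmbedding (SemidirectProduct.equivProd : GG n R ≃ (GL (Fin n) R × Rˣ) × ℤˣ) :=
  ⟨⟨rfl⟩, Equiv.injective _⟩

theorem isHomeomorph_equivProd :
    IsHomeomorph (SemidirectProduct.equivProd : GG n R ≃ (GL (Fin n) R × Rˣ) × ℤˣ) :=
  isHomeomorph_iff_isEmbedding_surjective.2 ⟨isEmbedding_equivProd, Equiv.surjective _⟩

theorem continuous_glContra : Continuous (glContra n R) := by
  refine Units.continuous_iff.2 ⟨?_, ?_⟩
  · exact Units.continuous_coe_inv.matrix_transpose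
  · exact Units.continuous_val.matrix_transpose

theorem continuous_ofGL : Continuous (ofGL : GL (Fin n) R →* GG n R) :=
  continuous_mk (continuous_id.prodMk continuous_const) continuous_const

theorem continuous_map (f : R →+* S) (hf : Continuous f) :
    Continuous (map f : GG n R →* GG n S) := by
  refine continuous_mk (Continuous.prodMk ?_ ?_) continuous_right
  · refine (Continuous.units_map (f.mapMatrix : Matrix (Fin n) (Fin n) R →+* _).toMonoidHom ?_).comp
      (continuous_fst.comp continuous_left)
    exact continuous_id.matrix_map hf
  · exact (Continuous.units_map f.toMonoidHom hf).comp (continuous_snd.comp continuous_left)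

variable [IsTopologicalRing R]

theorem continuous_conjDual : Continuous (conjDual n R) := by
  have h : Continuous (glScalar n R) := by
    refine Continuous.units_map _ ?_
    exact (continuous_pi fun _ => continuous_id).matrix_diagonal
  exact ((h.comp continuous_snd).mul (continuous_glContra.comp continuous_fst)).prodMk
    continuous_snd

theorem continuous_conjDualAction {X : Type*} [TopologicalSpace X] {s : X → ℤˣ}
    {f : X → GL (Fin n) R × Rˣ} (hs : Continuous s) (hf : Continuous f) :
    Continuous fun x => conjDualAction n R (s x) (f x) := by
  have h : Continuous fun p : ℤˣ × (GL (Fin n) R × Rˣ) => conjDualAction n R p.1 p.2 := by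
    refine continuous_prod_of_discrete_left.2 fun s => ?_
    rcases Int.units_eq_one_or s with rfl | rfl
    · exact continuous_id.congr fun x => by simp
    · exact continuous_conjDual
  exact h.comp (hs.prodMk hf)

instance : IsTopologicalGroup (GG n R) where
  continuous_mul := by
    have hl1 := continuous_left.comp (continuous_fst (X := GG n R) (Y := GG n R))
    have hl2 := continuous_left.comp (continuous_snd (X := GG n R) (Y := GG n R))
    have hr1 := continuous_right.comp (continuous_fst (X := GG n R) (Y := GG n R))
    have hr2 := continuous_right.comp (continuous_snd (X := GG n R) (Y := GG n R))
    exact continuous_mk (hl1.mul (continuous_conjDualAction hr1 hl2)) (hr1.mul hr2)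
  continuous_inv :=
    continuous_mk (continuous_conjDualAction continuous_right.inv continuous_left.inv)
      continuous_right.inv

theorem continuous_nu : Continuous (nu : GG n R →* Rˣ) :=
  (continuous_snd.comp continuous_left).mul ((Continuous.comp
    (continuous_of_discreteTopology (f := Units.map (Int.castRingHom R).toMonoidHom))
    continuous_right))

omit [IsTopologicalRing R] in
theorem t2Space [T2Space R] : T2Space (GG n R) := isEmbedding_equivProd.t2Space

theorem compactSpace_matrix {R : Type*} [TopologicalSpace R] [CompactSpace R] :
    CompactSpace (Matrix (Fin n) (Fin n) R) :=
  inferInstanceAs (CompactSpace (Fin n → Fin n → R))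

theorem compactSpace [T2Space R] [CompactSpace R] : CompactSpace (GG n R) := by
  have := compactSpace_matrix (n := n) (R := R)
  exact (isHomeomorph_equivProd (n := n) (R := R)).homeomorph.symm.compactSpace

omit [IsTopologicalRing R] in
theorem totallyDisconnectedSpace [TotallyDisconnectedSpace R] :
    TotallyDisconnectedSpace (GG n R) := by
  have h1 : TotallyDisconnectedSpace (Matrix (Fin n) (Fin n) R) :=
    inferInstanceAs (TotallyDisconnectedSpace (Fin n → Fin n → R))
  have h2 : TotallyDisconnectedSpace (GL (Fin n) R) :=
    ⟨isTotallyDisconnected_of_image Units.continuous_val.continuousOn Units.val_injective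
      (isTotallyDisconnected_of_totallyDisconnectedSpace _)⟩
  have h3 : TotallyDisconnectedSpace Rˣ :=
    ⟨isTotallyDisconnected_of_image Units.continuous_val.continuousOn Units.val_injective
      (isTotallyDisconnected_of_totallyDisconnectedSpace _)⟩
  exact ⟨isTotallyDisconnected_of_image isEmbedding_equivProd.continuous.continuousOn
    (Equiv.injective _) (isTotallyDisconnected_of_totallyDisconnectedSpace _)⟩

end GG

end GroupTopology

/-! ### The adic topology and pro-`ℓ` elements of `GL_n(R)` -/

section AdicTopology

open IsLocalRing Filter Topology Matrix

/-- The adic topology on a local ring. -/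
@[reducible]
def IsLocalRing.adicTopologicalSpace (R : Type*) [CommRing R] [IsLocalRing R] :
    TopologicalSpace R := (maximalIdeal R).adicTopology

attribute [local instance] IsLocalRing.adicTopologicalSpace

variable {R S : Type*} [CommRing R] [IsLocalRing R] [CommRing S] [IsLocalRing S]

namespace IsLocalRing

theorem isAdic_maximalIdeal : IsAdic (maximalIdeal R) := rfl

instance isTopologicalRing_adic : IsTopologicalRing R :=
  (maximalIdeal R).nonarchimedean.toIsTopologicalRing

theorem continuous_of_map_le (f : R →+* S) (hf : ∀ x ∈ maximalIdeal R, f x ∈ maximalIdeal S) :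
    Continuous f := by
  refine continuous_of_continuousAt_zero f ?_
  rw [ContinuousAt, map_zero, (isAdic_maximalIdeal (R := R)).hasBasis_nhds_zero.tendsto_iff
    (isAdic_maximalIdeal (R := S)).hasBasis_nhds_zero]
  refine fun i _ => ⟨i, trivial, fun x hx => ?_⟩
  have h : (maximalIdeal R).map f ≤ maximalIdeal S := Ideal.map_le_iff_le_comap.2 hf
  have h1 := Ideal.mem_map_of_mem f hx
  rw [Ideal.map_pow] at h1
  exact Ideal.pow_right_mono h i h1

theorem t2Space_adic [IsNoetherianRing R] : T2Space R :=
  isAdic_maximalIdeal.isHausdorff_iff.1 inferInstance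

theorem totallyDisconnectedSpace_adic [IsNoetherianRing R] : TotallyDisconnectedSpace R := by
  have := t2Space_adic (R := R)
  have : NonarchimedeanRing R := (maximalIdeal R).nonarchimedean
  infer_instance

/-- A complete ring is compact once it is totally bounded, and the quotients by powers of the
maximal ideal are finite because the residue field is. -/
theorem compactSpace_adic [IsNoetherianRing R] [IsAdicComplete (maximalIdeal R) R]
    [Finite (ResidueField R)] : CompactSpace R := by
  let : UniformSpace R := IsTopologicalAddGroup.rightUniformSpace R
  have : IsUniformAddGroup R := isUniformAddGroup_of_addCommGroup
  have hc : CompleteSpace R :=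
    ((isAdic_maximalIdeal (R := R)).isAdicComplete_iff.1 inferInstance).1
  refine ⟨isCompact_iff_totallyBounded_isComplete.2 ⟨?_, completeSpace_iff_isComplete_univ.1 hc⟩⟩
  rw [totallyBounded_iff_subset_finite_iUnion_nhds_zero]
  intro U hU
  obtain ⟨i, -, hi⟩ := (isAdic_maximalIdeal (R := R)).hasBasis_nhds_zero.mem_iff.1 hU
  have : Finite (R ⧸ maximalIdeal R ^ i) := finite_quotient_iff.2 ⟨i, le_rfl⟩
  obtain ⟨s, hs⟩ := (Ideal.Quotient.mk_surjective (I := maximalIdeal R ^ i)).hasRightInverse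
  refine ⟨Set.range s, Set.finite_range s, fun x _ => ?_⟩
  refine Set.mem_iUnion₂.2 ⟨_, ⟨Ideal.Quotient.mk _ x, rfl⟩, ?_⟩
  refine Set.mem_vadd_set.2 ⟨x - s (Ideal.Quotient.mk _ x), hi ?_, ?_⟩
  · change _ ∈ maximalIdeal R ^ i
    rw [← Ideal.Quotient.eq_zero_iff_mem, map_sub, hs, sub_self]
  · simp

theorem discreteTopology_of_isField {K : Type*} [Field K] : DiscreteTopology K := by
  rw [discreteTopology_iff_isOpen_singleton_zero]
  have h := (isAdic_iff.1 (isAdic_maximalIdeal (R := K))).1 1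
  rw [pow_one, (isField_iff_maximalIdeal_eq (R := K)).1 (Field.toIsField K)] at h
  simpa using h

/-- An element of `GL_n(R)` whose reduction has `ℓ`-power order generates a pro-`ℓ` group. -/
theorem tendsto_pow_GL {n ℓ : ℕ} (hℓ : (ℓ : R) ∈ maximalIdeal R) [IsNoetherianRing R]
    [IsAdicComplete (maximalIdeal R) R] [Finite (ResidueField R)] (A : GL (Fin n) R) {N₀ : ℕ}
    (hA : ((A : Matrix (Fin n) (Fin n) R).map (residue R)) ^ ℓ ^ N₀ = 1) :
    Tendsto (fun N : ℕ => A ^ ℓ ^ N) atTop (𝓝 1) := by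
  have := t2Space_adic (R := R)
  have := compactSpace_adic (R := R)
  have := GG.compactSpace_matrix (n := n) (R := R)
  have he : IsClosedEmbedding (Units.val : GL (Fin n) R → Matrix (Fin n) (Fin n) R) :=
    Units.continuous_val.isClosedEmbedding Units.val_injective
  rw [he.isInducing.nhds_eq_comap, tendsto_comap_iff]
  -- One `ℓ`-th power gains one power of the maximal ideal: `(1 + Y) ^ ℓ - 1` is `Y` times a
  -- geometric sum of `ℓ` terms, and this sum reduces to `ℓ = 0`.
  have hstep : ∀ (i : ℕ) (Y : Matrix (Fin n) (Fin n) R), (∀ a b, Y a b ∈ maximalIdeal R ^ (i + 1)) →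
      ∀ a b, ((1 + Y) ^ ℓ - 1) a b ∈ maximalIdeal R ^ (i + 2) := by
    intro i Y hY
    have hY0 : Y.map (residue R) = 0 := by
      ext a b
      exact (residue_eq_zero_iff _).2 (Ideal.pow_le_self (Nat.succ_ne_zero i) (hY a b))
    have hg : ∀ a b, (∑ j ∈ Finset.range ℓ, (1 + Y) ^ j) a b ∈ maximalIdeal R := by
      intro a b
      have h1 : (∑ j ∈ Finset.range ℓ, (1 + Y) ^ j).map (residue R) = 0 := by
        rw [← RingHom.mapMatrix_apply] at hY0 ⊢
        have h2 : residue R (ℓ : R) = 0 := (residue_eq_zero_iff _).2 hℓ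
        rw [map_natCast] at h2
        rw [map_sum, Finset.sum_congr rfl fun j _ => by
          rw [map_pow, map_add, map_one, hY0, add_zero, one_pow]]
        rw [Finset.sum_const, Finset.card_range, nsmul_one, ← Matrix.diagonal_natCast, h2,
          Matrix.diagonal_zero]
      rw [← residue_eq_zero_iff]
      exact congrFun (congrFun h1 a) b
    have hmul : (1 + Y) ^ ℓ - 1 = Y * ∑ j ∈ Finset.range ℓ, (1 + Y) ^ j := by
      rw [← mul_geom_sum, add_sub_cancel_left]
    intro a b
    rw [hmul, Matrix.mul_apply]
    refine Ideal.sum_mem _ fun c _ => ?_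
    rw [pow_succ _ (i + 1)]
    exact Ideal.mul_mem_mul (hY a c) (hg c b)
  have hpow : ∀ (i : ℕ) a b, ((A : Matrix (Fin n) (Fin n) R) ^ ℓ ^ (N₀ + i) - 1) a b ∈
      maximalIdeal R ^ (i + 1) := by
    intro i
    induction i with
    | zero =>
      intro a b
      rw [zero_add, pow_one, add_zero, ← residue_eq_zero_iff]
      have h1 : (((A : Matrix (Fin n) (Fin n) R) ^ ℓ ^ N₀ - 1).map (residue R)) = 0 := by
        rw [← RingHom.mapMatrix_apply, map_sub, map_pow, map_one, RingHom.mapMatrix_apply, hA,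
          sub_self]
      exact congrFun (congrFun h1 a) b
    | succ i ih =>
      have h := hstep i _ ih
      rw [add_sub_cancel, ← pow_mul, ← pow_succ] at h
      exact h
  refine tendsto_pi_nhds.2 fun a => tendsto_pi_nhds.2 fun b => ?_
  rw [(isAdic_maximalIdeal (R := R)).hasBasis_nhds _ |>.tendsto_right_iff]
  refine fun i _ => eventually_atTop.2 ⟨N₀ + i, fun N hN => ?_⟩
  obtain ⟨c, rfl⟩ := Nat.exists_eq_add_of_le hN
  refine ⟨((A : Matrix (Fin n) (Fin n) R) ^ ℓ ^ (N₀ + i + c) - 1) a b, ?_, ?_⟩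
  · have := hpow (i + c) a b
    rw [← add_assoc] at this
    exact Ideal.pow_le_pow_right (by omega) this
  · simp

end IsLocalRing

end AdicTopology

/-! ### Liftings as pairs of matrices -/

section Liftings

open IsLocalRing Filter Topology Matrix

attribute [local instance] IsLocalRing.adicTopologicalSpace

namespace GG

variable {n : ℕ} {R S T : Type*} [CommRing R] [CommRing S] [CommRing T]

@[simp]
theorem gl_ofGL (g : GL (Fin n) R) : (ofGL g).gl = g := rfl

theorem map_map (g : S →+* T) (f : R →+* S) (x : GG n R) :
    map g (map f x) = map (g.comp f) x := rfl

/-- The element `(B, -a) 𝔠` of `𝒢_n(R)`, of similitude `a`. -/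
def odd (B : GL (Fin n) R) (a : Rˣ) : GG n R := ⟨(B, -a), -1⟩

@[simp]
theorem gl_odd (B : GL (Fin n) R) (a : Rˣ) : (odd B a).gl = B := rfl

/-- The second component `-a` cancels under conjugation, so the relation between the images of `φ`
and `t` involves only their `GL_n`-components. -/
theorem odd_mul_ofGL_mul_inv (A B : GL (Fin n) R) (a : Rˣ) :
    odd B a * ofGL A * (odd B a)⁻¹ = ofGL (B * glContra n R A * B⁻¹) := by
  have hc : ∀ z, conjDualAction n R (-1) z = conjDual n R z := fun z =>
    congrArg (fun f : MulAut _ => f z)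
      (if_neg (by decide) : (if (-1 : ℤˣ) = 1 then 1 else conjDual n R) = conjDual n R)
  rw [mul_inv_eq_iff_eq_mul]
  refine SemidirectProduct.ext (Prod.ext ?_ ?_) rfl
  · change B * (conjDualAction n R (-1) (A, 1)).1 =
      B * glContra n R A * B⁻¹ * (conjDualAction n R 1 (B, -a)).1
    rw [hc, map_one]
    change B * (glScalar n R 1 * glContra n R A) = B * glContra n R A * B⁻¹ * B
    rw [map_one, one_mul, inv_mul_cancel_right]
  · change -a * (conjDualAction n R (-1) (A, 1)).2 = 1 * (conjDualAction n R 1 (B, -a)).2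
    rw [hc, map_one]
    change -a * 1 = 1 * -a
    rw [mul_one, one_mul]

theorem eq_ofGL {x : GG n R} (h : x.right = 1) (hn : x.nu = 1) : x = ofGL x.gl := by
  refine SemidirectProduct.ext (Prod.ext rfl ?_) h
  have h1 : x.left.2 * Units.map (Int.castRingHom R).toMonoidHom x.right = 1 := hn
  rw [h, map_one, mul_one] at h1
  exact h1

theorem eq_odd {x : GG n R} (h : x.right = -1) : x = odd x.gl x.nu := by
  refine SemidirectProduct.ext (Prod.ext rfl ?_) h
  change x.left.2 = -(x.left.2 * Units.map (Int.castRingHom R).toMonoidHom x.right)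
  rw [h]
  ext
  simp

theorem nu_odd (B : GL (Fin n) R) (a : Rˣ) : (odd B a).nu = a := by
  change -a * Units.map (Int.castRingHom R).toMonoidHom (-1) = a
  ext
  simp

theorem nu_ofGL (A : GL (Fin n) R) : (ofGL A).nu = 1 := by
  change 1 * Units.map (Int.castRingHom R).toMonoidHom 1 = 1
  simp

theorem map_odd (f : R →+* S) (B : GL (Fin n) R) (a : Rˣ) :
    map f (odd B a) = odd (GeneralLinearGroup.map f B) (Units.map f.toMonoidHom a) := by
  refine SemidirectProduct.ext (Prod.ext rfl ?_) rfl
  ext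
  simp [odd, map]

theorem map_ofGL (f : R →+* S) (A : GL (Fin n) R) :
    map f (ofGL A) = ofGL (GeneralLinearGroup.map f A) := by
  refine SemidirectProduct.ext (Prod.ext rfl ?_) rfl
  ext
  simp [ofGL, map]

theorem nu_map (f : R →+* S) (x : GG n R) : (map f x).nu = Units.map f.toMonoidHom x.nu := by
  change Units.map f.toMonoidHom x.left.2 * Units.map (Int.castRingHom S).toMonoidHom x.right =
    Units.map f.toMonoidHom (x.left.2 * Units.map (Int.castRingHom R).toMonoidHom x.right)
  ext
  simp

end GG

namespace TameGroup

variable {ℓ q : ℕ} [Fact ℓ.Prime] (hq : q.Coprime ℓ)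

theorem t_mem_powSubgroup (b : ℕ) : t hq ∈ powSubgroup hq b :=
  Subgroup.le_topologicalClosure _ (Subgroup.subset_closure (by simp))

/-- The sign character `t ↦ 1`, `φ ↦ -1` is continuous and trivial on `t` and `φ ^ 2`. Hence
`rhobar(φ)` lies in the component of `𝔠`. -/
theorem phi_notMem_powSubgroup : phi hq ∉ powSubgroup hq 2 := by
  obtain ⟨f, hf, hf1⟩ := ZHat.exists_hom_finite (-1 : ℤˣ)
  let F : TameGroup hq →* ℤˣ := f.comp SemidirectProduct.rightHom
  have hF : Continuous F := hf.comp (continuous_right hq)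
  have hphi : F (phi hq) = -1 := by
    change f (phi hq).right = -1
    simpa [phi] using hf1
  have hle : powSubgroup hq 2 ≤ F.ker := by
    refine Subgroup.topologicalClosure_minimal _ ((Subgroup.closure_le _).2 ?_)
      ((isClosed_singleton (x := (1 : ℤˣ))).preimage hF)
    rintro _ (rfl | rfl)
    · change f (t hq).right = 1
      simp [t]
    · change F (phi hq ^ 2) = 1
      rw [map_pow, hphi]
      rfl
  intro h
  have h1 : F (phi hq) = 1 := hle h
  rw [hphi] at h1
  exact absurd h1 (by decide)

end TameGroup

variable {O : Type u} [CommRing O] [IsLocalRing O]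

namespace CompleteLocalAlg

theorem finite_residueField [Finite (ResidueField O)] (R : CompleteLocalAlg O) :
    Finite (ResidueField R) :=
  Finite.of_surjective _ R.residue_bijective.2

theorem residue_algHom {R S : CompleteLocalAlg O} (f : R →ₐ[O] S) (x : R) (y : ResidueField O)
    (h : residue R x = R.resMap y) : residue S (f x) = S.resMap y := by
  obtain ⟨o, rfl⟩ := residue_surjective y
  have h1 : residue R (x - algebraMap O R o) = 0 := by
    rw [map_sub, sub_eq_zero, h]
    rfl
  have h2 := R.map_mem S f ((residue_eq_zero_iff _).1 h1)
  rw [map_sub, f.commutes, ← residue_eq_zero_iff, map_sub, sub_eq_zero] at h2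
  exact h2

end CompleteLocalAlg

theorem GG.map_residue_map {n : ℕ} {R S : CompleteLocalAlg O} (f : R →ₐ[O] S) (x : GG n R)
    (y : GG n (ResidueField O)) (h : GG.map (residue R) x = GG.map R.resMap y) :
    GG.map (residue S) (GG.map f.toRingHom x) = GG.map S.resMap y := by
  refine SemidirectProduct.ext (Prod.ext (Units.ext (Matrix.ext fun i j => ?_)) (Units.ext ?_)) ?_
  · exact CompleteLocalAlg.residue_algHom f _ _ (congrArg (fun z : GG n (ResidueField R) =>
      (z.gl : Matrix (Fin n) (Fin n) (ResidueField R)) i j) h)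
  · exact CompleteLocalAlg.residue_algHom f _ _ (congrArg (fun z : GG n (ResidueField R) =>
      (z.left.2 : ResidueField R)) h)
  · exact congrArg (fun z : GG n (ResidueField R) => z.right) h

theorem IsLifting.map {Γ : Type} [Group Γ] [TopologicalSpace Γ] {n : ℕ}
    {rbar : Γ →* GG n (ResidueField O)} {χ : Γ →* Oˣ} {R S : CompleteLocalAlg O} {r : Γ →* GG n R}
    (h : IsLifting rbar χ R r) (f : R →ₐ[O] S) :
    IsLifting rbar χ S ((GG.map f.toRingHom).comp r) where
  continuous := by
    have h1 : Continuous r := h.continuous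
    exact (GG.continuous_map _ (continuous_of_map_le _ fun x hx => R.map_mem S f hx)).comp h1
  reduction g := GG.map_residue_map f _ _ (h.reduction g)
  similitude g := by
    change (GG.map f.toRingHom (r g)).nu = _
    rw [GG.nu_map, h.similitude]
    ext
    exact f.commutes _

variable {ℓ q n : ℕ} [Fact ℓ.Prime] {hq : q.Coprime ℓ}

/-- The hypotheses on the representation and on the similitude character. -/
structure IsTameDatum (rhobar : TameGroup hq →* GG n (ResidueField O)) (μ : TameGroup hq →* Oˣ) :
    Prop where
  continuous : AdicContinuous rhobar
  continuousChar : AdicContinuousChar μ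
  comap_identityPart : (GG.identityPart n (ResidueField O)).comap rhobar =
    TameGroup.powSubgroup hq 2
  nu : ∀ g, (rhobar g).nu = Units.map (residue O).toMonoidHom (μ g)
  map_t : μ (TameGroup.t hq) = 1
  natCast_mem : (ℓ : O) ∈ maximalIdeal O

variable {rhobar : TameGroup hq →* GG n (ResidueField O)} {μ : TameGroup hq →* Oˣ}

namespace IsTameDatum

theorem right_t (h : IsTameDatum rhobar μ) : (rhobar (TameGroup.t hq)).right = 1 := by
  have h1 := TameGroup.t_mem_powSubgroup hq 2
  rw [← h.comap_identityPart] at h1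
  exact h1

theorem right_phi (h : IsTameDatum rhobar μ) : (rhobar (TameGroup.phi hq)).right = -1 := by
  have h1 := TameGroup.phi_notMem_powSubgroup hq
  rw [← h.comap_identityPart] at h1
  exact (Int.units_eq_one_or _).resolve_left h1

theorem map_t_eq (h : IsTameDatum rhobar μ) :
    rhobar (TameGroup.t hq) = GG.ofGL (rhobar (TameGroup.t hq)).gl :=
  GG.eq_ofGL h.right_t (by rw [h.nu, h.map_t, map_one])

theorem map_phi_eq (h : IsTameDatum rhobar μ) : rhobar (TameGroup.phi hq) =
    GG.odd (rhobar (TameGroup.phi hq)).gl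
      (Units.map (residue O).toMonoidHom (μ (TameGroup.phi hq))) := by
  rw [← h.nu]
  exact GG.eq_odd h.right_phi

end IsTameDatum

namespace IsLifting

variable {R : CompleteLocalAlg O} {ρ : TameGroup hq →* GG n R}

theorem map_t_eq (hρ : IsLifting rhobar μ R ρ) (h : IsTameDatum rhobar μ) :
    ρ (TameGroup.t hq) = GG.ofGL (ρ (TameGroup.t hq)).gl := by
  refine GG.eq_ofGL ?_ (by rw [hρ.similitude, h.map_t, map_one])
  exact (congrArg (fun z : GG n (ResidueField R) => z.right) (hρ.reduction _)).trans h.right_t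

theorem map_phi_eq (hρ : IsLifting rhobar μ R ρ) (h : IsTameDatum rhobar μ) :
    ρ (TameGroup.phi hq) = GG.odd (ρ (TameGroup.phi hq)).gl
      (Units.map (algebraMap O R).toMonoidHom (μ (TameGroup.phi hq))) := by
  rw [← hρ.similitude]
  refine GG.eq_odd ?_
  exact (congrArg (fun z : GG n (ResidueField R) => z.right) (hρ.reduction _)).trans h.right_phi

theorem relation (hρ : IsLifting rhobar μ R ρ) (h : IsTameDatum rhobar μ) :
    (ρ (TameGroup.phi hq)).gl * glContra n R (ρ (TameGroup.t hq)).gl *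
      (ρ (TameGroup.phi hq)).gl⁻¹ = (ρ (TameGroup.t hq)).gl ^ q := by
  have h1 := congrArg ρ (TameGroup.phi_mul_t_mul_phi_inv hq)
  rw [map_mul, map_mul, map_inv, map_pow, hρ.map_t_eq h, hρ.map_phi_eq h,
    GG.odd_mul_ofGL_mul_inv, ← map_pow] at h1
  exact congrArg GG.gl h1

theorem gl_map_residue (hρ : IsLifting rhobar μ R ρ) (g : TameGroup hq) :
    GeneralLinearGroup.map (residue R) (ρ g).gl = GeneralLinearGroup.map R.resMap (rhobar g).gl :=
  congrArg GG.gl (hρ.reduction g)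

theorem ext {ρ' : TameGroup hq →* GG n R} (hρ : IsLifting rhobar μ R ρ)
    (hρ' : IsLifting rhobar μ R ρ') (h : IsTameDatum rhobar μ)
    (ht : (ρ (TameGroup.t hq)).gl = (ρ' (TameGroup.t hq)).gl)
    (hphi : (ρ (TameGroup.phi hq)).gl = (ρ' (TameGroup.phi hq)).gl) : ρ = ρ' := by
  have := t2Space_adic (R := R)
  have := GG.t2Space (n := n) (R := R)
  refine TameGroup.hom_ext hq hρ.continuous hρ'.continuous ?_ ?_
  · rw [hρ.map_t_eq h, hρ'.map_t_eq h, ht]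
  · rw [hρ.map_phi_eq h, hρ'.map_phi_eq h, hphi]

end IsLifting

/-- The powers `t ^ ℓ ^ N` tend to `1`, and `𝒢_n(k)` is discrete. -/
theorem IsTameDatum.exists_pow_eq_one (h : IsTameDatum rhobar μ) :
    ∃ N, (rhobar (TameGroup.t hq)).gl ^ ℓ ^ N = 1 := by
  have hc : Continuous rhobar := h.continuous
  have h0 : DiscreteTopology (ResidueField O) := discreteTopology_of_isField
  have h1 : DiscreteTopology (Matrix (Fin n) (Fin n) (ResidueField O)) :=
    inferInstanceAs (DiscreteTopology (Fin n → Fin n → ResidueField O))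
  have h2 : DiscreteTopology (GG n (ResidueField O)) := GG.isEmbedding_equivProd.discreteTopology
  have h3 := (hc.tendsto 1).comp (TameGroup.tendsto_t_pow hq)
  rw [map_one, nhds_discrete, tendsto_pure, eventually_atTop] at h3
  obtain ⟨N, hN⟩ := h3
  refine ⟨N, ?_⟩
  have h4 : rhobar (TameGroup.t hq ^ ℓ ^ N) = 1 := hN N le_rfl
  rw [map_pow, h.map_t_eq, ← map_pow] at h4
  exact congrArg GG.gl h4

variable [Finite (ResidueField O)]

/-- Liftings are given by pairs of matrices. -/
theorem IsTameDatum.exists_isLifting (h : IsTameDatum rhobar μ) (R : CompleteLocalAlg O)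
    (A B : GL (Fin n) R) (hAB : B * glContra n R A * B⁻¹ = A ^ q)
    (hA : GeneralLinearGroup.map (residue R) A =
      GeneralLinearGroup.map R.resMap (rhobar (TameGroup.t hq)).gl)
    (hB : GeneralLinearGroup.map (residue R) B =
      GeneralLinearGroup.map R.resMap (rhobar (TameGroup.phi hq)).gl) :
    ∃ ρ : TameGroup hq →* GG n R, IsLifting rhobar μ R ρ ∧ (ρ (TameGroup.t hq)).gl = A ∧
      (ρ (TameGroup.phi hq)).gl = B := by
  have := R.finite_residueField
  have := t2Space_adic (R := R)
  have := compactSpace_adic (R := R)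
  have := totallyDisconnectedSpace_adic (R := R)
  have := GG.t2Space (n := n) (R := R)
  have := GG.compactSpace (n := n) (R := R)
  have := GG.totallyDisconnectedSpace (n := n) (R := R)
  obtain ⟨N₀, hN₀⟩ := h.exists_pow_eq_one
  have hℓ : (ℓ : R) ∈ maximalIdeal R := by
    have := R.algebraMap_mem h.natCast_mem
    rwa [map_natCast] at this
  have htend : Tendsto (fun N : ℕ => (GG.ofGL A) ^ ℓ ^ N) atTop (𝓝 1) := by
    have h1 := tendsto_pow_GL hℓ A (N₀ := N₀) (by
      have h2 : GeneralLinearGroup.map (residue R) A ^ ℓ ^ N₀ = 1 := by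
        rw [hA, ← map_pow, hN₀, map_one]
      exact congrArg Units.val h2)
    have h2 := (GG.continuous_ofGL (n := n) (R := R)).continuousAt.tendsto.comp h1
    rw [map_one] at h2
    exact h2.congr fun N => map_pow _ _ _
  obtain ⟨ρ, hρ, hρt, hρp⟩ := TameGroup.exists_hom hq (GG.ofGL A)
    (GG.odd B (Units.map (algebraMap O R).toMonoidHom (μ (TameGroup.phi hq)))) htend (by
      rw [GG.odd_mul_ofGL_mul_inv, hAB, map_pow])
  refine ⟨ρ, ⟨hρ, fun g => ?_, fun g => ?_⟩, by rw [hρt, GG.gl_ofGL], by rw [hρp, GG.gl_odd]⟩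
  · have : T2Space (ResidueField R) := t2Space_adic
    have := GG.t2Space (n := n) (R := ResidueField R)
    have hc : Continuous rhobar := h.continuous
    -- Both sides are continuous into a Hausdorff group, so it suffices to compare them at `t` and
    -- `φ`; the same argument gives the similitude character.
    have h1 : (GG.map (residue R)).comp ρ = (GG.map R.resMap).comp rhobar := by
      refine TameGroup.hom_ext hq ((GG.continuous_map _ (continuous_of_map_le _ fun x hx => ?_)).comp
        hρ) ((GG.continuous_map _ (continuous_of_map_le _ fun x hx => ?_)).comp hc) ?_ ?_
      · rw [(residue_eq_zero_iff x).2 hx]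
        exact zero_mem _
      · rw [(isField_iff_maximalIdeal_eq (R := ResidueField O)).1 (Field.toIsField _)] at hx
        rw [Ideal.mem_bot.1 hx, map_zero]
        exact zero_mem _
      · simp only [MonoidHom.comp_apply]
        rw [hρt, h.map_t_eq, GG.map_ofGL, GG.map_ofGL, hA]
      · simp only [MonoidHom.comp_apply]
        rw [hρp, h.map_phi_eq, GG.map_odd, GG.map_odd, hB]
        rfl
    exact DFunLike.congr_fun h1 g
  · have hc : Continuous μ := h.continuousChar
    have h1 : GG.nu.comp ρ = (Units.map (algebraMap O R).toMonoidHom).comp μ := by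
      refine TameGroup.hom_ext hq (GG.continuous_nu.comp hρ)
        ((Continuous.units_map _ (continuous_of_map_le _ fun x hx => R.algebraMap_mem hx)).comp hc)
        ?_ ?_
      · simp only [MonoidHom.comp_apply]
        rw [hρt, GG.nu_ofGL, h.map_t, map_one]
      · simp only [MonoidHom.comp_apply]
        rw [hρp, GG.nu_odd]
    exact DFunLike.congr_fun h1 g

end Liftings

/-! ### The universal lifting -/

section UniversalLifting

open IsLocalRing Matrix

variable {O : Type u} [CommRing O] [IsLocalRing O]

/-- This form of the relation is free of inverses, hence polynomial in the entries: it generates an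
ideal, and it can be tested on matrices before they are known to be invertible. -/
theorem mul_glContra_mul_inv_eq_pow_iff {n q : ℕ} {R : Type*} [CommRing R] (A B : GL (Fin n) R) :
    B * glContra n R A * B⁻¹ = A ^ q ↔
      (A : Matrix (Fin n) (Fin n) R) ^ q * B * (A : Matrix (Fin n) (Fin n) R)ᵀ = B := by
  rw [mul_inv_eq_iff_eq_mul, ← eq_mul_inv_iff_mul_eq, Units.ext_iff,
    eq_comm]
  simp only [Units.val_mul, Units.val_pow_eq_pow_val]
  rfl

theorem Matrix.map_residue_eq_of_sub_mem {ι R : Type*} [CommRing R] [IsLocalRing R]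
    {A B : Matrix ι ι R} (h : ∀ i j, (A - B) i j ∈ maximalIdeal R) :
    A.map (residue R) = B.map (residue R) := by
  ext i j
  have := (residue_eq_zero_iff _).2 (h i j)
  rwa [Matrix.sub_apply, map_sub, sub_eq_zero] at this

theorem Matrix.sub_mem_of_map_residue_eq {ι R : Type*} [CommRing R] [IsLocalRing R]
    {A B : Matrix ι ι R} (h : A.map (residue R) = B.map (residue R)) (i j : ι) :
    (A - B) i j ∈ maximalIdeal R := by
  rw [← residue_eq_zero_iff, Matrix.sub_apply, map_sub, sub_eq_zero]
  exact congrFun (congrFun h i) j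

theorem Matrix.map_algebraMap_map_residue {ι : Type*} (R : CompleteLocalAlg O)
    (A₀ : Matrix ι ι O) : (A₀.map (algebraMap O R)).map (residue R) =
      (A₀.map (residue O)).map R.resMap := rfl

theorem Matrix.map_algHom_map_residue {ι : Type*} {R S : CompleteLocalAlg O} (f : R →ₐ[O] S)
    {A : Matrix ι ι R} {Abar : Matrix ι ι (ResidueField O)}
    (h : A.map (residue R) = Abar.map R.resMap) : (A.map f).map (residue S) = Abar.map S.resMap :=
  Matrix.ext fun i j => CompleteLocalAlg.residue_algHom f _ _ (congrFun (congrFun h i) j)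

theorem Matrix.exists_map_residue_eq {ι R : Type*} [CommRing R] [IsLocalRing R]
    (A : Matrix ι ι (ResidueField R)) : ∃ A₀ : Matrix ι ι R, A₀.map (residue R) = A := by
  choose f hf using residue_surjective (R := R)
  exact ⟨A.map f, Matrix.ext fun i j => hf _⟩

variable {ℓ q n : ℕ} [Fact ℓ.Prime] {hq : q.Coprime ℓ}
  {rhobar : TameGroup hq →* GG n (ResidueField O)} {μ : TameGroup hq →* Oˣ}

namespace IsLifting

variable {R : CompleteLocalAlg O} {ρ : TameGroup hq →* GG n R}

theorem relation_matrix (hρ : IsLifting rhobar μ R ρ) (h : IsTameDatum rhobar μ) :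
    ((ρ (TameGroup.t hq)).gl : Matrix (Fin n) (Fin n) R) ^ q *
      ((ρ (TameGroup.phi hq)).gl : Matrix (Fin n) (Fin n) R) *
      ((ρ (TameGroup.t hq)).gl : Matrix (Fin n) (Fin n) R)ᵀ = (ρ (TameGroup.phi hq)).gl :=
  (mul_glContra_mul_inv_eq_pow_iff _ _).1 (hρ.relation h)

theorem map_residue (hρ : IsLifting rhobar μ R ρ) (g : TameGroup hq) :
    ((ρ g).gl : Matrix (Fin n) (Fin n) R).map (residue R) =
      ((rhobar g).gl : Matrix (Fin n) (Fin n) (ResidueField O)).map R.resMap :=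
  congrArg Units.val (hρ.gl_map_residue g)

theorem sub_mem (hρ : IsLifting rhobar μ R ρ) {g : TameGroup hq} {A₀ : Matrix (Fin n) (Fin n) O}
    (hA₀ : A₀.map (residue O) = (rhobar g).gl) (i j : Fin n) :
    (((ρ g).gl : Matrix (Fin n) (Fin n) R) - A₀.map (algebraMap O R)) i j ∈ maximalIdeal R := by
  refine Matrix.sub_mem_of_map_residue_eq ?_ i j
  rw [hρ.map_residue, Matrix.map_algebraMap_map_residue, hA₀]

end IsLifting

theorem IsTameDatum.relation_matrix (h : IsTameDatum rhobar μ) :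
    ((rhobar (TameGroup.t hq)).gl : Matrix (Fin n) (Fin n) (ResidueField O)) ^ q *
      ((rhobar (TameGroup.phi hq)).gl : Matrix (Fin n) (Fin n) (ResidueField O)) *
      ((rhobar (TameGroup.t hq)).gl : Matrix (Fin n) (Fin n) (ResidueField O))ᵀ =
      (rhobar (TameGroup.phi hq)).gl := by
  refine (mul_glContra_mul_inv_eq_pow_iff _ _).1 ?_
  have h1 := congrArg rhobar (TameGroup.phi_mul_t_mul_phi_inv hq)
  rw [map_mul, map_mul, map_inv, map_pow, h.map_t_eq, h.map_phi_eq,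
    GG.odd_mul_ofGL_mul_inv, ← map_pow] at h1
  exact congrArg GG.gl h1

variable [Finite (ResidueField O)]

theorem IsTameDatum.exists_isLifting_matrix (h : IsTameDatum rhobar μ) (R : CompleteLocalAlg O)
    (A B : Matrix (Fin n) (Fin n) R) (hAB : A ^ q * B * Aᵀ = B)
    (hA : A.map (residue R) = ((rhobar (TameGroup.t hq)).gl : Matrix (Fin n) (Fin n) _).map R.resMap)
    (hB : B.map (residue R) = ((rhobar (TameGroup.phi hq)).gl : Matrix (Fin n) (Fin n) _).map R.resMap) :
    ∃ ρ : TameGroup hq →* GG n R, IsLifting rhobar μ R ρ ∧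
      ((ρ (TameGroup.t hq)).gl : Matrix (Fin n) (Fin n) R) = A ∧
      ((ρ (TameGroup.phi hq)).gl : Matrix (Fin n) (Fin n) R) = B := by
  have hu : ∀ (C : Matrix (Fin n) (Fin n) R) (g : GL (Fin n) (ResidueField O)),
      C.map (residue R) = (g : Matrix (Fin n) (Fin n) _).map R.resMap → IsUnit C := fun C g hC =>
    isUnit_matrix_of_residue (hC ▸ (GeneralLinearGroup.map R.resMap g).isUnit)
  obtain ⟨A, rfl⟩ := hu A _ hA
  obtain ⟨B, rfl⟩ := hu B _ hB
  obtain ⟨ρ, hρ, rfl, rfl⟩ := h.exists_isLifting R A B ((mul_glContra_mul_inv_eq_pow_iff _ _).2 hAB)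
    (Units.ext hA) (Units.ext hB)
  exact ⟨ρ, hρ, rfl, rfl⟩

theorem IsTameDatum.nonempty_universalLifting [IsPrincipalIdealRing O]
    [IsAdicComplete (maximalIdeal O) O] (h : IsTameDatum rhobar μ) :
    Nonempty (UniversalLifting rhobar μ) := by
  obtain ⟨S, x, hS⟩ := exists_isFormalAffineSpace O (Fintype.card (Bool × Fin n × Fin n))
  let e := Fintype.equivFin (Bool × Fin n × Fin n)
  obtain ⟨A₀, hA₀⟩ := Matrix.exists_map_residue_eq
    ((rhobar (TameGroup.t hq)).gl : Matrix (Fin n) (Fin n) (ResidueField O))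
  obtain ⟨B₀, hB₀⟩ := Matrix.exists_map_residue_eq
    ((rhobar (TameGroup.phi hq)).gl : Matrix (Fin n) (Fin n) (ResidueField O))
  -- The generic pair: arbitrary lifts of the two residual matrices to `O`, plus one independent
  -- variable for each entry.
  let A : Matrix (Fin n) (Fin n) S :=
    A₀.map (algebraMap O S) + Matrix.of fun i j => x (e (false, i, j))
  let B : Matrix (Fin n) (Fin n) S :=
    B₀.map (algebraMap O S) + Matrix.of fun i j => x (e (true, i, j))
  have hA : A.map (residue S) = ((rhobar (TameGroup.t hq)).gl : Matrix (Fin n) (Fin n) _).map S.resMap := by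
    rw [← hA₀, ← Matrix.map_algebraMap_map_residue]
    refine Matrix.map_residue_eq_of_sub_mem fun i j => ?_
    rw [add_sub_cancel_left]
    exact hS.mem _
  have hB : B.map (residue S) = ((rhobar (TameGroup.phi hq)).gl : Matrix (Fin n) (Fin n) _).map S.resMap := by
    rw [← hB₀, ← Matrix.map_algebraMap_map_residue]
    refine Matrix.map_residue_eq_of_sub_mem fun i j => ?_
    rw [add_sub_cancel_left]
    exact hS.mem _
  -- The entries of the relation. The ideal is proper because `rhobar` satisfies the relation.
  let I : Ideal S := Ideal.span (Set.range fun p : Fin n × Fin n => (A ^ q * B * Aᵀ - B) p.1 p.2)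
  have hI : I ≤ maximalIdeal S := by
    refine Ideal.span_le.2 ?_
    rintro _ ⟨⟨i, j⟩, rfl⟩
    refine Matrix.sub_mem_of_map_residue_eq ?_ i j
    rw [Matrix.map_mul, Matrix.map_mul, Matrix.map_pow, Matrix.transpose_map, hA, hB,
      ← Matrix.map_pow, ← Matrix.transpose_map, ← Matrix.map_mul, ← Matrix.map_mul,
      h.relation_matrix]
  let π : S →ₐ[O] S.quot I hI := S.quotMk I hI
  have hrel : ∀ (R : CompleteLocalAlg O) (f : S →ₐ[O] R),
      (A ^ q * B * Aᵀ - B).map f = A.map f ^ q * B.map f * (A.map f)ᵀ - B.map f := by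
    intro R f
    rw [← AlgHom.mapMatrix_apply, ← AlgHom.mapMatrix_apply, ← AlgHom.mapMatrix_apply, map_sub,
      map_mul, map_mul, map_pow]
    rfl
  obtain ⟨ρ, hρ, hρt, hρp⟩ := h.exists_isLifting_matrix (S.quot I hI) (A.map π) (B.map π)
    (by
      rw [← sub_eq_zero, ← hrel]
      ext i j
      exact (S.quotMk_eq_zero_iff I hI).2 (Ideal.subset_span ⟨(i, j), rfl⟩))
    (Matrix.map_algHom_map_residue π hA) (Matrix.map_algHom_map_residue π hB)
  refine ⟨⟨S.quot I hI, ρ, hρ, fun R r hr => ?_⟩⟩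
  let y : Bool × Fin n × Fin n → R := fun p =>
    if p.1 then (((r (TameGroup.phi hq)).gl : Matrix (Fin n) (Fin n) R) -
      B₀.map (algebraMap O R)) p.2.1 p.2.2
    else (((r (TameGroup.t hq)).gl : Matrix (Fin n) (Fin n) R) -
      A₀.map (algebraMap O R)) p.2.1 p.2.2
  have hy : ∀ p, y p ∈ maximalIdeal R := by
    rintro ⟨b, i, j⟩
    cases b
    · exact hr.sub_mem hA₀ i j
    · exact hr.sub_mem hB₀ i j
  have hAf : ∀ (f : S →ₐ[O] R), (∀ p, f (x (e p)) = y p) →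
      A.map f = (r (TameGroup.t hq)).gl := fun f hf => by
    ext i j
    change f (algebraMap O S (A₀ i j) + x (e (false, i, j))) = _
    rw [map_add, hf, f.commutes]
    exact add_sub_cancel _ _
  have hBf : ∀ (f : S →ₐ[O] R), (∀ p, f (x (e p)) = y p) →
      B.map f = (r (TameGroup.phi hq)).gl := fun f hf => by
    ext i j
    change f (algebraMap O S (B₀ i j) + x (e (true, i, j))) = _
    rw [map_add, hf, f.commutes]
    exact add_sub_cancel _ _
  obtain ⟨f, hf⟩ := hS.exists_algHom R (fun m => y (e.symm m)) fun m => hy _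
  replace hf : ∀ p, f (x (e p)) = y p := fun p => by rw [hf, e.symm_apply_apply]
  have hfI : ∀ z ∈ I, f z = 0 := by
    intro z hz
    refine (Ideal.span_le (I := RingHom.ker f)).2 ?_ hz
    rintro _ ⟨⟨i, j⟩, rfl⟩
    have h1 := hrel R f
    rw [hAf f hf, hBf f hf, hr.relation_matrix h, sub_self] at h1
    exact congrFun (congrFun h1 i) j
  have hgl : ∀ (g : S.quot I hI →ₐ[O] R) (s : TameGroup hq) (C : Matrix (Fin n) (Fin n) S),
      ((ρ s).gl : Matrix (Fin n) (Fin n) _) = C.map π →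
      (((GG.map g.toRingHom) (ρ s)).gl : Matrix (Fin n) (Fin n) R) = C.map (g.comp π) := by
    intro g s C hC
    change ((ρ s).gl : Matrix (Fin n) (Fin n) _).map g = _
    rw [hC]
    rfl
  have hcomp : (S.quotLift I hI f hfI).comp π = f :=
    AlgHom.ext fun z => S.quotLift_quotMk I hI f hfI z
  refine ⟨S.quotLift I hI f hfI, ?_, fun g hg => ?_⟩
  · refine DFunLike.congr_fun ((hρ.map (S.quotLift I hI f hfI)).ext hr h ?_ ?_)
    · exact Units.ext ((hgl _ _ A hρt).trans ((congrArg (fun g : S →ₐ[O] R => A.map g) hcomp).trans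
        (hAf f hf)))
    · exact Units.ext ((hgl _ _ B hρp).trans ((congrArg (fun g : S →ₐ[O] R => B.map g) hcomp).trans
        (hBf f hf)))
  -- Uniqueness: the lifting determines the images of the entries of the generic pair, hence of all
  -- the variables.
  · have h1 : g.comp π = f := by
      refine hS.algHom_ext R _ _ fun m => ?_
      obtain ⟨⟨b, i, j⟩, rfl⟩ := e.surjective m
      rw [hf]
      cases b
      · have h2 := hgl g _ A hρt
        rw [hg] at h2
        have h3 : _ = (g.comp π) (algebraMap O S (A₀ i j) + x (e (false, i, j))) :=
          congrFun (congrFun h2 i) j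
        rw [map_add, AlgHom.commutes] at h3
        exact (sub_eq_of_eq_add' h3).symm
      · have h2 := hgl g _ B hρp
        rw [hg] at h2
        have h3 : _ = (g.comp π) (algebraMap O S (B₀ i j) + x (e (true, i, j))) :=
          congrFun (congrFun h2 i) j
        rw [map_add, AlgHom.commutes] at h3
        exact (sub_eq_of_eq_add' h3).symm
    refine AlgHom.ext fun z => ?_
    obtain ⟨z, rfl⟩ := S.quotMk_surjective I hI z
    exact (DFunLike.congr_fun h1 z).trans (S.quotLift_quotMk I hI f hfI z).symm

end UniversalLifting

/-! ### Uniqueness of the Jordan type -/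

section JordanType

open Matrix

/-- The second difference at `i` of the function `i ↦ max (a - i) 0`, which is the truncated
subtraction, is the indicator of `a = i + 1`. -/
theorem Multiset.count_add_two_mul_sum_sub (s : Multiset ℕ) (i : ℕ) :
    s.count (i + 1) + 2 * (s.map fun a => a - (i + 1)).sum =
      (s.map fun a => a - i).sum + (s.map fun a => a - (i + 2)).sum := by
  induction s using Multiset.induction_on with
  | empty => simp
  | cons a s ih =>
    simp only [Multiset.map_cons, Multiset.sum_cons, Multiset.count_cons]
    split_ifs <;> omega

/-- The second differences count the parts of each positive size; parts equal to `0` would leave no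
trace in the sums. -/
theorem Multiset.eq_of_sum_sub_eq {s t : Multiset ℕ} (hs : ∀ a ∈ s, 0 < a) (ht : ∀ a ∈ t, 0 < a)
    (h : ∀ i, (s.map fun a => a - i).sum = (t.map fun a => a - i).sum) : s = t := by
  ext a
  rcases a with _ | i
  · rw [Multiset.count_eq_zero_of_notMem fun h0 => (hs 0 h0).ne rfl,
      Multiset.count_eq_zero_of_notMem fun h0 => (ht 0 h0).ne rfl]
  · have h1 := s.count_add_two_mul_sum_sub i
    have h2 := t.count_add_two_mul_sum_sub i
    rw [h, h, h] at h1
    omega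

/-- The product of the matrix of `f` with that of its inverse is the diagonal projection onto the
domain of `f`, and each of the two matrices factors through the other. -/
theorem PEquiv.rank_toMatrix {ι K : Type*} [Fintype ι] [DecidableEq ι] [Field K] (f : ι ≃. ι) :
    (f.toMatrix : Matrix ι ι K).rank = Fintype.card {x // (f x).isSome} := by
  classical
  have hd : (f.trans f.symm).toMatrix =
      (diagonal fun x => if (f x).isSome then (1 : K) else 0 : Matrix ι ι K) := by
    rw [PEquiv.self_trans_symm]
    ext x y
    simp only [PEquiv.toMatrix_apply, diagonal_apply, PEquiv.mem_ofSet_iff]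
    by_cases hxy : x = y
    · simp [hxy]
    · simp [hxy, Ne.symm hxy]
  have hr : ((f.trans f.symm).toMatrix : Matrix ι ι K).rank = Fintype.card {x // (f x).isSome} := by
    rw [hd, rank_diagonal]
    exact Fintype.card_congr (Equiv.subtypeEquivRight fun x => by
      cases f x <;> simp)
  refine le_antisymm ?_ ?_
  · have h1 : f.toMatrix = (f.trans f.symm).toMatrix * (f.toMatrix : Matrix ι ι K) := by
      ext x y
      rw [hd, diagonal_mul, PEquiv.toMatrix_apply]
      by_cases h : (f x).isSome
      · simp [h]
      · rw [Option.not_isSome_iff_eq_none] at h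
        simp [h]
    rw [← hr]
    calc (f.toMatrix : Matrix ι ι K).rank
        = ((f.trans f.symm).toMatrix * (f.toMatrix : Matrix ι ι K)).rank := by rw [← h1]
      _ ≤ _ := rank_mul_le_left _ _
  · rw [← hr, PEquiv.toMatrix_trans]
    exact rank_mul_le_left _ _

variable {r n : ℕ} {m : Fin r → ℕ}

theorem exists_toMatrix_eq_pow (e : (Σ i, Fin (m i)) ≃ Fin n) (K : Type*) [CommRing K] (k : ℕ) :
    ∃ g : Fin n ≃. Fin n, (g.toMatrix : Matrix (Fin n) (Fin n) K) = (jordanPEquiv m e).toMatrix ^ k ∧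
      ∀ x y, g x = some y ↔ (e.symm x).1 = (e.symm y).1 ∧
        ((e.symm x).2 : ℕ) + k = (e.symm y).2 := by
  induction k with
  | zero =>
    refine ⟨PEquiv.refl _, by simp, fun x y => ?_⟩
    rw [PEquiv.refl_apply, Option.some_inj, ← e.symm.injective.eq_iff]
    constructor
    · intro h
      obtain rfl := e.symm.injective h
      simp
    · generalize e.symm x = a, e.symm y = b
      obtain ⟨i, a⟩ := a
      obtain ⟨j, b⟩ := b
      rintro ⟨rfl, h⟩
      exact Sigma.ext rfl (heq_of_eq (Fin.ext h))
  | succ k ih =>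
    obtain ⟨g, hg, hg'⟩ := ih
    refine ⟨g.trans (jordanPEquiv m e), by rw [PEquiv.toMatrix_trans, hg, pow_succ], fun x y => ?_⟩
    rw [PEquiv.trans_eq_some]
    simp only [hg', jordanPEquiv_eq_some_iff, jordanShift_eq_some_iff]
    constructor
    · rintro ⟨b, ⟨h1, h2⟩, h3, h4⟩
      exact ⟨h1.trans h3, by omega⟩
    · rintro ⟨h1, h2⟩
      have hlt : ((e.symm x).2 : ℕ) + k < m (e.symm x).1 := by
        have := (e.symm y).2.2
        have := congrArg m h1
        omega
      refine ⟨e ⟨(e.symm x).1, ⟨(e.symm x).2 + k, hlt⟩⟩, ?_⟩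
      rw [e.symm_apply_apply]
      exact ⟨⟨rfl, rfl⟩, h1, by simpa [add_assoc] using h2⟩

theorem rank_jordanPEquiv_pow (e : (Σ i, Fin (m i)) ≃ Fin n) (K : Type*) [Field K] (k : ℕ) :
    ((jordanPEquiv m e).toMatrix ^ k : Matrix (Fin n) (Fin n) K).rank = ∑ i, (m i - k) := by
  obtain ⟨g, hg, hg'⟩ := exists_toMatrix_eq_pow e K k
  rw [← hg, PEquiv.rank_toMatrix]
  have h1 : ∀ x, (g x).isSome ↔ ((e.symm x).2 : ℕ) + k < m (e.symm x).1 := by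
    intro x
    rw [Option.isSome_iff_exists]
    constructor
    · rintro ⟨y, hy⟩
      rw [hg'] at hy
      have := (e.symm y).2.2
      have := congrArg m hy.1
      omega
    · intro h
      refine ⟨e ⟨(e.symm x).1, ⟨(e.symm x).2 + k, h⟩⟩, (hg' _ _).2 ?_⟩
      rw [e.symm_apply_apply]
      exact ⟨rfl, rfl⟩
  have h2 : {s : Σ i, Fin (m i) // (s.2 : ℕ) + k < m s.1} ≃ Σ i, Fin (m i - k) :=
    { toFun := fun s => ⟨s.1.1, ⟨s.1.2, by have := s.2; omega⟩⟩
      invFun := fun p => ⟨⟨p.1, ⟨p.2, by have := p.2.2; omega⟩⟩, by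
        have := p.2.2
        change (p.2 : ℕ) + k < m p.1
        omega⟩
      left_inv := fun s => rfl
      right_inv := fun p => rfl }
  rw [Fintype.card_congr ((e.symm.subtypeEquiv h1).trans h2), Fintype.card_sigma]
  simp

/-- The rank of `X ^ k` is the sum of the numbers `max (a - k) 0` over the parts `a`, and these sums
determine the partition. -/
theorem HasJordanType.unique {K : Type*} [Field K] {p p' : n.Partition} {X : Matrix (Fin n) (Fin n) K}
    (h : HasJordanType p X) (h' : HasJordanType p' X) : p = p' := by
  have key : ∀ {p : n.Partition}, HasJordanType p X → ∀ k,
      (p.parts.map fun a => a - k).sum = (X ^ k).rank := by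
    intro p hp k
    obtain ⟨r, m, e, P, hm, hP, hX⟩ := hasJordanType_iff.1 hp
    have hk : X ^ k * P = P * (jordanPEquiv m e).toMatrix ^ k := by
      induction k with
      | zero => simp
      | succ k ih => rw [pow_succ, mul_assoc, hX, ← mul_assoc, ih, mul_assoc, ← pow_succ]
    have hdet := (isUnit_iff_isUnit_det P).1 hP
    rw [← rank_mul_eq_left_of_isUnit_det P (X ^ k) hdet, hk,
      rank_mul_eq_right_of_isUnit_det P _ hdet, rank_jordanPEquiv_pow, ← hm]
    simp [List.map_ofFn, List.sum_ofFn]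
  refine Nat.Partition.ext (Multiset.eq_of_sum_sub_eq (fun a => p.parts_pos) (fun a => p'.parts_pos)
    fun i => ?_)
  rw [key h, key h']

end JordanType

/-! ### Coordinates on the pairs `(X, B)` -/

section Parametrization

open IsLocalRing Matrix

variable {n : ℕ} {R S : Type*} [CommRing R] [CommRing S]

/-- The transition matrix attached to the parameter `M`. -/
noncomputable def paramG (f : Fin n ≃. Fin n) (P M : Matrix (Fin n) (Fin n) R) :
    Matrix (Fin n) (Fin n) R :=
  P * (1 + (M - commProj f M))

/-- The matrix of the polarization attached to the parameter `M`. -/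
noncomputable def paramB (f : Fin n ≃. Fin n) (P Z b M : Matrix (Fin n) (Fin n) R) :
    Matrix (Fin n) (Fin n) R :=
  paramG f P M * (Z + commProj f M) * b * (paramG f P M)ᵀ

theorem paramG_map (g : R →+* S) (f : Fin n ≃. Fin n) (P M : Matrix (Fin n) (Fin n) R) :
    (paramG f P M).map g = paramG f (P.map g) (M.map g) := by
  rw [paramG, paramG, Matrix.map_mul, Matrix.map_add _ (map_add g), Matrix.map_sub _ (map_sub g),
    commProj_map, Matrix.map_one _ (map_zero g) (map_one g)]

theorem paramB_map (g : R →+* S) (f : Fin n ≃. Fin n) (P Z b M : Matrix (Fin n) (Fin n) R) :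
    (paramB f P Z b M).map g = paramB f (P.map g) (Z.map g) (b.map g) (M.map g) := by
  rw [paramB, paramB, Matrix.map_mul, Matrix.map_mul, Matrix.map_mul, transpose_map, paramG_map,
    Matrix.map_add _ (map_add g), commProj_map]

theorem paramG_zero (f : Fin n ≃. Fin n) (P : Matrix (Fin n) (Fin n) R) : paramG f P 0 = P := by
  rw [paramG, map_zero, sub_zero, add_zero, mul_one]

theorem paramB_zero (f : Fin n ≃. Fin n) (P Z b : Matrix (Fin n) (Fin n) R) :
    paramB f P Z b 0 = P * Z * b * Pᵀ := by
  rw [paramB, paramG_zero, map_zero, add_zero]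

theorem isNilpotent_of_mul_eq {X G J : Matrix (Fin n) (Fin n) R} (hG : IsUnit G) (hJ : J ^ n = 0)
    (h : X * G = G * J) : X ^ n = 0 := by
  have hk : ∀ k, X ^ k * G = G * J ^ k := fun k => by
    induction k with
    | zero => simp
    | succ k ih => rw [pow_succ, mul_assoc, h, ← mul_assoc, ih, mul_assoc, ← pow_succ]
  refine hG.mul_right_cancel ?_
  rw [hk, hJ, mul_zero, zero_mul]

/-- Transported along `G`, the matrix `X` becomes `J` and the form becomes `Z * b`. As `b` already
satisfies the relation with `J`, the relation for `Z * b` follows from `Z` commuting with `J`. -/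
theorem mul_transpose_of_commute {X G Z b J : Matrix (Fin n) (Fin n) R} {q : R}
    (h : X * G = G * J) (hZ : J * Z = Z * J) (hb : b * Jᵀ = -q • (J * b)) :
    G * Z * b * Gᵀ * Xᵀ = -q • (X * (G * Z * b * Gᵀ)) := by
  have h1 : Gᵀ * Xᵀ = Jᵀ * Gᵀ := by rw [← transpose_mul, h, transpose_mul]
  calc G * Z * b * Gᵀ * Xᵀ = G * Z * (b * Jᵀ) * Gᵀ := by
        simp only [mul_assoc, h1]
    _ = -q • (G * (Z * J) * b * Gᵀ) := by
        rw [hb]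
        simp only [Matrix.mul_smul, Matrix.smul_mul, mul_assoc]
    _ = -q • (X * (G * Z * b * Gᵀ)) := by
        rw [← hZ]
        simp only [← mul_assoc, h]

theorem commute_of_mul_transpose {X G Z b J : Matrix (Fin n) (Fin n) R} {q : R} (hq : IsUnit q)
    (hG : IsUnit G) (hbu : IsUnit b)
    (h : X * G = G * J) (hb : b * Jᵀ = -q • (J * b))
    (hB : G * Z * b * Gᵀ * Xᵀ = -q • (X * (G * Z * b * Gᵀ))) : J * Z = Z * J := by
  have h1 : Gᵀ * Xᵀ = Jᵀ * Gᵀ := by rw [← transpose_mul, h, transpose_mul]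
  have h2 : G * Z * b * Gᵀ * Xᵀ = -q • (G * (Z * J) * b * Gᵀ) := by
    calc G * Z * b * Gᵀ * Xᵀ = G * Z * (b * Jᵀ) * Gᵀ := by simp only [mul_assoc, h1]
      _ = _ := by
        rw [hb]
        simp only [Matrix.mul_smul, Matrix.smul_mul, mul_assoc]
  have h3 : -q • (X * (G * Z * b * Gᵀ)) = -q • (G * (J * Z) * b * Gᵀ) := by
    simp only [← mul_assoc, h]
  rw [h2, h3] at hB
  have h4 := hq.neg.smul_left_cancel.1 hB
  have hGt : IsUnit Gᵀ := (isUnit_transpose G).2 hG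
  exact (hG.mul_left_cancel (hbu.mul_right_cancel (hGt.mul_right_cancel h4))).symm

theorem commProj_apply_mem {R : Type*} [CommRing R] (f : Fin n ≃. Fin n) {I : Ideal R}
    {Y : Matrix (Fin n) (Fin n) R} (hY : ∀ i j, Y i j ∈ I) (i j : Fin n) :
    commProj f Y i j ∈ I := by
  have h := entry_commProj f Y (some (i, j))
  change commProj f Y i j = _ at h
  rw [h]
  cases commRep f (some (i, j)) with
  | none => exact I.zero_mem
  | some p => exact hY p.1 p.2

theorem Matrix.mul_apply_mem {I J : Ideal R} {Y W : Matrix (Fin n) (Fin n) R}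
    (hY : ∀ i j, Y i j ∈ I) (hW : ∀ i j, W i j ∈ J) (i j : Fin n) : (Y * W) i j ∈ I * J := by
  rw [Matrix.mul_apply]
  exact Ideal.sum_mem _ fun k _ => Ideal.mul_mem_mul (hY i k) (hW k j)

theorem Matrix.mul_apply_mem_of_left {I : Ideal R} {Y : Matrix (Fin n) (Fin n) R}
    (hY : ∀ i j, Y i j ∈ I) (W : Matrix (Fin n) (Fin n) R) (i j : Fin n) : (Y * W) i j ∈ I := by
  rw [Matrix.mul_apply]
  exact Ideal.sum_mem _ fun k _ => I.mul_mem_right _ (hY i k)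

theorem Matrix.mul_apply_mem_of_right {I : Ideal R} {W : Matrix (Fin n) (Fin n) R}
    (hW : ∀ i j, W i j ∈ I) (Y : Matrix (Fin n) (Fin n) R) (i j : Fin n) : (Y * W) i j ∈ I := by
  rw [Matrix.mul_apply]
  exact Ideal.sum_mem _ fun k _ => I.mul_mem_left _ (hW k j)

variable [IsLocalRing R]

theorem isUnit_of_sub_mem {P G : Matrix (Fin n) (Fin n) R} (hP : IsUnit P)
    (h : ∀ i j, (G - P) i j ∈ maximalIdeal R) : IsUnit G := by
  refine isUnit_matrix_of_residue ?_
  rw [Matrix.map_residue_eq_of_sub_mem h]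
  exact hP.map (residue R).mapMatrix

theorem paramG_sub_mem (f : Fin n ≃. Fin n) (P : Matrix (Fin n) (Fin n) R)
    {M : Matrix (Fin n) (Fin n) R} (hM : ∀ i j, M i j ∈ maximalIdeal R) (i j : Fin n) :
    (paramG f P M - P) i j ∈ maximalIdeal R := by
  rw [paramG, mul_add, mul_one, add_sub_cancel_left]
  exact Matrix.mul_apply_mem_of_right
    (fun i j => Ideal.sub_mem _ (hM i j) (commProj_apply_mem f hM i j)) P i j

theorem isUnit_paramG (f : Fin n ≃. Fin n) {P : Matrix (Fin n) (Fin n) R} (hP : IsUnit P)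
    {M : Matrix (Fin n) (Fin n) R} (hM : ∀ i j, M i j ∈ maximalIdeal R) :
    IsUnit (paramG f P M) :=
  isUnit_of_sub_mem hP (paramG_sub_mem f P hM)

theorem paramB_map_residue (f : Fin n ≃. Fin n) (P Z b : Matrix (Fin n) (Fin n) R)
    {M : Matrix (Fin n) (Fin n) R} (hM : ∀ i j, M i j ∈ maximalIdeal R) :
    (paramB f P Z b M).map (residue R) = (P * Z * b * Pᵀ).map (residue R) := by
  have h0 : M.map (residue R) = (0 : Matrix (Fin n) (Fin n) R).map (residue R) :=
    Matrix.map_residue_eq_of_sub_mem fun i j => by rw [sub_zero]; exact hM i j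
  rw [paramB_map, h0, ← paramB_map, paramB_zero]

/-- A complement of the unipotent centralizer of a nilpotent matrix in Jordan form. -/
theorem exists_commProj_mul_eq_one (f : Fin n ≃. Fin n) {Y : Matrix (Fin n) (Fin n) R}
    (hY : ∀ i j, Y i j ∈ maximalIdeal R) :
    ∃ V : Matrix (Fin n) (Fin n) R, (∀ i j, V i j ∈ maximalIdeal R) ∧ commProj f V = V ∧
      commProj f ((1 + Y) * (1 + V)) = 1 := by
  -- For `V` in the centralizer the required equation reads `Ψ V = -commProj f Y`. Since `Ψ` is the
  -- identity modulo the maximal ideal, it is surjective by Nakayama's lemma, and every solution of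
  -- this equation lies in the centralizer.
  let Ψ : Matrix (Fin n) (Fin n) R →ₗ[R] Matrix (Fin n) (Fin n) R :=
    LinearMap.id + (commProj f).comp (LinearMap.mulLeft R Y)
  have hΨ : Function.Surjective Ψ := by
    rw [← LinearMap.range_eq_top, ← top_le_iff]
    refine Submodule.le_of_le_smul_of_le_jacobson_bot (I := maximalIdeal R) Module.Finite.fg_top
      (maximalIdeal_le_jacobson _) fun V _ => ?_
    have h1 : V = Ψ V - commProj f (Y * V) := by
      change V = V + commProj f (Y * V) - commProj f (Y * V)
      rw [add_sub_cancel_right]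
    rw [h1]
    refine Submodule.sub_mem_sup ⟨V, rfl⟩ ?_
    rw [matrix_eq_sum_single (commProj f (Y * V))]
    refine Submodule.sum_mem _ fun i _ => Submodule.sum_mem _ fun j _ => ?_
    have h2 : Matrix.single i j (commProj f (Y * V) i j) =
        commProj f (Y * V) i j • Matrix.single i j (1 : R) := by
      rw [Matrix.smul_single, smul_eq_mul, mul_one]
    rw [h2]
    exact Submodule.smul_mem_smul
      (commProj_apply_mem f (Matrix.mul_apply_mem_of_left hY V) i j) trivial
  obtain ⟨V, hV⟩ := hΨ (-commProj f Y)
  have hV1 : V = -commProj f Y - commProj f (Y * V) := by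
    rw [← hV]
    exact (add_sub_cancel_right _ _).symm
  have hπ : commProj f V = V := by
    rw [hV1, map_sub, map_neg, commProj_commProj, commProj_commProj, ← hV1]
  refine ⟨V, fun i j => ?_, hπ, ?_⟩
  · rw [hV1]
    refine Ideal.sub_mem _ (neg_mem (commProj_apply_mem f hY i j))
      (commProj_apply_mem f (Matrix.mul_apply_mem_of_left hY V) i j)
  · have h3 : commProj f ((1 + Y) * (1 + V)) =
        1 + V + (commProj f Y + commProj f (Y * V)) := by
      rw [add_mul, one_mul, mul_add, mul_one, map_add, map_add, map_add, commProj_one, hπ]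
    rw [h3]
    nth_rewrite 1 [hV1]
    abel

/-- Uniqueness of the normalization: projecting the equation shows that `V = C - 1` equals
`-commProj f (W * V)`. So the ideal generated by the entries of `V` is contained in its product with
the maximal ideal, and Nakayama's lemma gives `V = 0`. -/
theorem eq_of_one_add_eq_mul [IsNoetherianRing R] (f : Fin n ≃. Fin n) {W W' C : Matrix (Fin n) (Fin n) R}
    (hW : ∀ i j, W i j ∈ maximalIdeal R) (hπ : commProj f W = 0) (hπ' : commProj f W' = 0)
    (hC : commProj f C = C) (h : 1 + W' = (1 + W) * C) : W' = W := by
  set V := C - 1 with hV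
  have hVπ : commProj f V = V := by rw [hV, map_sub, hC, commProj_one]
  have h1 : W' = W + V + W * V := by
    have : C = 1 + V := by rw [hV]; abel
    rw [this, mul_add, mul_one, add_mul, one_mul] at h
    refine add_left_cancel (a := 1) (h.trans ?_)
    abel
  have h2 : V = -commProj f (W * V) := by
    have := congrArg (commProj f) h1
    rw [map_add, map_add, hπ, hπ', hVπ, zero_add] at this
    exact eq_neg_of_add_eq_zero_left this.symm
  let I : Ideal R := Ideal.span (Set.range fun p : Fin n × Fin n => V p.1 p.2)
  have hI : ∀ i j, V i j ∈ I := fun i j => Ideal.subset_span ⟨(i, j), rfl⟩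
  have hle : I ≤ maximalIdeal R • I := by
    refine Ideal.span_le.2 ?_
    rintro _ ⟨⟨i, j⟩, rfl⟩
    change V i j ∈ _
    rw [h2]
    exact neg_mem (commProj_apply_mem f (Matrix.mul_apply_mem hW hI) i j)
  have hbot : I = ⊥ := Submodule.eq_bot_of_le_smul_of_le_jacobson_bot (maximalIdeal R) I
    (IsNoetherian.noetherian I) hle (maximalIdeal_le_jacobson _)
  have hV0 : V = 0 := by
    ext i j
    exact Ideal.mem_bot.1 (hbot ▸ hI i j)
  rw [h1, hV0, mul_zero, add_zero, add_zero]

variable {f : Fin n ≃. Fin n} {P Z b : Matrix (Fin n) (Fin n) R} {q : R}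

/-- `G` is first normalized by a factor from the centralizer, which does not disturb `X * G = G *
J`. Solving `B = G' * Z' * b * G'ᵀ` then yields a `Z'` that centralizes `J` and has the reduction of
`Z`. -/
theorem exists_param (hP : IsUnit P) (hbu : IsUnit b) (hq : IsUnit q)
    (hZ : f.toMatrix * Z = Z * f.toMatrix) (hb : b * f.toMatrixᵀ = -q • (f.toMatrix * b))
    {X B G : Matrix (Fin n) (Fin n) R}
    (hG : ∀ i j, (G - P) i j ∈ maximalIdeal R) (hX : X * G = G * f.toMatrix)
    (hB : B.map (residue R) = (P * Z * b * Pᵀ).map (residue R)) (hBX : B * Xᵀ = -q • (X * B)) :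
    ∃ M : Matrix (Fin n) (Fin n) R, (∀ i j, M i j ∈ maximalIdeal R) ∧
      X * paramG f P M = paramG f P M * f.toMatrix ∧ B = paramB f P Z b M := by
  obtain ⟨P', hP'⟩ := hP
  obtain ⟨b', rfl⟩ := hbu
  subst hP'
  set Y : Matrix (Fin n) (Fin n) R := (↑P'⁻¹ : Matrix (Fin n) (Fin n) R) * (G - P') with hYdef
  have hYm : ∀ i j, Y i j ∈ maximalIdeal R := fun i j =>
    Matrix.mul_apply_mem_of_right hG _ i j
  have hGY : G = P' * (1 + Y) := by
    rw [hYdef, mul_add, mul_one, ← mul_assoc, Units.mul_inv, one_mul, add_sub_cancel]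
  obtain ⟨V, hVm, hVπ, hYV⟩ := exists_commProj_mul_eq_one f hYm
  set W : Matrix (Fin n) (Fin n) R := (1 + Y) * (1 + V) - 1 with hW
  have hWπ : commProj f W = 0 := by rw [hW, map_sub, hYV, commProj_one, sub_self]
  have hWm : ∀ i j, W i j ∈ maximalIdeal R := fun i j => by
    have : W = Y + V + Y * V := by
      rw [hW]
      noncomm_ring
    rw [this]
    exact Ideal.add_mem _ (Ideal.add_mem _ (hYm i j) (hVm i j))
      (Matrix.mul_apply_mem_of_left hYm V i j)
  set G' : Matrix (Fin n) (Fin n) R := P' * (1 + W) with hG'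
  have hG'V : G' = G * (1 + V) := by
    rw [hG', hGY, hW, add_sub_cancel, mul_assoc]
  have hVc : f.toMatrix * (1 + V) = (1 + V) * f.toMatrix := by
    rw [mul_add, add_mul, (commProj_eq_self_iff f).1 hVπ, mul_one, one_mul]
  have hXG' : X * G' = G' * f.toMatrix := by
    rw [hG'V, ← mul_assoc, hX, mul_assoc, hVc, mul_assoc]
  have hG'm : ∀ i j, (G' - P') i j ∈ maximalIdeal R := fun i j => by
    rw [hG', mul_add, mul_one, add_sub_cancel_left]
    exact Matrix.mul_apply_mem_of_right hWm _ i j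
  have hG'u : IsUnit G' := isUnit_of_sub_mem P'.isUnit hG'm
  obtain ⟨Z', hZ'⟩ : ∃ Z' : Matrix (Fin n) (Fin n) R, B = G' * Z' * b' * G'ᵀ := by
    obtain ⟨g, hg⟩ := hG'u
    obtain ⟨g', hg'⟩ := (isUnit_transpose G').2 ⟨g, hg⟩
    refine ⟨(↑g⁻¹ : Matrix (Fin n) (Fin n) R) * B * (↑g'⁻¹ : Matrix (Fin n) (Fin n) R) *
      (↑b'⁻¹ : Matrix (Fin n) (Fin n) R), ?_⟩
    rw [← hg', ← hg]
    simp only [mul_assoc, Units.mul_inv_cancel_left, Units.inv_mul, mul_one]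
  have hZ'c : f.toMatrix * Z' = Z' * f.toMatrix :=
    commute_of_mul_transpose hq hG'u b'.isUnit hXG' hb (hZ' ▸ hBX)
  have hZm : ∀ i j, (Z' - Z) i j ∈ maximalIdeal R := by
    refine Matrix.sub_mem_of_map_residue_eq ?_
    rw [hZ'] at hB
    simp only [Matrix.map_mul, transpose_map] at hB
    rw [Matrix.map_residue_eq_of_sub_mem hG'm] at hB
    have hPu : IsUnit ((P' : Matrix (Fin n) (Fin n) R).map (residue R)) :=
      P'.isUnit.map (residue R).mapMatrix
    have hbu : IsUnit ((b' : Matrix (Fin n) (Fin n) R).map (residue R)) :=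
      b'.isUnit.map (residue R).mapMatrix
    exact hPu.mul_left_cancel (hbu.mul_right_cancel
      (((isUnit_transpose _).2 hPu).mul_right_cancel hB))
  have hzπ : commProj f (Z' - Z) = Z' - Z := by
    rw [commProj_eq_self_iff, mul_sub, sub_mul, hZ, hZ'c]
  have hMπ : commProj f (W + (Z' - Z)) = Z' - Z := by
    rw [map_add, hWπ, hzπ, zero_add]
  have hMG : paramG f (P' : Matrix (Fin n) (Fin n) R) (W + (Z' - Z)) = G' := by
    rw [paramG, hMπ, add_sub_cancel_right]
  -- The components `W` in the kernel and `Z' - Z` in the image of `commProj` are stored in one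
  -- matrix.
  refine ⟨W + (Z' - Z), fun i j => Ideal.add_mem _ (hWm i j) (hZm i j), ?_, ?_⟩
  · rw [hMG, hXG']
  · rw [paramB, hMG, hMπ, hZ']
    rw [add_sub_cancel]

/-- Two normalized transition matrices for the same `X` differ by an element of the centralizer, so
they coincide; then `Z'` is recovered from `B` by cancellation. -/
theorem param_injective [IsNoetherianRing R] (hP : IsUnit P) (hbu : IsUnit b)
    {X M M' : Matrix (Fin n) (Fin n) R}
    (hM : ∀ i j, M i j ∈ maximalIdeal R) (hM' : ∀ i j, M' i j ∈ maximalIdeal R)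
    (hX : X * paramG f P M = paramG f P M * f.toMatrix)
    (hX' : X * paramG f P M' = paramG f P M' * f.toMatrix)
    (hB : paramB f P Z b M = paramB f P Z b M') : M = M' := by
  have hGu := isUnit_paramG f hP hM
  have hGu' := isUnit_paramG f hP hM'
  obtain ⟨g, hg⟩ := hGu
  set C : Matrix (Fin n) (Fin n) R :=
    (↑g⁻¹ : Matrix (Fin n) (Fin n) R) * paramG f P M' with hC
  have hCg : paramG f P M' = paramG f P M * C := by
    rw [hC, ← mul_assoc, ← hg, Units.mul_inv, one_mul]
  have hCc : commProj f C = C := by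
    rw [commProj_eq_self_iff]
    refine g.isUnit.mul_left_cancel ?_
    rw [hg, ← mul_assoc, ← hX, mul_assoc, ← hCg, hX', hCg, mul_assoc]
  have hw : ∀ N : Matrix (Fin n) (Fin n) R, commProj f (N - commProj f N) = 0 := fun N => by
    rw [map_sub, commProj_commProj, sub_self]
  have hww : M' - commProj f M' = M - commProj f M := by
    refine eq_of_one_add_eq_mul f (C := C) (fun i j => Ideal.sub_mem _ (hM i j)
      (commProj_apply_mem f hM i j)) (hw M) (hw M') hCc (hP.mul_left_cancel ?_)
    rw [← mul_assoc]
    exact hCg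
  have hGG : paramG f P M' = paramG f P M := by rw [paramG, hww, paramG]
  rw [paramB, paramB, hGG] at hB
  have h1 := hGu'.mul_left_cancel (hGG ▸ hbu.mul_right_cancel
    (((isUnit_transpose _).2 ⟨g, hg⟩).mul_right_cancel hB))
  have h2 := add_left_cancel h1
  rw [← sub_add_cancel M (commProj f M), ← hww, h2, sub_add_cancel]

end Parametrization

/-! ### The residual normal form and matrices of constant Jordan type -/

section MinimalLiftings

open IsLocalRing Matrix

/-- The relation says that `B` intertwines `exp (-Xᵀ)` with `exp (q X)`. Intertwining passes to
logarithms and back to exponentials, so this is the same as `B` intertwining `-Xᵀ` with `q X`. -/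
theorem truncExp_pow_mul_iff {n q : ℕ} {R : Type*} [CommRing R]
    (hR : ∀ i, 0 < i → i < n → IsUnit (i : R)) (hn : 0 < n) {X B : Matrix (Fin n) (Fin n) R}
    (hX : X ^ n = 0) : truncExp X ^ q * B * (truncExp X)ᵀ = B ↔ B * Xᵀ = -(q : R) • (X * B) := by
  have hXt : Xᵀ ^ n = 0 := by rw [← transpose_pow, hX, transpose_zero]
  have hXn : (-Xᵀ) ^ n = 0 := by rw [neg_pow, hXt, mul_zero]
  have hqX : ((q : R) • X) ^ n = 0 := by rw [smul_pow, hX, smul_zero]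
  have h1 : truncExp Xᵀ * truncExp (-Xᵀ) = 1 := truncExp_mul_truncExp_neg hR hn hXt
  have h2 : truncExp (-Xᵀ) * truncExp Xᵀ = 1 := mul_eq_one_comm.1 h1
  rw [← truncExp_transpose, ← truncExp_natCast_smul hR hn hX]
  have key : B * Xᵀ = -(q : R) • (X * B) ↔ B * -Xᵀ = ((q : R) • X) * B := by
    rw [mul_neg, Matrix.smul_mul, neg_smul, neg_eq_iff_eq_neg]
  rw [key]
  constructor
  · intro h
    have h3 : B * truncExp (-Xᵀ) = truncExp ((q : R) • X) * B := by
      conv_lhs => rw [← h]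
      rw [mul_assoc, h1, mul_one]
    have h4 := mul_truncLog_of_mul_eq h3
    rwa [truncLog_truncExp hR hn hXn, truncLog_truncExp hR hn hqX] at h4
  · intro h
    rw [← mul_truncExp_of_mul_eq h, mul_assoc, h2, mul_one]

theorem jordanPEquiv_toMatrix_pow {r n : ℕ} {m : Fin r → ℕ} (e : (Σ i, Fin (m i)) ≃ Fin n)
    (R : Type*) [CommRing R] : ((jordanPEquiv m e).toMatrix : Matrix (Fin n) (Fin n) R) ^ n = 0 := by
  obtain ⟨g, hg, hg'⟩ := exists_toMatrix_eq_pow e R n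
  rw [← hg]
  ext x y
  rw [PEquiv.toMatrix_apply, Matrix.zero_apply, if_neg]
  intro h
  have h1 := ((hg' x y).1 h).2
  have h2 := (e.symm y).2.2
  have h3 : m (e.symm y).1 ≤ n := by
    simpa using Fintype.card_le_of_injective (fun a : Fin (m (e.symm y).1) => e ⟨_, a⟩)
      fun a b hab => by simpa using hab
  omega

variable {O : Type u} [CommRing O] [IsLocalRing O]

theorem isUnit_natCast_of_coprime {ℓ : ℕ} (hℓ : (ℓ : O) ∈ maximalIdeal O) {i : ℕ} (h : i.Coprime ℓ) :
    IsUnit (i : O) := by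
  by_contra hi
  have h1 : IsCoprime (i : O) (ℓ : O) := by
    have := (Nat.isCoprime_iff_coprime.2 h).map (Int.castRingHom O)
    simpa using this
  obtain ⟨a, b, hab⟩ := h1
  exact (maximalIdeal.isMaximal O).ne_top ((Ideal.eq_top_iff_one _).2 (hab ▸ Ideal.add_mem _
    (Ideal.mul_mem_left _ a hi) (Ideal.mul_mem_left _ b hℓ)))

variable {ℓ q n : ℕ} [Fact ℓ.Prime] {hq : q.Coprime ℓ}

theorem isUnit_natCast_of_lt (hℓ : (ℓ : O) ∈ maximalIdeal O) (hnℓ : n ≤ ℓ) (i : ℕ) (h0 : 0 < i)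
    (hi : i < n) : IsUnit (i : O) :=
  isUnit_natCast_of_coprime hℓ (Nat.Coprime.symm
    ((Fact.out : ℓ.Prime).coprime_iff_not_dvd.2 fun h => by
      have := Nat.le_of_dvd h0 h
      omega))

theorem isUnit_natCast_map {R S : Type*} [CommRing R] [CommRing S] (g : R →+* S)
    (h : ∀ i, 0 < i → i < n → IsUnit (i : R)) (i : ℕ) (h0 : 0 < i) (hi : i < n) :
    IsUnit (i : S) := by
  have := (h i h0 hi).map g
  rwa [map_natCast] at this

/-- A nilpotent `n × n` matrix over a field has vanishing `n`-th power. -/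
theorem Matrix.pow_eq_zero_of_isNilpotent {K : Type*} [Field K] {X : Matrix (Fin n) (Fin n) K}
    (h : IsNilpotent X) : X ^ n = 0 := by
  have h1 := (isNilpotent_charpoly_sub_pow_of_isNilpotent h).eq_zero
  rw [sub_eq_zero, Fintype.card_fin] at h1
  have h2 := aeval_self_charpoly X
  rwa [h1, map_pow, Polynomial.aeval_X] at h2

variable {rhobar : TameGroup hq →* GG n (ResidueField O)} {μ : TameGroup hq →* Oˣ}

/-- In characteristic `ℓ` one has `(A - 1) ^ ℓ ^ N = A ^ ℓ ^ N - 1`, which vanishes for large `N`.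
-/
theorem IsTameDatum.unipotent (h : IsTameDatum rhobar μ) :
    (((rhobar (TameGroup.t hq)).gl : Matrix (Fin n) (Fin n) (ResidueField O)) - 1) ^ n = 0 := by
  refine Matrix.pow_eq_zero_of_isNilpotent ?_
  obtain ⟨N, hN⟩ := h.exists_pow_eq_one
  have hℓ : ((ℓ : ℕ) : ResidueField O) = 0 := by
    rw [← map_natCast (residue O), residue_eq_zero_iff]
    exact h.natCast_mem
  have : CharP (ResidueField O) ℓ := (CharP.charP_iff_prime_eq_zero (Fact.out : ℓ.Prime)).2 hℓ
  by_cases hn : n = 0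
  · subst hn
    exact ⟨1, Subsingleton.elim _ _⟩
  have : Nonempty (Fin n) := ⟨⟨0, Nat.pos_of_ne_zero hn⟩⟩
  refine ⟨ℓ ^ N, ?_⟩
  rw [sub_pow_char_pow_of_commute ℓ N (Commute.one_right _), one_pow, sub_eq_zero]
  exact congrArg Units.val hN

/-- The matrices `P`, `Z`, `b` over `O` bring `rhobar` in normal form: `P` conjugates
`X = log (rhobar(t))` to the Jordan matrix of `f`, and `rhobar(φ)` is given by the matrix
`P Z b ᵗP`, where `Z` centralizes the Jordan matrix. -/
structure IsNormalForm (rhobar : TameGroup hq →* GG n (ResidueField O)) (f : Fin n ≃. Fin n)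
    (P Z b : Matrix (Fin n) (Fin n) O) : Prop where
  pos : 0 < n
  isUnit_natCast : ∀ i, 0 < i → i < n → IsUnit (i : O)
  isUnit_q : IsUnit (q : O)
  isUnit_P : IsUnit P
  isUnit_b : IsUnit b
  pow_eq_zero : (f.toMatrix : Matrix (Fin n) (Fin n) O) ^ n = 0
  comm : f.toMatrix * Z = Z * f.toMatrix
  dual : b * f.toMatrixᵀ = -(q : O) • (f.toMatrix * b)
  unipotent : (((rhobar (TameGroup.t hq)).gl : Matrix (Fin n) (Fin n) (ResidueField O)) - 1) ^ n = 0
  conj : truncLog ((rhobar (TameGroup.t hq)).gl : Matrix (Fin n) (Fin n) (ResidueField O)) *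
    P.map (residue O) = P.map (residue O) * f.toMatrix
  polarization : ((rhobar (TameGroup.phi hq)).gl : Matrix (Fin n) (Fin n) (ResidueField O)) =
    (P * Z * b * Pᵀ).map (residue O)
  jordan : ∃ (r : ℕ) (m : Fin r → ℕ) (e : (Σ i, Fin (m i)) ≃ Fin n) (p : n.Partition),
    f = jordanPEquiv m e ∧ Multiset.ofList (List.ofFn m) = p.parts ∧
    HasJordanType p (truncLog ((rhobar (TameGroup.t hq)).gl :
      Matrix (Fin n) (Fin n) (ResidueField O)))

/-- Over `k`, the relation forces the matrix `Zbar` defined by `B = P * Zbar * b * Pᵀ` to commute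
with `J`. An arbitrary lift of `Zbar` is moved into the centralizer over `O` by `commProj`, which
leaves the reduction unchanged; `P` may be lifted freely. -/
theorem IsTameDatum.exists_isNormalForm (h : IsTameDatum rhobar μ) (hn : 0 < n) (hnℓ : n ≤ ℓ) :
    ∃ f P Z b, IsNormalForm rhobar f P Z b := by
  set A := ((rhobar (TameGroup.t hq)).gl : Matrix (Fin n) (Fin n) (ResidueField O)) with hA
  set B := ((rhobar (TameGroup.phi hq)).gl : Matrix (Fin n) (Fin n) (ResidueField O)) with hB
  have hunits := isUnit_natCast_of_lt h.natCast_mem hnℓ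
  have hunits' := isUnit_natCast_map (residue O) hunits
  have hq' := isUnit_natCast_of_coprime h.natCast_mem hq
  have hX : truncLog A ^ n = 0 := truncLog_pow h.unipotent
  obtain ⟨p, hp⟩ := exists_hasJordanType (truncLog A) ⟨n, hX⟩
  obtain ⟨r, m, e, Pbar, hm, hPbar, hXP⟩ := hasJordanType_iff.1 hp
  set f := jordanPEquiv m e with hf
  obtain ⟨τ, d, hτ, h1, h2⟩ := exists_dual_jordanPEquiv e
  obtain ⟨P, rfl⟩ := Matrix.exists_map_residue_eq Pbar
  have hP : IsUnit P := isUnit_matrix_of_residue hPbar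
  have hdual := fun (R : Type u) [CommRing R] (c : R) => scaledPerm_mul_transpose hτ h1 h2 c
  set b : Matrix (Fin n) (Fin n) O := scaledPerm τ d (-(q : O)) with hb
  have hbu : IsUnit b := isUnit_scaledPerm τ d hq'.neg
  have hbmap : b.map (residue O) = scaledPerm τ d (-(q : ResidueField O)) := by
    rw [hb, scaledPerm_map, map_neg, map_natCast]
  have hbu' : IsUnit (b.map (residue O)) := hbu.map (residue O).mapMatrix
  have hrel : B * (truncLog A)ᵀ = -(q : ResidueField O) • (truncLog A * B) := by
    refine (truncExp_pow_mul_iff hunits' hn hX).1 ?_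
    rw [truncExp_truncLog hunits' hn h.unipotent]
    exact h.relation_matrix
  obtain ⟨Zbar, hZbar⟩ : ∃ Zbar, B = P.map (residue O) * Zbar * b.map (residue O) *
      (P.map (residue O))ᵀ := by
    obtain ⟨g, hg⟩ := hPbar
    obtain ⟨g', hg'⟩ := (isUnit_transpose (P.map (residue O))).2 ⟨g, hg⟩
    obtain ⟨b', hb'⟩ := hbu'
    refine ⟨(↑g⁻¹ : Matrix (Fin n) (Fin n) (ResidueField O)) * B *
      (↑g'⁻¹ : Matrix (Fin n) (Fin n) (ResidueField O)) *
      (↑b'⁻¹ : Matrix (Fin n) (Fin n) (ResidueField O)), ?_⟩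
    rw [← hg', ← hg, ← hb']
    simp only [mul_assoc, Units.mul_inv_cancel_left, Units.inv_mul, mul_one]
  have hZc : f.toMatrix * Zbar = Zbar * f.toMatrix := by
    refine commute_of_mul_transpose (hq'.map (residue O)) hPbar hbu' hXP ?_ ?_
    · rw [hbmap, map_natCast]
      exact hdual _ _
    · rw [map_natCast, ← hZbar]
      exact hrel
  obtain ⟨Z', hZ'⟩ := Matrix.exists_map_residue_eq Zbar
  refine ⟨f, P, commProj f Z', b, hn, hunits, hq', hP, hbu, ?_, commProj_commute f Z', hdual _ _,
    h.unipotent, hXP, ?_, r, m, e, p, rfl, hm, hp⟩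
  · exact jordanPEquiv_toMatrix_pow e O
  · rw [Matrix.map_mul, Matrix.map_mul, Matrix.map_mul, transpose_map, commProj_map, hZ',
      (commProj_eq_self_iff f).2 hZc]
    exact hZbar

namespace IsNormalForm

variable {f : Fin n ≃. Fin n} {P Z b : Matrix (Fin n) (Fin n) O}

theorem isUnit_map (hN : IsNormalForm rhobar f P Z b) (R : CompleteLocalAlg O) :
    IsUnit (P.map (algebraMap O R)) ∧ IsUnit (b.map (algebraMap O R)) :=
  ⟨hN.isUnit_P.map (algebraMap O R).mapMatrix, hN.isUnit_b.map (algebraMap O R).mapMatrix⟩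

theorem toMatrix_pow (hN : IsNormalForm rhobar f P Z b) (R : CompleteLocalAlg O) :
    (f.toMatrix : Matrix (Fin n) (Fin n) R) ^ n = 0 := by
  have := congrArg (fun M => M.map (algebraMap O R)) hN.pow_eq_zero
  rwa [Matrix.map_pow, PEquiv.map_toMatrix, Matrix.map_zero _ (map_zero _)] at this

theorem comm_map (hN : IsNormalForm rhobar f P Z b) (R : CompleteLocalAlg O) :
    f.toMatrix * Z.map (algebraMap O R) = Z.map (algebraMap O R) * f.toMatrix := by
  have := congrArg (fun M => M.map (algebraMap O R)) hN.comm
  rwa [Matrix.map_mul, Matrix.map_mul, PEquiv.map_toMatrix] at this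

theorem dual_map (hN : IsNormalForm rhobar f P Z b) (R : CompleteLocalAlg O) :
    b.map (algebraMap O R) * f.toMatrixᵀ = -(q : R) • (f.toMatrix * b.map (algebraMap O R)) := by
  have := congrArg (fun M => M.map (algebraMap O R)) hN.dual
  rw [Matrix.map_mul, transpose_map, PEquiv.map_toMatrix,
    Matrix.map_smul' _ _ _ (map_mul _), Matrix.map_mul, PEquiv.map_toMatrix] at this
  simpa using this

theorem conj_map (hN : IsNormalForm rhobar f P Z b) (R : CompleteLocalAlg O) :
    (truncLog ((rhobar (TameGroup.t hq)).gl : Matrix (Fin n) (Fin n) (ResidueField O))).map R.resMap *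
      (P.map (algebraMap O R)).map (residue R) =
      (P.map (algebraMap O R)).map (residue R) * f.toMatrix := by
  have := congrArg (fun M => M.map R.resMap) hN.conj
  rwa [Matrix.map_mul, Matrix.map_mul, PEquiv.map_toMatrix] at this

theorem polarization_map (hN : IsNormalForm rhobar f P Z b) (R : CompleteLocalAlg O) :
    ((rhobar (TameGroup.phi hq)).gl : Matrix (Fin n) (Fin n) (ResidueField O)).map R.resMap =
      (P.map (algebraMap O R) * Z.map (algebraMap O R) * b.map (algebraMap O R) *
        (P.map (algebraMap O R))ᵀ).map (residue R) := by
  rw [hN.polarization, ← transpose_map, ← Matrix.map_mul, ← Matrix.map_mul, ← Matrix.map_mul]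
  rfl

theorem isUnit_natCast_alg (hN : IsNormalForm rhobar f P Z b) (R : CompleteLocalAlg O) :
    ∀ i, 0 < i → i < n → IsUnit (i : R) :=
  isUnit_natCast_map (algebraMap O R) hN.isUnit_natCast

variable {E : Type*} [Field E] [Algebra O E]

/-- A matrix of the same Jordan type as its reduction is conjugate to a Jordan matrix. -/
theorem exists_conj_of_mem_nilFunctor [IsDomain O] [IsPrincipalIdealRing O] [IsFractionRing O E]
    (hN : IsNormalForm rhobar f P Z b) {R : CompleteLocalAlg O} {X : Matrix (Fin n) (Fin n) R}
    (hX : X ∈ nilFunctor E (truncLog ((rhobar (TameGroup.t hq)).gl : Matrix _ _ (ResidueField O))) R) :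
    ∃ G : Matrix (Fin n) (Fin n) R, (∀ i j, (G - P.map (algebraMap O R)) i j ∈ maximalIdeal R) ∧
      X * G = G * f.toMatrix := by
  obtain ⟨-, hXred, X₀, C, -, ⟨p', hp'E, hp'⟩, hXC⟩ := hX
  obtain ⟨r, m, e, p, hf, hm, hp⟩ := hN.jordan
  obtain rfl := hp'.unique hp
  have hXC' : X * C = C * X₀.map (algebraMap O R) := by
    rw [hXC, mul_assoc, Units.inv_mul, mul_one]
  have hE : ∃ Q : Matrix (Fin n) (Fin n) E, IsUnit Q ∧
      X₀.map (algebraMap O E) * Q = Q * f.toMatrix := by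
    obtain ⟨r₁, m₁, e₁, P₁, hm₁, hP₁, hXP₁⟩ := hasJordanType_iff.1 hp'E
    obtain ⟨Q, hQ, hQJ⟩ := exists_conj_jordan e₁ e (hm₁.trans hm.symm) E
    exact ⟨P₁ * Q, hP₁.mul hQ, by rw [← mul_assoc, hXP₁, mul_assoc, hQJ, hf, mul_assoc]⟩
  -- The reduction of `C` conjugates the reduction of `X₀` to the logarithm of `rhobar(t)`, so `X₀`
  -- has the same Jordan type over `k` as over `E`.
  have hk : ∃ Q : Matrix (Fin n) (Fin n) (ResidueField O), IsUnit Q ∧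
      X₀.map (residue O) * Q = Q * f.toMatrix := by
    let ε := RingEquiv.ofBijective R.resMap R.residue_bijective
    let C' : Matrix (Fin n) (Fin n) (ResidueField O) :=
      ε.symm.mapMatrix ((residue R).mapMatrix (C : Matrix (Fin n) (Fin n) R))
    have hC'u : IsUnit C' := (C.isUnit.map (residue R).mapMatrix).map ε.symm.mapMatrix
    have hC' : C'.map R.resMap = (C : Matrix (Fin n) (Fin n) R).map (residue R) :=
      Matrix.ext fun i j => ε.apply_symm_apply _
    have hinj : Function.Injective fun M : Matrix (Fin n) (Fin n) (ResidueField O) =>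
        M.map R.resMap := Matrix.map_injective R.residue_bijective.1
    have h1 : truncLog ((rhobar (TameGroup.t hq)).gl : Matrix (Fin n) (Fin n) (ResidueField O)) * C' =
        C' * X₀.map (residue O) := by
      refine hinj ?_
      have h2 := congrArg (fun M => M.map (residue R)) hXC'
      rw [Matrix.map_mul, Matrix.map_mul, hXred] at h2
      change (_ * _ : Matrix _ _ _).map _ = (_ * _ : Matrix _ _ _).map _
      rw [Matrix.map_mul, Matrix.map_mul, hC', h2]
      rfl
    obtain ⟨c, hc⟩ := hC'u
    refine ⟨(↑c⁻¹ : Matrix (Fin n) (Fin n) (ResidueField O)) * P.map (residue O),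
      c⁻¹.isUnit.mul (hN.isUnit_P.map (residue O).mapMatrix), ?_⟩
    rw [← hc] at h1
    rw [mul_assoc, ← hN.conj, ← mul_assoc, ← mul_assoc]
    congr 1
    rw [Units.eq_inv_mul_iff_mul_eq, ← mul_assoc, ← h1, mul_assoc, Units.mul_inv, mul_one]
  obtain ⟨Q, hQ, hXQ⟩ := exists_conj_of_generic_special f X₀ hE hk
  set G₁ : Matrix (Fin n) (Fin n) R := C * Q.map (algebraMap O R) with hG₁
  have hG₁u : IsUnit G₁ := C.isUnit.mul (hQ.map (algebraMap O R).mapMatrix)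
  have hXG₁ : X * G₁ = G₁ * f.toMatrix := by
    have h1 := congrArg (fun M => M.map (algebraMap O R)) hXQ
    rw [Matrix.map_mul, Matrix.map_mul, PEquiv.map_toMatrix] at h1
    rw [hG₁, ← mul_assoc, hXC', mul_assoc, h1, mul_assoc]
  clear_value G₁
  obtain ⟨g, hg⟩ : IsUnit (G₁.map (residue R)) := hG₁u.map (residue R).mapMatrix
  -- Both `G₁` and `P` conjugate the reduction of `X` to `J`, so they differ there by an element of
  -- the centralizer. It is lifted through `commProj`, and multiplying `G₁` by the lift makes it
  -- congruent to `P`.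
  obtain ⟨D, hD⟩ := Matrix.exists_map_residue_eq
    ((↑g⁻¹ : Matrix (Fin n) (Fin n) (ResidueField R)) * (P.map (algebraMap O R)).map (residue R))
  have hDc : f.toMatrix * D.map (residue R) = D.map (residue R) * f.toMatrix := by
    have h1 := congrArg (fun M => M.map (residue R)) hXG₁
    rw [Matrix.map_mul, Matrix.map_mul, PEquiv.map_toMatrix, hXred, ← hg] at h1
    rw [hD, mul_assoc, ← hN.conj_map, ← mul_assoc, ← mul_assoc]
    congr 1
    rw [Units.eq_inv_mul_iff_mul_eq, ← mul_assoc, ← h1, mul_assoc, Units.mul_inv, mul_one]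
  refine ⟨G₁ * commProj f D, Matrix.sub_mem_of_map_residue_eq ?_, ?_⟩
  · rw [Matrix.map_mul, commProj_map, (commProj_eq_self_iff f).2 hDc, hD, ← hg, ← mul_assoc,
      Units.mul_inv, one_mul]
  · rw [← mul_assoc, hXG₁, mul_assoc, commProj_commute, mul_assoc]

end IsNormalForm

end MinimalLiftings

/-! ### The deformation problem of minimally ramified liftings -/

section MinimalDeformationProblem

open IsLocalRing Matrix

variable {O : Type u} [CommRing O] [IsLocalRing O]

theorem IsLifting.conj {Γ : Type} [Group Γ] [TopologicalSpace Γ] {n : ℕ}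
    {rbar : Γ →* GG n (ResidueField O)} {χ : Γ →* Oˣ} {R : CompleteLocalAlg O} {r : Γ →* GG n R}
    (h : IsLifting rbar χ R r) (x : GL (Fin n) R)
    (hx : ∀ i j, ((x : Matrix (Fin n) (Fin n) R) - 1) i j ∈ maximalIdeal R) :
    IsLifting rbar χ R ((MulAut.conj (GG.ofGL x)).toMonoidHom.comp r) where
  continuous := by
    let : TopologicalSpace R := (maximalIdeal R).adicTopology
    have : IsTopologicalRing R := isTopologicalRing_adic
    have h1 : Continuous r := h.continuous
    change Continuous fun g => GG.ofGL x * r g * (GG.ofGL x)⁻¹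
    exact (continuous_const.mul h1).mul continuous_const
  reduction g := by
    change GG.map (residue R) (GG.ofGL x * r g * (GG.ofGL x)⁻¹) = _
    have h1 : GeneralLinearGroup.map (residue R) x = 1 := by
      refine Units.ext ((Matrix.map_residue_eq_of_sub_mem hx).trans ?_)
      exact Matrix.map_one _ (map_zero _) (map_one _)
    rw [map_mul, map_mul, map_inv, GG.map_ofGL, h1, map_one, one_mul, inv_one, mul_one, h.reduction]
  similitude g := by
    change GG.nu (GG.ofGL x * r g * (GG.ofGL x)⁻¹) = _
    rw [map_mul, map_mul, map_inv, mul_comm, inv_mul_cancel_left, h.similitude]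

variable {ℓ q n : ℕ} [Fact ℓ.Prime] {hq : q.Coprime ℓ}
  {rhobar : TameGroup hq →* GG n (ResidueField O)} {μ : TameGroup hq →* Oˣ}
  {E : Type*} [Field E] [Algebra O E]

theorem nilFunctor_conj {Xbar : Matrix (Fin n) (Fin n) (ResidueField O)} {R : CompleteLocalAlg O}
    {X : Matrix (Fin n) (Fin n) R} (hX : X ∈ nilFunctor E Xbar R) (x : GL (Fin n) R)
    (hx : ∀ i j, ((x : Matrix (Fin n) (Fin n) R) - 1) i j ∈ maximalIdeal R) :
    (x : Matrix (Fin n) (Fin n) R) * X * (↑x⁻¹ : Matrix (Fin n) (Fin n) R) ∈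
      nilFunctor E Xbar R := by
  obtain ⟨hXn, hXbar, X₀, C, hX₀, hp, rfl⟩ := hX
  refine ⟨isNilpotent_of_mul_eq x.isUnit hXn (by rw [mul_assoc, Units.inv_mul, mul_one]), ?_,
    X₀, x * C, hX₀, hp, ?_⟩
  · have h1 : GeneralLinearGroup.map (residue R) x = 1 := by
      refine Units.ext ((Matrix.map_residue_eq_of_sub_mem hx).trans ?_)
      exact Matrix.map_one _ (map_zero _) (map_one _)
    have h2 : (x : Matrix (Fin n) (Fin n) R).map (residue R) = 1 := congrArg Units.val h1
    have h3 : (↑x⁻¹ : Matrix (Fin n) (Fin n) R).map (residue R) = 1 := by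
      have := congrArg Units.val (congrArg Inv.inv h1)
      rw [← map_inv, inv_one] at this
      exact this
    rw [Matrix.map_mul, Matrix.map_mul, h2, h3, hXbar, one_mul, mul_one]
  · simp only [Units.val_mul, _root_.mul_inv_rev, mul_assoc]

theorem IsMinimallyRamified.conj (h : IsTameDatum rhobar μ) {R : CompleteLocalAlg O}
    {ρ : TameGroup hq →* GG n R} (hρ : IsLifting rhobar μ R ρ)
    (hmin : IsMinimallyRamified E rhobar R ρ) (x : GL (Fin n) R)
    (hx : ∀ i j, ((x : Matrix (Fin n) (Fin n) R) - 1) i j ∈ maximalIdeal R) :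
    IsMinimallyRamified E rhobar R ((MulAut.conj (GG.ofGL x)).toMonoidHom.comp ρ) := by
  obtain ⟨X, hX, hA⟩ := hmin
  refine ⟨_, nilFunctor_conj hX x hx, ?_⟩
  have h1 : (((MulAut.conj (GG.ofGL x)).toMonoidHom.comp ρ) (TameGroup.t hq)).gl =
      x * (ρ (TameGroup.t hq)).gl * x⁻¹ := by
    change (GG.ofGL x * ρ (TameGroup.t hq) * (GG.ofGL x)⁻¹).gl = _
    rw [hρ.map_t_eq h, ← map_mul, ← map_inv, ← map_mul, GG.gl_ofGL, GG.gl_ofGL]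
  rw [h1, Units.val_mul, Units.val_mul, hA, mul_truncExp_of_mul_eq
    (Z := (x : Matrix (Fin n) (Fin n) R) * X * (↑x⁻¹ : Matrix (Fin n) (Fin n) R)), mul_assoc,
    Units.mul_inv, mul_one]
  rw [mul_assoc, Units.inv_mul, mul_one]

namespace IsNormalForm

variable {f : Fin n ≃. Fin n} {P Z b : Matrix (Fin n) (Fin n) O}

/-- The matrix `M` is the coordinate of the minimally ramified lifting `ρ`. -/
structure IsParam (f : Fin n ≃. Fin n) (P Z b : Matrix (Fin n) (Fin n) O) {R : CompleteLocalAlg O}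
    (ρ : TameGroup hq →* GG n R) (M : Matrix (Fin n) (Fin n) R) : Prop where
  mem : ∀ i j, M i j ∈ maximalIdeal R
  unipotent : (((ρ (TameGroup.t hq)).gl : Matrix (Fin n) (Fin n) R) - 1) ^ n = 0
  conj : truncLog ((ρ (TameGroup.t hq)).gl : Matrix (Fin n) (Fin n) R) *
    paramG f (P.map (algebraMap O R)) M = paramG f (P.map (algebraMap O R)) M * f.toMatrix
  polarization : ((ρ (TameGroup.phi hq)).gl : Matrix (Fin n) (Fin n) R) =
    paramB f (P.map (algebraMap O R)) (Z.map (algebraMap O R)) (b.map (algebraMap O R)) M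

variable {R : CompleteLocalAlg O} {ρ ρ' : TameGroup hq →* GG n R} {M M' : Matrix (Fin n) (Fin n) R}

theorem exists_isParam [IsDomain O] [IsPrincipalIdealRing O] [IsFractionRing O E]
    (hN : IsNormalForm rhobar f P Z b) (h : IsTameDatum rhobar μ)
    (hρ : IsLifting rhobar μ R ρ) (hmin : IsMinimallyRamified E rhobar R ρ) :
    ∃ M, IsParam f P Z b ρ M := by
  obtain ⟨X, hX, hA⟩ := hmin
  have hR := hN.isUnit_natCast_alg R
  have hXA : truncLog ((ρ (TameGroup.t hq)).gl : Matrix (Fin n) (Fin n) R) = X := by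
    rw [hA, truncLog_truncExp hR hN.pos hX.1]
  obtain ⟨G, hG, hXG⟩ := hN.exists_conj_of_mem_nilFunctor hX
  have hrel := hρ.relation_matrix h
  rw [hA, truncExp_pow_mul_iff hR hN.pos hX.1] at hrel
  obtain ⟨M, hM, hXM, hB⟩ := exists_param (hN.isUnit_map R).1 (hN.isUnit_map R).2
    (by simpa using hN.isUnit_q.map (algebraMap O R)) (hN.comm_map R) (hN.dual_map R) hG hXG
    ((hρ.map_residue _).trans (hN.polarization_map R)) hrel
  refine ⟨M, hM, ?_, by rw [hXA, hXM], hB⟩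
  rw [hA]
  exact truncExp_sub_one_pow hN.pos hX.1

theorem exists_isLifting_of_param [Finite (ResidueField O)]
    (hN : IsNormalForm rhobar f P Z b) (h : IsTameDatum rhobar μ)
    (hM : ∀ i j, M i j ∈ maximalIdeal R) :
    ∃ ρ, IsLifting rhobar μ R ρ ∧ IsMinimallyRamified E rhobar R ρ ∧ IsParam f P Z b ρ M := by
  have hR := hN.isUnit_natCast_alg R
  have hk := isUnit_natCast_map (residue O) hN.isUnit_natCast
  have hGu := isUnit_paramG f (hN.isUnit_map R).1 hM
  obtain ⟨G, hG⟩ : ∃ G : GL (Fin n) R, (G : Matrix (Fin n) (Fin n) R) =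
    paramG f (P.map (algebraMap O R)) M := hGu
  obtain ⟨X, hX⟩ : ∃ X : Matrix (Fin n) (Fin n) R, X = (G : Matrix (Fin n) (Fin n) R) *
    f.toMatrix * (↑G⁻¹ : Matrix (Fin n) (Fin n) R) := ⟨_, rfl⟩
  have hXG : X * (G : Matrix (Fin n) (Fin n) R) =
      (G : Matrix (Fin n) (Fin n) R) * f.toMatrix := by
    rw [hX, mul_assoc, Units.inv_mul, mul_one]
  have hXn : X ^ n = 0 := isNilpotent_of_mul_eq G.isUnit (hN.toMatrix_pow R) hXG
  have hXred : X.map (residue R) = (truncLog ((rhobar (TameGroup.t hq)).gl :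
      Matrix (Fin n) (Fin n) (ResidueField O))).map R.resMap := by
    have h1 := congrArg (fun Y : Matrix (Fin n) (Fin n) R => Y.map (residue R)) hXG
    have h2 : (G : Matrix (Fin n) (Fin n) R).map (residue R) =
        (P.map (algebraMap O R)).map (residue R) := by
      rw [hG]
      exact Matrix.map_residue_eq_of_sub_mem (paramG_sub_mem f _ hM)
    rw [Matrix.map_mul, Matrix.map_mul, PEquiv.map_toMatrix, h2, ← hN.conj_map] at h1
    exact ((hN.isUnit_map R).1.map (residue R).mapMatrix).mul_right_cancel h1
  have hnil : X ∈ nilFunctor E (truncLog ((rhobar (TameGroup.t hq)).gl :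
      Matrix (Fin n) (Fin n) (ResidueField O))) R := by
    obtain ⟨r, m, e, p, hf, hm, hp⟩ := hN.jordan
    -- The Jordan matrix itself, over `O`, serves as the model `X₀`.
    refine ⟨hXn, hXred, f.toMatrix, G, hN.pow_eq_zero, ⟨p, ?_, hp⟩, ?_⟩
    · rw [PEquiv.map_toMatrix]
      exact hasJordanType_iff.2 ⟨r, m, e, 1, hm, isUnit_one, by rw [hf, mul_one, one_mul]⟩
    · rw [PEquiv.map_toMatrix, hX]
  obtain ⟨ρ, hρ, hρt, hρp⟩ := h.exists_isLifting_matrix R (truncExp X)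
    (paramB f (P.map (algebraMap O R)) (Z.map (algebraMap O R)) (b.map (algebraMap O R)) M)
    ((truncExp_pow_mul_iff hR hN.pos hXn).2 (mul_transpose_of_commute (hG ▸ hXG) (by
        rw [mul_add, add_mul, hN.comm_map, commProj_commute]) (hN.dual_map R)))
    (by rw [truncExp_map _ hR, hXred, ← truncExp_map _ hk, truncExp_truncLog hk hN.pos hN.unipotent])
    (by rw [paramB_map_residue f _ _ _ hM, hN.polarization_map])
  refine ⟨ρ, hρ, ⟨X, hnil, hρt⟩, hM, ?_, ?_, hρp⟩
  · rw [hρt]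
    exact truncExp_sub_one_pow hN.pos hXn
  · rw [hρt, truncLog_truncExp hR hN.pos hXn, ← hG, hXG]

namespace IsParam

theorem unique (hN : IsNormalForm rhobar f P Z b) (hM : IsParam f P Z b ρ M)
    (hM' : IsParam f P Z b ρ M') : M = M' :=
  param_injective (hN.isUnit_map R).1 (hN.isUnit_map R).2 hM.mem hM'.mem hM.conj hM'.conj
    (hM.polarization.symm.trans hM'.polarization)

theorem lifting_eq (hN : IsNormalForm rhobar f P Z b) (h : IsTameDatum rhobar μ)
    (hρ : IsLifting rhobar μ R ρ) (hρ' : IsLifting rhobar μ R ρ') (hM : IsParam f P Z b ρ M)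
    (hM' : IsParam f P Z b ρ' M) : ρ = ρ' := by
  have hR := hN.isUnit_natCast_alg R
  refine hρ.ext hρ' h (Units.ext ?_) (Units.ext (hM.polarization.trans hM'.polarization.symm))
  rw [← truncExp_truncLog hR hN.pos hM.unipotent, ← truncExp_truncLog hR hN.pos hM'.unipotent]
  congr 1
  exact (isUnit_paramG f (hN.isUnit_map R).1 hM.mem).mul_right_cancel
    (hM.conj.trans hM'.conj.symm)

theorem map (hN : IsNormalForm rhobar f P Z b) {S : CompleteLocalAlg O} (g : R →ₐ[O] S)
    (hM : IsParam f P Z b ρ M) : IsParam f P Z b ((GG.map g.toRingHom).comp ρ) (M.map g) := by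
  have hR := hN.isUnit_natCast_alg R
  have hgl : ∀ s, ((((GG.map g.toRingHom).comp ρ) s).gl : Matrix (Fin n) (Fin n) S) =
      ((ρ s).gl : Matrix (Fin n) (Fin n) R).map g.toRingHom := fun s => rfl
  have halg : ∀ Y : Matrix (Fin n) (Fin n) O,
      (Y.map (algebraMap O R)).map g.toRingHom = Y.map (algebraMap O S) := fun Y =>
    Matrix.ext fun i j => g.commutes _
  refine ⟨fun i j => R.map_mem S g (hM.mem i j), ?_, ?_, ?_⟩
  · have := congrArg (fun Y : Matrix (Fin n) (Fin n) R => Y.map g.toRingHom) hM.unipotent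
    rwa [Matrix.map_pow, Matrix.map_sub _ (map_sub _), Matrix.map_one _ (map_zero _) (map_one _),
      Matrix.map_zero _ (map_zero _)] at this
  · have := congrArg (fun Y : Matrix (Fin n) (Fin n) R => Y.map g.toRingHom) hM.conj
    rw [Matrix.map_mul, Matrix.map_mul, paramG_map, truncLog_map _ hR, halg,
      PEquiv.map_toMatrix] at this
    exact this
  · have := congrArg (fun Y : Matrix (Fin n) (Fin n) R => Y.map g.toRingHom) hM.polarization
    rw [paramB_map, halg, halg, halg] at this
    exact this

end IsParam

end IsNormalForm

/-- The ring `S`, with coordinates `x`, represents the minimally ramified liftings. -/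
theorem IsNormalForm.exists_universal [IsDomain O] [IsPrincipalIdealRing O]
    [IsAdicComplete (maximalIdeal O) O] [Finite (ResidueField O)] [IsFractionRing O E]
    {f : Fin n ≃. Fin n} {P Z b : Matrix (Fin n) (Fin n) O}
    (hN : IsNormalForm rhobar f P Z b) (h : IsTameDatum rhobar μ) (U : UniversalLifting rhobar μ) :
    ∃ (S : CompleteLocalAlg O) (x : Fin (n * n) → S) (φ : U.ring →ₐ[O] S),
      IsFormalAffineSpace (n * n) S x ∧ Function.Surjective φ ∧
      ∀ (R : CompleteLocalAlg O) (ρ : TameGroup hq →* GG n R),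
        (IsLifting rhobar μ R ρ ∧ IsMinimallyRamified E rhobar R ρ) ↔
        ∃ g : S →ₐ[O] R, ∀ s, GG.map (g.comp φ).toRingHom (U.lift s) = ρ s := by
  obtain ⟨S, x, hS⟩ := exists_isFormalAffineSpace O (n * n)
  let e : Fin n × Fin n ≃ Fin (n * n) := finProdFinEquiv
  -- The generic parameter; the lifting that it defines is the universal minimally ramified one.
  let M : Matrix (Fin n) (Fin n) S := Matrix.of fun i j => x (e (i, j))
  obtain ⟨ρ₀, hρ₀, -, hρ₀M⟩ := hN.exists_isLifting_of_param (E := E) h (R := S) (M := M)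
    fun i j => hS.mem _
  obtain ⟨φ, hφ, -⟩ := U.universal S ρ₀ hρ₀
  have hφ' : (GG.map φ.toRingHom).comp U.lift = ρ₀ := MonoidHom.ext hφ
  have hcomp : ∀ (R : CompleteLocalAlg O) (g : S →ₐ[O] R) (s : TameGroup hq),
      GG.map (g.comp φ).toRingHom (U.lift s) = ((GG.map g.toRingHom).comp ρ₀) s := by
    intro R g s
    rw [← hφ', MonoidHom.comp_apply, MonoidHom.comp_apply, GG.map_map]
    rfl
  -- Surjectivity of `φ`: homomorphisms from `S` that agree on `U.ring` give the same lifting, hence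
  -- the same parameter, hence agree on the coordinates.
  refine ⟨S, x, φ, hS, U.ring.surjective_of_separates S φ fun Q g₁ g₂ hg => ?_, fun R ρ => ?_⟩
  · have h1 : (GG.map g₁.toRingHom).comp ρ₀ = (GG.map g₂.toRingHom).comp ρ₀ :=
      MonoidHom.ext fun s => by rw [← hcomp, ← hcomp, hg]
    have h2 := (h1 ▸ hρ₀M.map hN g₁).unique hN (hρ₀M.map hN g₂)
    refine hS.algHom_ext Q _ _ fun m => ?_
    obtain ⟨⟨i, j⟩, rfl⟩ := e.surjective m
    exact congrFun (congrFun h2 i) j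
  · constructor
    · rintro ⟨hρ, hmin⟩
      obtain ⟨M', hM'⟩ := hN.exists_isParam h hρ hmin
      obtain ⟨g, hg⟩ := hS.exists_algHom R (fun m => M' (e.symm m).1 (e.symm m).2)
        fun m => hM'.mem _ _
      have hgM : M.map g = M' := Matrix.ext fun i j => by
        change g (x (e (i, j))) = _
        rw [hg, e.symm_apply_apply]
      refine ⟨g, fun s => ?_⟩
      have h1 := hρ₀M.map hN g
      rw [hgM] at h1
      rw [hcomp, h1.lifting_eq hN h (hρ₀.map g) hρ hM']
    · rintro ⟨g, hg⟩
      have hρ : (GG.map g.toRingHom).comp ρ₀ = ρ := MonoidHom.ext fun s => by rw [← hcomp, hg]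
      subst hρ
      -- Minimal ramification is stable under base change: the parameter `M.map g` also belongs to a
      -- minimally ramified lifting, and a lifting is determined by its parameter.
      obtain ⟨ρ', hρ', hmin, hM'⟩ := hN.exists_isLifting_of_param (E := E) h
        (hρ₀M.map hN g).mem
      rw [(hρ₀M.map hN g).lifting_eq hN h (hρ₀.map g) hρ' hM']
      exact ⟨hρ', hmin⟩

theorem HasPureDimension.of_isDomain {A : Type*} [CommRing A] [IsDomain A] {d : ℕ}
    (h : ringKrullDim A = d) : HasPureDimension A d := by
  refine ⟨h, fun p hp => ?_⟩
  rw [IsDomain.minimalPrimes_eq_singleton_bot, Set.mem_singleton_iff] at hp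
  subst hp
  exact (ringKrullDim_eq_of_ringEquiv (RingEquiv.quotientBot A)).trans h

theorem HasPureDimension.of_ringEquiv {A B : Type*} [CommRing A] [CommRing B] [IsDomain A] {d : ℕ}
    (e : A ≃+* B) (h : ringKrullDim A = d) : HasPureDimension B d := by
  have := e.symm.toMulEquiv.isDomain
  exact HasPureDimension.of_isDomain ((ringKrullDim_eq_of_ringEquiv e.symm).trans h)

theorem IsFormalAffineSpace.isFormallySmooth {N : ℕ} {S : CompleteLocalAlg O} {x : Fin N → S}
    (hS : IsFormalAffineSpace N S x) {U : UniversalLifting rhobar μ}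
    (D : LocalDeformationProblem U) {φ : U.ring →ₐ[O] S} (hφ : Function.Surjective φ)
    (hker : D.ideal = RingHom.ker φ) : D.IsFormallySmooth N := by
  let e : (U.ring ⧸ D.ideal) ≃ₐ[O] S :=
    (Ideal.quotientEquivAlgOfEq O hker).trans (Ideal.quotientKerAlgEquivOfSurjective hφ)
  have he : ∀ z : U.ring, e (Ideal.Quotient.mk D.ideal z) = φ z := fun z => rfl
  have hmap : (maximalIdeal U.ring).map (φ : U.ring →+* S) = maximalIdeal S := by
    refine le_antisymm (Ideal.map_le_iff_le_comap.2 fun z hz => U.ring.map_mem S φ hz) fun s hs => ?_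
    obtain ⟨z, rfl⟩ := hφ s
    refine Ideal.mem_map_of_mem (φ : U.ring →+* S) ?_
    by_contra hz
    have : IsUnit z := by simpa using hz
    exact hs (this.map φ)
  constructor
  · refine hS.smooth.of_algEquiv e.symm ?_
    rw [← hmap, Ideal.map_map]
    congr 1
    refine RingHom.ext fun z => ?_
    exact (e.symm_apply_apply _).symm.trans (congrArg e.symm (he z))
  · have := hS.isPrime
    have h1 : IsDomain (S ⧸ (maximalIdeal O).map (algebraMap O S)) := Ideal.Quotient.isDomain _
    refine HasPureDimension.of_ringEquiv (Ideal.quotientEquiv _ _ e.symm.toRingEquiv ?_) hS.dim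
    rw [Ideal.map_map]
    congr 1
    exact RingHom.ext fun z => (e.symm.commutes z).symm

/-- The points of the closed formal subscheme cut out by the kernel of `φ` are the homomorphisms
that factor through `S`. Conjugation preserves both the lifting condition and minimal ramification.
-/
theorem IsNormalForm.exists_localDeformationProblem [IsDomain O] [IsPrincipalIdealRing O]
    [IsAdicComplete (maximalIdeal O) O] [Finite (ResidueField O)] [IsFractionRing O E]
    {f : Fin n ≃. Fin n} {P Z b : Matrix (Fin n) (Fin n) O}
    (hN : IsNormalForm rhobar f P Z b) (h : IsTameDatum rhobar μ) (U : UniversalLifting rhobar μ) :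
    ∃ (D : LocalDeformationProblem U) (S : CompleteLocalAlg O) (x : Fin (n * n) → S)
      (φ : U.ring →ₐ[O] S), IsFormalAffineSpace (n * n) S x ∧ Function.Surjective φ ∧
      D.ideal = RingHom.ker φ ∧ ClassifiesMinimallyRamified E D := by
  obtain ⟨S, x, φ, hS, hφ, hclass⟩ := hN.exists_universal (E := E) h U
  have hpoints : ∀ (R : CompleteLocalAlg O) (ρ : TameGroup hq →* GG n R),
      ρ ∈ U.points (RingHom.ker φ) R ↔
        IsLifting rhobar μ R ρ ∧ IsMinimallyRamified E rhobar R ρ := by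
    intro R ρ
    rw [hclass]
    constructor
    · rintro ⟨g, hg, hgρ⟩
      refine ⟨Ideal.Quotient.liftₐ (RingHom.ker φ) g hg |>.comp
        (Ideal.quotientKerAlgEquivOfSurjective hφ).symm.toAlgHom, fun s => ?_⟩
      rw [← hgρ]
      congr 2
      refine RingHom.ext fun z => ?_
      have : (Ideal.quotientKerAlgEquivOfSurjective hφ).symm (φ z) =
          Ideal.Quotient.mk _ z := by
        rw [AlgEquiv.symm_apply_eq]
        rfl
      change Ideal.Quotient.liftₐ (RingHom.ker φ) g hg
        ((Ideal.quotientKerAlgEquivOfSurjective hφ).symm (φ z)) = g z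
      rw [this]
      rfl
    · rintro ⟨g, hg⟩
      refine ⟨g.comp φ, fun z hz => ?_, hg⟩
      change g (φ z) = 0
      rw [show φ z = 0 from hz, map_zero]
  refine ⟨⟨RingHom.ker φ, le_maximalIdeal (RingHom.ker_ne_top _), fun R ρ hρ y hy => ?_⟩,
    S, x, φ, hS, hφ, rfl, hpoints⟩
  rw [hpoints] at hρ ⊢
  exact ⟨hρ.1.conj y hy, hρ.2.conj h hρ.1 y hy⟩

end MinimalDeformationProblem

/-! ### The tangent space and its dimension -/

section TangentSpace

open IsLocalRing Matrix

theorem DualNumber.mem_maximalIdeal_iff {k : Type*} [Field k] {x : DualNumber k} :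
    x ∈ maximalIdeal (DualNumber k) ↔ x.fst = 0 := by
  rw [mem_maximalIdeal, mem_nonunits_iff, TrivSqZeroExt.isUnit_iff_isUnit_fst, isUnit_iff_ne_zero,
    not_not]

instance DualNumber.isAdicComplete {k : Type*} [Field k] :
    IsAdicComplete (maximalIdeal (DualNumber k)) (DualNumber k) :=
  { toIsHausdorff := inferInstance
    toIsPrecomplete := by
      refine IsPrecomplete.of_pow_le (I := ⊥) (e := 2) two_pos ?_ bot_le
      rw [pow_two, Ideal.mul_le]
      intro x hx y hy
      rw [DualNumber.mem_maximalIdeal_iff] at hx hy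
      rw [Ideal.mem_bot]
      ext <;> simp [hx, hy] }

/-- The dual numbers over the residue field, as an object of the category of complete Noetherian
local `O`-algebras. -/
noncomputable def CompleteLocalAlg.dualNumber (O : Type u) [CommRing O] [IsLocalRing O] :
    CompleteLocalAlg O :=
  mk' (DualNumber (ResidueField O))
    (fun o ho => DualNumber.mem_maximalIdeal_iff.2 ((residue_eq_zero_iff o).2 ho))
    (fun b => by
      obtain ⟨o, ho⟩ := residue_surjective b.fst
      refine ⟨o, DualNumber.mem_maximalIdeal_iff.2 ?_⟩
      rw [TrivSqZeroExt.fst_sub, ← ho]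
      exact sub_self _)

section EpsLift

variable {n : ℕ} {k : Type*} [Field k]

theorem map_fst_epsLift (X : Matrix (Fin n) (Fin n) k) (y : GG n k) :
    GG.map (TrivSqZeroExt.fstHom k k k).toRingHom (epsLift X y) = y := by
  rw [epsLift, map_mul, GG.map_ofGL]
  have h1 : GeneralLinearGroup.map (TrivSqZeroExt.fstHom k k k).toRingHom (oneAddEps X) = 1 := by
    ext i j
    change ((1 : Matrix (Fin n) (Fin n) (DualNumber k)) i j + TrivSqZeroExt.inr (X i j)).fst = _
    rw [TrivSqZeroExt.fst_add, TrivSqZeroExt.fst_inr, add_zero, Matrix.one_apply]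
    change _ = (1 : Matrix (Fin n) (Fin n) k) i j
    rw [Matrix.one_apply]
    split_ifs <;> rfl
  rw [h1, map_one, one_mul]
  rfl

theorem oneAddEps_injective : Function.Injective (oneAddEps (n := n) (k := k)) := by
  intro X Y h
  ext i j
  have h1 : ((1 : Matrix (Fin n) (Fin n) (DualNumber k)) i j + TrivSqZeroExt.inr (X i j)) =
    (1 : Matrix (Fin n) (Fin n) (DualNumber k)) i j + TrivSqZeroExt.inr (Y i j) :=
    congrArg (fun g : GL (Fin n) (DualNumber k) => (g : Matrix _ _ (DualNumber k)) i j) h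
  exact TrivSqZeroExt.inr_injective (add_left_cancel h1)

theorem epsLift_injective {X Y : Matrix (Fin n) (Fin n) k} {y z : GG n k}
    (h : epsLift X y = epsLift Y z) : X = Y ∧ y = z := by
  have h1 : y = z := by rw [← map_fst_epsLift X y, h, map_fst_epsLift]
  subst h1
  exact ⟨oneAddEps_injective (congrArg GG.gl (mul_right_cancel h)), rfl⟩

theorem oneAddEps_mul (X Y : Matrix (Fin n) (Fin n) k) :
    oneAddEps X * oneAddEps Y = oneAddEps (X + Y) := by
  refine Units.ext ?_
  change (1 + X.map TrivSqZeroExt.inr) * (1 + Y.map TrivSqZeroExt.inr) =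
    1 + (X + Y).map TrivSqZeroExt.inr
  have h : X.map (TrivSqZeroExt.inr : k → DualNumber k) * Y.map TrivSqZeroExt.inr = 0 := by
    ext i j <;> simp [Matrix.mul_apply]
  rw [add_mul, one_mul, mul_add, mul_one, h, Matrix.map_add _ (TrivSqZeroExt.inr_add k)]
  abel

theorem oneAddEps_zero : oneAddEps (0 : Matrix (Fin n) (Fin n) k) = 1 :=
  Units.ext (by
    change 1 + (0 : Matrix (Fin n) (Fin n) k).map TrivSqZeroExt.inr = 1
    rw [Matrix.map_zero _ (by simp), add_zero])

theorem oneAddEps_inv (X : Matrix (Fin n) (Fin n) k) : (oneAddEps X)⁻¹ = oneAddEps (-X) :=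
  inv_eq_of_mul_eq_one_right (by rw [oneAddEps_mul, add_neg_cancel, oneAddEps_zero])

theorem glContra_oneAddEps (X : Matrix (Fin n) (Fin n) k) :
    glContra n (DualNumber k) (oneAddEps X) = oneAddEps (-Xᵀ) := by
  refine Units.ext ?_
  change ((oneAddEps X)⁻¹ : GL (Fin n) (DualNumber k)).valᵀ = _
  rw [oneAddEps_inv]
  change (1 + (-X).map TrivSqZeroExt.inr)ᵀ = 1 + (-Xᵀ).map TrivSqZeroExt.inr
  rw [transpose_add, transpose_one]
  rfl

theorem conj_oneAddEps (g : GL (Fin n) k) (X : Matrix (Fin n) (Fin n) k) :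
    GeneralLinearGroup.map (TrivSqZeroExt.inlHom k k) g * oneAddEps X =
      oneAddEps ((g : Matrix (Fin n) (Fin n) k) * X * (↑g⁻¹ : Matrix (Fin n) (Fin n) k)) *
        GeneralLinearGroup.map (TrivSqZeroExt.inlHom k k) g := by
  have h1 : ∀ A B : Matrix (Fin n) (Fin n) k,
      A.map (TrivSqZeroExt.inl : k → DualNumber k) * B.map TrivSqZeroExt.inr =
        (A * B).map TrivSqZeroExt.inr := fun A B => by
    ext i j <;> simp [Matrix.mul_apply, -DualNumber.inr_eq_smul_eps, TrivSqZeroExt.fst_sum,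
      TrivSqZeroExt.snd_sum]
  have h2 : ∀ A B : Matrix (Fin n) (Fin n) k,
      A.map (TrivSqZeroExt.inr : k → DualNumber k) * B.map TrivSqZeroExt.inl =
        (A * B).map TrivSqZeroExt.inr := fun A B => by
    ext i j <;> simp [Matrix.mul_apply, -DualNumber.inr_eq_smul_eps, TrivSqZeroExt.fst_sum,
      TrivSqZeroExt.snd_sum, mul_comm]
  refine Units.ext ?_
  change (g : Matrix (Fin n) (Fin n) k).map TrivSqZeroExt.inl * (1 + X.map TrivSqZeroExt.inr) =
    (1 + ((g : Matrix (Fin n) (Fin n) k) * X * (↑g⁻¹ : Matrix (Fin n) (Fin n) k)).map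
      TrivSqZeroExt.inr) * (g : Matrix (Fin n) (Fin n) k).map TrivSqZeroExt.inl
  rw [mul_add, add_mul, mul_one, one_mul, h1, h2, mul_assoc _ _ (g : Matrix (Fin n) (Fin n) k),
    Units.inv_mul, mul_one]

theorem oneAddEps_sub_one_apply (X : Matrix (Fin n) (Fin n) k) (i j : Fin n) :
    (((oneAddEps X : Matrix (Fin n) (Fin n) (DualNumber k)) - 1) i j).fst = 0 := by
  change ((1 + X.map TrivSqZeroExt.inr - 1 : Matrix (Fin n) (Fin n) (DualNumber k)) i j).fst = 0
  rw [add_sub_cancel_left]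
  exact TrivSqZeroExt.fst_inr _ _

/-- The inclusion of `𝒢_n(k)` in `𝒢_n(k[ε])`. -/
noncomputable abbrev GG.inlEps : GG n k →* GG n (DualNumber k) :=
  GG.map (n := n) (R := k) (S := DualNumber k) (TrivSqZeroExt.inlHom k k)

/-- The element `1 + ε X` of `𝒢_n(k[ε])`. -/
noncomputable abbrev GG.ofEps (X : Matrix (Fin n) (Fin n) k) : GG n (DualNumber k) :=
  GG.ofGL (n := n) (R := DualNumber k) (oneAddEps X)

theorem GG.ofEps_mul (X Y : Matrix (Fin n) (Fin n) k) : ofEps X * ofEps Y = ofEps (X + Y) := by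
  rw [ofEps, ofEps, ofEps, ← oneAddEps_mul, map_mul]

theorem GG.ofEps_zero : ofEps (0 : Matrix (Fin n) (Fin n) k) = 1 := by
  rw [ofEps, oneAddEps_zero, map_one]

theorem GG.ofEps_inv (X : Matrix (Fin n) (Fin n) k) : (ofEps X)⁻¹ = ofEps (-X) := by
  rw [ofEps, ← map_inv, oneAddEps_inv]

/-- This is where the adjoint action enters: on the component of `𝔠`, the transposed inverse of `1 +
ε X` is `1 - ε Xᵀ`. -/
theorem GG.inlEps_mul_ofEps (y : GG n k) (X : Matrix (Fin n) (Fin n) k) :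
    inlEps y * ofEps X = ofEps (y.ad X) * inlEps y := by
  have hact : (conjDualAction n (DualNumber k) y.right (oneAddEps X, 1)) =
      (oneAddEps (if y.right = 1 then X else -Xᵀ), 1) := by
    by_cases hy : y.right = 1
    · rw [if_pos hy, hy, map_one]
      rfl
    · rw [if_neg hy]
      have h1 : conjDualAction n (DualNumber k) y.right = conjDual n (DualNumber k) := if_neg hy
      rw [h1]
      refine Prod.ext ?_ rfl
      change glScalar n (DualNumber k) 1 * glContra n (DualNumber k) (oneAddEps X) = _
      rw [map_one, one_mul, glContra_oneAddEps]
  refine SemidirectProduct.ext ?_ ?_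
  · change (GeneralLinearGroup.map (TrivSqZeroExt.inlHom k k) y.left.1,
        Units.map (TrivSqZeroExt.inlHom k k).toMonoidHom y.left.2) *
        (conjDualAction n (DualNumber k) y.right (oneAddEps X, 1)) =
      (oneAddEps (y.ad X), 1) * (conjDualAction n (DualNumber k) 1
        (GeneralLinearGroup.map (TrivSqZeroExt.inlHom k k) y.left.1,
        Units.map (TrivSqZeroExt.inlHom k k).toMonoidHom y.left.2))
    rw [hact, map_one]
    refine Prod.ext (conj_oneAddEps _ _) ?_
    change _ * 1 = 1 * _
    rw [mul_one, one_mul]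
    rfl
  · change y.right * 1 = 1 * y.right
    rw [mul_one, one_mul]

theorem epsLift_mul (X Y : Matrix (Fin n) (Fin n) k) (y z : GG n k) :
    epsLift X y * epsLift Y z = epsLift (X + y.ad Y) (y * z) := by
  change (GG.ofEps X * GG.inlEps y) * (GG.ofEps Y * GG.inlEps z) =
    GG.ofEps (X + y.ad Y) * GG.inlEps (y * z)
  rw [mul_assoc, ← mul_assoc (GG.inlEps y), GG.inlEps_mul_ofEps, ← GG.ofEps_mul, map_mul]
  simp only [mul_assoc]

/-- Coboundaries are the conjugates of the trivial lifting; the sign in `-X` produces `ad(y) X - X`.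
-/
theorem conj_epsLift_zero (X : Matrix (Fin n) (Fin n) k) (y : GG n k) :
    GG.ofEps (-X) * epsLift 0 y * (GG.ofEps (-X))⁻¹ = epsLift (y.ad X - X) y := by
  change GG.ofEps (-X) * (GG.ofEps 0 * GG.inlEps y) * (GG.ofEps (-X))⁻¹ =
    GG.ofEps (y.ad X - X) * GG.inlEps y
  rw [GG.ofEps_inv, neg_neg, GG.ofEps_zero, one_mul, mul_assoc, GG.inlEps_mul_ofEps, ← mul_assoc,
    GG.ofEps_mul, neg_add_eq_sub]

end EpsLift

/-- Rank and nullity of `X ↦ (g ↦ ad(r(g)) X - X)`, whose range consists of the coboundaries and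
whose kernel consists of the invariants. -/
theorem finrank_adB1_add_finrank_adH0 {Γ : Type} [Group Γ] {n : ℕ} {k : Type*} [Field k]
    (r : Γ →* GG n k) :
    Module.finrank k (adB1 r) + Module.finrank k (adH0 r) = n * n := by
  have h := LinearMap.finrank_range_add_finrank_ker (LinearMap.pi fun g => (r g).ad - LinearMap.id)
  rw [LinearMap.ker_pi, Module.finrank_matrix, Module.finrank_self, mul_one, Fintype.card_fin] at h
  exact h

variable {O : Type u} [CommRing O] [IsLocalRing O] {Γ : Type} [Group Γ] [TopologicalSpace Γ]
  {n : ℕ} {rbar : Γ →* GG n (ResidueField O)} {χ : Γ →* Oˣ}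

theorem IsLifting.exists_epsLift {R : CompleteLocalAlg O} {r : Γ →* GG n R}
    (h : IsLifting rbar χ R r) (f : R →ₐ[O] DualNumber (ResidueField O)) :
    ∃ X : Γ → Matrix (Fin n) (Fin n) (ResidueField O),
      ∀ g, GG.map f.toRingHom (r g) = epsLift (X g) (rbar g) := by
  have hred : ∀ z, (f z).fst = R.red z := fun z => DFunLike.congr_fun
    (R.algHom_eq_red ((TrivSqZeroExt.fstHom O _ _).comp f)) z
  refine ⟨fun g => ((r g).gl : Matrix (Fin n) (Fin n) R).map (fun z => (f z).snd) *
    (↑(rbar g).gl⁻¹ : Matrix (Fin n) (Fin n) (ResidueField O)), fun g => ?_⟩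
  obtain ⟨h1, h2, h3⟩ := (map_eq_epsLift_iff _ _ _ _).1 (h.map_inl_red g)
  rw [map_eq_epsLift_iff]
  refine ⟨fun i j => ?_, ?_, h3⟩
  · have h4 := congrArg TrivSqZeroExt.fst (h1 i j)
    rw [mul_assoc, Units.inv_mul, mul_one]
    refine TrivSqZeroExt.ext ?_ ?_
    · refine (hred _).trans (Eq.trans ?_ (h4.trans ?_))
      · rfl
      · simp
    · simp
  -- The similitude is prescribed by a character with values in `O`, so the `GL_1`-component comes
  -- from `O` and acquires no `ε`-part.
  · have h4 : ∃ o, algebraMap O R o = (r g).left.2 := by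
      have h5 : (r g).left.2 * Units.map (Int.castRingHom R).toMonoidHom (r g).right =
        Units.map (algebraMap O R).toMonoidHom (χ g) := h.similitude g
      rcases Int.units_eq_one_or (r g).right with h6 | h6
      · rw [h6, map_one, mul_one] at h5
        exact ⟨χ g, (congrArg Units.val h5).symm⟩
      · refine ⟨-χ g, ?_⟩
        have h7 := congrArg Units.val h5
        rw [h6] at h7
        simp only [Units.val_mul, Units.coe_map] at h7
        rw [map_neg, neg_eq_iff_eq_neg]
        refine h7.symm.trans ?_
        simp
    obtain ⟨o, ho⟩ := h4
    rw [← ho] at h2 ⊢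
    refine Eq.trans ?_ h2
    change f (algebraMap O R o) = TrivSqZeroExt.inl (R.red (algebraMap O R o))
    rw [AlgHom.commutes, AlgHom.commutes]
    rfl

theorem IsLifting.mem_adZ1 {R : CompleteLocalAlg O} {r : Γ →* GG n R}
    (h : IsLifting rbar χ R r) (f : R →ₐ[O] DualNumber (ResidueField O))
    {X : Γ → Matrix (Fin n) (Fin n) (ResidueField O)}
    (hX : ∀ g, GG.map f.toRingHom (r g) = epsLift (X g) (rbar g)) [Finite (ResidueField O)] :
    X ∈ adZ1 rbar := by
  constructor
  · rw [IsLocallyConstant.iff_exists_open]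
    intro g
    let S := CompleteLocalAlg.dualNumber O
    let r' : Γ →* GG n S := (GG.map f.toRingHom).comp r
    let : TopologicalSpace S := (maximalIdeal S).adicTopology
    have hc : Continuous r' := (h.map (S := S) f).continuous
    have h1 : T2Space S := t2Space_adic
    have h2 : Finite S :=
      inferInstanceAs (Finite (ResidueField O × ResidueField O))
    have h3 : T2Space (GG n S) := GG.t2Space
    have h4 : Finite (GL (Fin n) S) := inferInstance
    have h5 : Finite (GG n S) := Finite.of_equiv _ SemidirectProduct.equivProd.symm
    -- A finite Hausdorff space is discrete, so continuity of the lifting makes the cocycle locally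
    -- constant.
    have h6 : DiscreteTopology (GG n S) := inferInstance
    refine ⟨r' ⁻¹' {r' g}, (isOpen_discrete _).preimage hc, rfl, fun x hx => ?_⟩
    exact (epsLift_injective ((hX x).symm.trans (Eq.trans hx (hX g)))).1
  · intro g g'
    have h1 := hX (g * g')
    rw [map_mul, map_mul, hX, hX, epsLift_mul] at h1
    exact (epsLift_injective h1).1.symm

theorem UniversalLifting.algHom_ext (U : UniversalLifting rbar χ) {R : CompleteLocalAlg O}
    {f g : U.ring →ₐ[O] R}
    (h : ∀ s, GG.map f.toRingHom (U.lift s) = GG.map g.toRingHom (U.lift s)) : f = g :=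
  (U.universal R _ (U.isLifting.map g)).unique h fun _ => rfl

namespace LocalDeformationProblem

variable {U : UniversalLifting rbar χ} (D : LocalDeformationProblem U) [Finite (ResidueField O)]

/-- A homomorphism `S → k[ε]` sends the coordinates to arbitrary elements `ε a i`, and those
homomorphisms correspond to the cocycles. As `k` is finite, counting already determines the
dimension, and linearity of this bijection is not needed. -/
theorem natCard_cocycles {N : ℕ} {S : CompleteLocalAlg O} {x : Fin N → S}
    (hS : IsFormalAffineSpace N S x) {φ : U.ring →ₐ[O] S} (hφ : Function.Surjective φ)
    (hker : D.ideal = RingHom.ker φ) :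
    Nat.card D.cocycles = Nat.card (ResidueField O) ^ N := by
  let T := CompleteLocalAlg.dualNumber O
  have hex : ∀ a : Fin N → ResidueField O, ∃ (f : S →ₐ[O] T) (c : D.cocycles),
      (∀ i, f (x i) = (TrivSqZeroExt.inr (a i) : DualNumber (ResidueField O))) ∧
      ∀ s, GG.map (f.comp φ).toRingHom (U.lift s) = epsLift (c.1.1 s) (rbar s) := by
    intro a
    obtain ⟨f, hf⟩ := hS.exists_algHom T (fun i => (TrivSqZeroExt.inr (a i) : DualNumber _))
      fun i => DualNumber.mem_maximalIdeal_iff.2 (TrivSqZeroExt.fst_inr _ _)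
    obtain ⟨X, hX⟩ := U.isLifting.exists_epsLift (f.comp φ)
    refine ⟨f, ⟨⟨X, U.isLifting.mem_adZ1 (f.comp φ) hX⟩, f.comp φ, fun z hz => ?_, hX⟩, hf, hX⟩
    rw [hker] at hz
    change f (φ z) = 0
    rw [show φ z = 0 from hz, map_zero]
  choose F c hF hc using hex
  have hbij : Function.Bijective c := by
    constructor
    · intro a b hab
      have h1 : (F a).comp φ = (F b).comp φ := U.algHom_ext (R := T) fun s => by
        rw [hc, hc, hab]
      have h2 : F a = F b := AlgHom.ext fun s => by
        obtain ⟨z, rfl⟩ := hφ s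
        exact DFunLike.congr_fun h1 z
      funext i
      have h3 := hF a i
      rw [h2, hF] at h3
      exact (TrivSqZeroExt.inr_injective h3).symm
    · rintro ⟨⟨X, hXZ⟩, f, hf, hfX⟩
      rw [hker] at hf
      let g : S →ₐ[O] T := (Ideal.Quotient.liftₐ (RingHom.ker φ) f hf).comp
        (Ideal.quotientKerAlgEquivOfSurjective hφ).symm.toAlgHom
      have hg : ∀ z, g (φ z) = f z := by
        intro z
        have : (Ideal.quotientKerAlgEquivOfSurjective hφ).symm (φ z) =
            Ideal.Quotient.mk _ z := by
          rw [AlgEquiv.symm_apply_eq]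
          rfl
        change Ideal.Quotient.liftₐ (RingHom.ker φ) f hf
          ((Ideal.quotientKerAlgEquivOfSurjective hφ).symm (φ z)) = f z
        rw [this]
        rfl
      let y : Fin N → DualNumber (ResidueField O) := fun i => g (x i)
      have hy : ∀ i, y i = TrivSqZeroExt.inr (y i).snd := fun i => by
        have h1 : (y i).fst = 0 :=
          DualNumber.mem_maximalIdeal_iff.1 (S.map_mem T g (hS.mem i))
        refine TrivSqZeroExt.ext ?_ ?_
        · rw [h1, TrivSqZeroExt.fst_inr]
        · rw [TrivSqZeroExt.snd_inr]
      have hgF : F (fun i => (y i).snd) = g := hS.algHom_ext T _ _ fun i => by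
        rw [hF]
        exact (hy i).symm
      refine ⟨fun i => (y i).snd, Subtype.ext (Subtype.ext (funext fun s => ?_))⟩
      have h1 := hc (fun i => (y i).snd) s
      have h2 : (F fun i => (y i).snd).comp φ = f := by
        rw [hgF]
        exact AlgHom.ext hg
      rw [h2] at h1
      exact (epsLift_injective (h1.symm.trans (hfX s))).1
  rw [← Nat.card_congr (Equiv.ofBijective c hbij), Nat.card_fun, Nat.card_fin]

/-- The trivial lifting is a point of `𝒟`, and `𝒟` is stable under conjugation by `1 - ε X`. -/
theorem mem_cocycles_of_mem_adB1 {ψ : Γ → Matrix (Fin n) (Fin n) (ResidueField O)}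
    (hψ : ψ ∈ adB1 rbar) : ∃ h : ψ ∈ adZ1 rbar, (⟨ψ, h⟩ : adZ1 rbar) ∈ D.cocycles := by
  obtain ⟨X, rfl⟩ := hψ
  obtain ⟨f₀, hf₀, hf₀'⟩ := D.cocycles.zero_mem
  let T := CompleteLocalAlg.dualNumber O
  obtain ⟨f, hf, hf'⟩ := D.stable T ((GG.map (f₀ : U.ring →ₐ[O] T).toRingHom).comp U.lift)
    ⟨f₀, hf₀, fun _ => rfl⟩ (oneAddEps (-X)) fun i j =>
      DualNumber.mem_maximalIdeal_iff.2 (oneAddEps_sub_one_apply (-X) i j)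
  have h1 : ∀ g, GG.map f.toRingHom (U.lift g) =
      epsLift (LinearMap.pi (fun g => (rbar g).ad - LinearMap.id) X g) (rbar g) := by
    intro g
    rw [hf']
    refine Eq.trans ?_ (conj_epsLift_zero X (rbar g))
    exact congrArg (fun y => GG.ofEps (-X) * y * (GG.ofEps (-X))⁻¹) (hf₀' g)
  exact ⟨U.isLifting.mem_adZ1 (f : U.ring →ₐ[O] DualNumber (ResidueField O)) h1, f, hf, h1⟩

/-- The cocycles of `𝒟` have dimension `n * n = dim B¹ + dim H⁰` and contain the coboundaries, which
are the kernel of the projection to `H¹`. -/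
theorem rank_tangentSpace {S : CompleteLocalAlg O} {x : Fin (n * n) → S}
    (hS : IsFormalAffineSpace (n * n) S x) {φ : U.ring →ₐ[O] S} (hφ : Function.Surjective φ)
    (hker : D.ideal = RingHom.ker φ) :
    Module.rank (ResidueField O) D.tangentSpace = Module.rank (ResidueField O) (adH0 rbar) := by
  have hcard := D.natCard_cocycles hS hφ hker
  have : Finite D.cocycles := Nat.finite_of_card_ne_zero (by
    rw [hcard]
    exact pow_ne_zero _ Nat.card_pos.ne')
  have hfin : Module.Finite (ResidueField O) D.cocycles := Module.Finite.of_finite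
  have hN : Module.finrank (ResidueField O) D.cocycles = n * n := by
    rw [Module.natCard_eq_pow_finrank (K := ResidueField O)] at hcard
    exact Nat.pow_right_injective Finite.one_lt_card hcard
  have hB1 : adB1 rbar ≤ adZ1 rbar := fun ψ hψ => (D.mem_cocycles_of_mem_adB1 hψ).1
  have hB : (adB1 rbar).submoduleOf (adZ1 rbar) ≤ D.cocycles := fun ψ hψ =>
    (D.mem_cocycles_of_mem_adB1 hψ).2
  have h1 := LinearMap.finrank_range_add_finrank_ker (K := ResidueField O) (V := D.cocycles)
    (((adB1 rbar).submoduleOf (adZ1 rbar)).mkQ.domRestrict D.cocycles)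
  rw [LinearMap.range_domRestrict, LinearMap.ker_domRestrict, Submodule.ker_mkQ, hN,
    (Submodule.comapSubtypeEquivOfLe hB).finrank_eq,
    (Submodule.submoduleOfEquivOfLe hB1).finrank_eq, ← finrank_adB1_add_finrank_adH0 rbar,
    add_comm, Nat.add_left_cancel_iff] at h1
  have : Module.Finite (ResidueField O) D.tangentSpace := by
    rw [LocalDeformationProblem.tangentSpace, ← LinearMap.range_domRestrict]
    infer_instance
  rw [← Module.finrank_eq_rank, ← Module.finrank_eq_rank]
  exact congrArg _ h1

end LocalDeformationProblem

end TangentSpace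
-- The theorem for the ring of integers of `E`
theorem mainTheorem8 (ℓ : ℕ) [Fact ℓ.Prime] (hℓ : Odd ℓ)
    (E : Type u) [Field E] [Algebra ℚ_[ℓ] E] [FiniteDimensional ℚ_[ℓ] E]
    (q : ℕ) (hq : q.Coprime ℓ) (n : ℕ) (hn : 1 ≤ n) (hnℓ : n ≤ ℓ)
    (rhobar : TameGroup hq →* GG n (IsLocalRing.ResidueField (padicIntegers ℓ E)))
    (μ : TameGroup hq →* (padicIntegers ℓ E)ˣ)
    (hrhobar : AdicContinuous rhobar) (hμ : AdicContinuousChar μ)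
    (hker : (GG.identityPart n (IsLocalRing.ResidueField (padicIntegers ℓ E))).comap rhobar =
      TameGroup.powSubgroup hq 2)
    (hnu : ∀ g, (rhobar g).nu = Units.map
      (IsLocalRing.residue (padicIntegers ℓ E)).toMonoidHom (μ g))
    (hμt : μ (TameGroup.t hq) = 1) :
    Nonempty (UniversalLifting rhobar μ) ∧
    ∀ U : UniversalLifting rhobar μ, ∃ D : LocalDeformationProblem U,
      ClassifiesMinimallyRamified E D ∧
      D.IsFormallySmooth (n ^ 2) ∧
      Module.rank (IsLocalRing.ResidueField (padicIntegers ℓ E)) D.tangentSpace =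
        Module.rank (IsLocalRing.ResidueField (padicIntegers ℓ E)) (adH0 rhobar) := by
  have h : IsTameDatum rhobar μ :=
    ⟨hrhobar, hμ, hker, hnu, hμt, padicIntegers.natCast_mem_maximalIdeal ℓ E⟩
  refine ⟨h.nonempty_universalLifting, fun U => ?_⟩
  obtain ⟨f, P, Z, b, hN⟩ := h.exists_isNormalForm hn hnℓ
  obtain ⟨D, S, x, φ, hS, hφ, hker, hD⟩ := hN.exists_localDeformationProblem (E := E) h U
  exact ⟨D, hD, (pow_two n).symm ▸ hS.isFormallySmooth D hφ hker, D.rank_tangentSpace hS hφ hker⟩
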